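/- An instance of \textsc{Subset Feedback Arc Set in Tournaments} (SFAST) consists of a finite tournament $D$, a set $T\subseteq V(D)$ of terminals, and an integer $k\ge 0$ (the parameter, encoded in binary). A set $S\subseteq A(D)$ is a $T$-feedback arc set if $D-S$ has no directed cycle through a vertex of $T$; the instance is a yes-instance if there is a $T$-feedback arc set of size at most $k$. A kernelization with vertex bound $f$ is a polynomial-time algorithm that maps every instance $(D,T,k)$ to an instance $(D',T',k')$ such that $(D',T',k')$ is a yes-instance if and only if $(D,T,k)$ is one, $k'\le k$, and $|V(D')|<f(k)$. For real $\alpha\ge 1$ put $$B(\alpha,k)=6\alpha(3\alpha+5)k^2+(21\alpha+13)k+6 .$$ \textbf{Theorem.} (1) Let $\alpha\ge1$ be a real number. Suppose that there is a polynomial-time algorithm that, given a tournament $D$ and $T\subseteq V(D)$, outputs a $T$-feedback arc set of size at most $\alpha$ times the minimum size of a $T$-feedback arc set. Then SFAST has a kernelization with vertex bound $f(k)=B(\alpha,k)$. (2) More generally, the ratio may depend on the parameter: let $\alpha\colon\mathbb N\to[1,\infty)$ and suppose that there is a polynomial-time algorithm that, given an instance $(D,T,k)$, either outputs a $T$-feedback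 arc set of size at most $\alpha(k)k$ or correctly reports that there is no $T$-feedback arc set of size at most $k$. Then SFAST has a kernelization with vertex bound $f(k)=B(\alpha(k),k)$. (3) $B(\alpha,k)=O((\alpha k)^2)$: there is an absolute constant $C$ with $B(\alpha,k)\le C(\alpha k)^2$ for all real $\alpha\ge1$ and all integers $k\ge1$. -/

import Mathlib

namespace SFAST

/-! ### A model of computation with a step count

Structured `while` programs over finitely many variables that hold binary trees. Every elementary
operation is charged the total size of its operands, so that one unit of cost is a bounded amount of
work of a multi-tape Turing machine up to polynomial overhead, and conversely. -/

/-- Data: finite binary trees. -/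
inductive Dat : Type
  | nil : Dat
  | cons (a b : Dat) : Dat

/-- The number of nodes (leaves included) of a tree. -/
def Dat.size : Dat → ℕ
  | .nil => 1
  | .cons a b => a.size + b.size + 1

/-- The left subtree (`nil` for a leaf). -/
def Dat.left : Dat → Dat
  | .nil => .nil
  | .cons a _ => a

/-- The right subtree (`nil` for a leaf). -/
def Dat.right : Dat → Dat
  | .nil => .nil
  | .cons _ b => b

/-- Programs. Variables are named by natural numbers; a program mentions only finitely many. -/
inductive Prog : Type
  /-- `x := nil` -/
  | clear (x : ℕ) : Prog
  /-- `x := y` -/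
  | copy (x y : ℕ) : Prog
  /-- `x := cons y z` -/
  | cons (x y z : ℕ) : Prog
  /-- `x := left y` -/
  | left (x y : ℕ) : Prog
  /-- `x := right y` -/
  | right (x y : ℕ) : Prog
  /-- `P; Q` -/
  | seq (P Q : Prog) : Prog
  /-- `if x ≠ nil then P else Q` -/
  | ite (x : ℕ) (P Q : Prog) : Prog
  /-- `while x ≠ nil do P` -/
  | loop (x : ℕ) (P : Prog) : Prog

/-- The contents of the variables. -/
abbrev Store := ℕ → Dat

/-- `Exec P s s' t`: started in the store `s`, the program `P` halts in the store `s'` after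
`t` steps. -/
inductive Exec : Prog → Store → Store → ℕ → Prop
  | clear (s : Store) (x : ℕ) :
      Exec (.clear x) s (Function.update s x .nil) 1
  | copy (s : Store) (x y : ℕ) :
      Exec (.copy x y) s (Function.update s x (s y)) ((s y).size + 1)
  | cons (s : Store) (x y z : ℕ) :
      Exec (.cons x y z) s (Function.update s x (.cons (s y) (s z)))
        ((s y).size + (s z).size + 1)
  | left (s : Store) (x y : ℕ) :
      Exec (.left x y) s (Function.update s x (s y).left) ((s y).size + 1)
  | right (s : Store) (x y : ℕ) :
      Exec (.right x y) s (Function.update s x (s y).right) ((s y).size + 1)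
  | seq {P Q : Prog} {s₁ s₂ s₃ : Store} {t u : ℕ}
      (hP : Exec P s₁ s₂ t) (hQ : Exec Q s₂ s₃ u) :
      Exec (.seq P Q) s₁ s₃ (t + u)
  | ite_true {x : ℕ} {P Q : Prog} {s₁ s₂ : Store} {t : ℕ}
      (hx : s₁ x ≠ .nil) (hP : Exec P s₁ s₂ t) :
      Exec (.ite x P Q) s₁ s₂ (t + 1)
  | ite_false {x : ℕ} {P Q : Prog} {s₁ s₂ : Store} {t : ℕ}
      (hx : s₁ x = .nil) (hQ : Exec Q s₁ s₂ t) :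
      Exec (.ite x P Q) s₁ s₂ (t + 1)
  | loop_done {x : ℕ} {P : Prog} {s : Store}
      (hx : s x = .nil) :
      Exec (.loop x P) s s 1
  | loop_step {x : ℕ} {P : Prog} {s₁ s₂ s₃ : Store} {t u : ℕ}
      (hx : s₁ x ≠ .nil) (hP : Exec P s₁ s₂ t) (hL : Exec (.loop x P) s₂ s₃ u) :
      Exec (.loop x P) s₁ s₃ (t + u + 1)

/-- The initial store: the input is in variable `0`, all other variables are `nil`. -/
def initial (d : Dat) : Store := Function.update (fun _ => Dat.nil) 0 d

/-- On every input `i` (encoded by `enc`) the program `P` halts within a number of steps polynomial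
in the size of the encoded input, and the content `d` of variable `0` at the end satisfies
`Correct i d`. -/
def RunsInPolyTime {ι : Type} (enc : ι → Dat) (P : Prog) (Correct : ι → Dat → Prop) : Prop :=
  ∃ p : Polynomial ℕ, ∀ i : ι, ∃ (s : Store) (t : ℕ),
    Exec P (initial (enc i)) s t ∧ t ≤ p.eval (enc i).size ∧ Correct i (s 0)

/-! ### Encodings -/

/-- A bit. -/
def encBool : Bool → Dat
  | false => .nil
  | true => .cons .nil .nil

/-- A list. -/
def encList {ι : Type} (enc : ι → Dat) : List ι → Dat
  | [] => .nil
  | a :: l => .cons (enc a) (encList enc l)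

/-- A natural number, in binary. -/
def encNat (k : ℕ) : Dat := encList encBool k.bits

/-- A `0`-`1` vector. -/
def encVec {n : ℕ} (v : Fin n → Bool) : Dat := encList encBool (List.ofFn v)

/-- A square `0`-`1` matrix, row by row. -/
def encMat {n : ℕ} (M : Fin n → Fin n → Bool) : Dat :=
  encList (encList encBool) (List.ofFn fun i => List.ofFn (M i))

/-! ### Subset feedback arc sets in tournaments -/

/-- A tournament on the vertices `0, …, n - 1`: there are no loops, and there is exactly one arc
between any two distinct vertices. -/
structure Tournament (n : ℕ) where
  arc : Fin n → Fin n → Bool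
  loopless : ∀ u, arc u u = false
  exactly_one : ∀ u v, u ≠ v → (arc u v = true ↔ arc v u = false)

/-- `c` is a directed cycle (with pairwise distinct vertices) of the digraph with arc relation `R`
that contains a vertex of `T`. The digraphs below have no loops, so cycles have length at
least two. -/
def IsTCycle {V : Type} (R : V → V → Prop) (T : Finset V) (c : Cycle V) : Prop :=
  c.Nodup ∧ c.Chain R ∧ ∃ t ∈ T, t ∈ c

/-- A tournament with a set of terminals. -/
structure TerminalTournament where
  n : ℕ
  D : Tournament n
  T : Finset (Fin n)

/-- `S` is a set of arcs such that no directed cycle through a terminal remains when `S`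
is removed. -/
def TerminalTournament.IsFeedback (G : TerminalTournament) (S : Finset (Fin G.n × Fin G.n)) :
    Prop :=
  (∀ e ∈ S, G.D.arc e.1 e.2 = true) ∧
    ∀ c : Cycle (Fin G.n), ¬ IsTCycle (fun u v => G.D.arc u v = true ∧ (u, v) ∉ S) G.T c

/-- An instance of the decision problem; the parameter is `k`. -/
structure Instance extends TerminalTournament where
  k : ℕ

/-- There is a feedback arc set (with respect to the terminals) of size at most `k`. -/
def Instance.IsYes (X : Instance) : Prop :=
  ∃ S : Finset (Fin X.n × Fin X.n), X.toTerminalTournament.IsFeedback S ∧ S.card ≤ X.k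

/-- Adjacency matrix and characteristic vector of the terminals. -/
def encGraph (G : TerminalTournament) : Dat :=
  .cons (encMat G.D.arc) (encVec fun v => decide (v ∈ G.T))

def encInstance (X : Instance) : Dat :=
  .cons (encGraph X.toTerminalTournament) (encNat X.k)

/-- A set of ordered pairs, as a `0`-`1` matrix. -/
def encArcs {n : ℕ} (S : Finset (Fin n × Fin n)) : Dat :=
  encMat fun u v => decide ((u, v) ∈ S)

/-! ### Approximation algorithms and kernelizations -/

/-- There is a polynomial-time algorithm that finds a feedback arc set whose size is at most `α`
times the size of every feedback arc set, hence at most `α` times the minimum. -/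
def HasApproximation (α : ℝ) : Prop :=
  ∃ P : Prog, RunsInPolyTime encGraph P fun G d =>
    ∃ S : Finset (Fin G.n × Fin G.n), d = encArcs S ∧ G.IsFeedback S ∧
      ∀ S' : Finset (Fin G.n × Fin G.n), G.IsFeedback S' → (S.card : ℝ) ≤ α * S'.card

/-- The version in which the ratio `α k` depends on the parameter: there is a polynomial-time
algorithm that, given an instance with parameter `k`, finds a feedback arc set of size at most
`α k * k`, or reports (by the output `nil`), correctly, that there is none of size at most `k`. -/
def HasParamApproximation (α : ℕ → ℝ) : Prop :=
  ∃ P : Prog, RunsInPolyTime encInstance P fun X d =>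
    (∃ S : Finset (Fin X.n × Fin X.n), d = .cons (encArcs S) .nil ∧
      X.toTerminalTournament.IsFeedback S ∧ (S.card : ℝ) ≤ α X.k * X.k) ∨
    (d = .nil ∧ ¬ X.IsYes)

/-- There is a polynomial-time algorithm that maps every instance with parameter `k` to an
equivalent instance whose parameter is at most `k` and that has fewer than `f k` vertices. -/
def HasKernel (f : ℕ → ℝ) : Prop :=
  ∃ P : Prog, RunsInPolyTime encInstance P fun X d =>
    ∃ Y : Instance, d = encInstance Y ∧ (Y.IsYes ↔ X.IsYes) ∧ Y.k ≤ X.k ∧ (Y.n : ℝ) < f X.k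

/-- The bound `6 α (3 α + 5) k² + (21 α + 13) k + 6`. -/
def kernelBound (α : ℝ) (k : ℕ) : ℝ :=
  6 * α * (3 * α + 5) * (k : ℝ) ^ 2 + (21 * α + 13) * k + 6

end SFAST

/-!
# Kernels for subset feedback arc set in tournaments from approximation algorithms

**Layerings.** There is a set of at most `k` arcs that meets all cycles through terminals if and
only if the vertices can be assigned to layers such that every terminal is alone in its layer and at
most `k` arcs lead to an earlier layer (`Instance.isYes_iff`). All arguments about solutions are about such
layerings (`Solvable`), and most rest on one count: if every vertex of a set `Z` has a backward arc
to or from a vertex outside of `Z`, then there are at least `|Z|` backward arcs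
(`card_le_card_backArcs`).

**Rewiring.** Call two nonterminals equivalent if they have the same in-neighbours among the
terminals. The core of a class consists of its members with more than `k` in-neighbours and more
than `k` out-neighbours in the class. In a tournament at most `2k + 1` vertices have at most `k`
in-neighbours, so a class with a core of at most `2k + 4` vertices has at most `6k + 6` members
(`cnt_class_le`). In every layering with at most `k` backward arcs the core can be gathered in a
single layer (`exists_layering_core_const`), so that only the numbers of arcs between a vertex and
the core matter, and of these only the part up to `k + 1`. A larger core is therefore replaced by
`2k + 4` of its vertices, with the numbers of arcs to and from the other vertices preserved up to
that threshold (`solvable_newKeep_iff`). Repeating this makes all classes small. It uses no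
approximate solution, and it does not increase the number of vertices or change the parameter.

**Deletion.** Let `S` be the approximate solution of the rewired instance and `s` its size. A
vertex is kept if it is an end of an arc in `S`, or if its class may share a layer with a
nonterminal end of such an arc, or if it is one of `3k + 3` witnesses selected for an arc in `S`,
vertices that form triangles with the arc. The other vertices can be put back into any solution
one at a time (`solvable_keep_iff`): either many members of the class of `v` are present, and `v`
joins one that is in no backward arc with a vertex outside of the class, or the witnesses force every
arc of `S` that forms a triangle with `v` to be a backward arc, and the solution can be rearranged
around `v` at no cost. At most two classes are kept for each arc of `S`, and hence at most
`15sk + 17s` vertices (`cnt_keep_le`).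

With `s ≤ α(k) k` this is below `15 α(k) k² + 17 α(k) k + 4`, which is at most the claimed bound. If
the approximation algorithm reports that there is no solution, the output is a directed triangle.
An approximation algorithm for the minimum is used with the integral ratio `⌈α⌉ ≤ α + 1`, so that
the size of its output can be compared with the parameter exactly.

**Programs.** `PolyTime enc f` says that the function `f` of inputs encoded by `enc` is computed in
polynomial time by a program that can be used as a subroutine. Closure under composition, pairing,
branching and folds over lists (`PolyTime.foldl`) yields maps, filters, counting in unary and
bounded quantifiers, in terms of which the transformation is written. The parameter is given in
binary; the computation uses its minimum with the square of the number of vertices, in unary, which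
does not affect the answer (`Instance.isYes_iff_min`).
-/

namespace SFAST

/-! ### Programs: frame property and output size -/

/-- All variables of the program are smaller than this number. -/
def Prog.bound : Prog → ℕ
  | .clear x => x + 1
  | .copy x y => max x y + 1
  | .cons x y z => max x (max y z) + 1
  | .left x y => max x y + 1
  | .right x y => max x y + 1
  | .seq P Q => max P.bound Q.bound
  | .ite x P Q => max (x + 1) (max P.bound Q.bound)
  | .loop x P => max (x + 1) P.bound

/-- The store that agrees with `s` below `N` and with `r` from `N` on. -/
def Store.mix (N : ℕ) (s r : Store) : Store := fun x => if x < N then s x else r x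

theorem Store.mix_update {N x : ℕ} {s r : Store} (hr : ∀ y < N, r y = s y) (hx : x < N) (v : Dat) :
    Store.mix N (Function.update s x v) r = Function.update r x v := by
  funext y
  unfold Store.mix
  by_cases h : y = x
  · subst h; simp [hx]
  · by_cases hy : y < N
    · simp [h, hy, hr y hy]
    · simp [h, hy]

/-- A program neither reads nor writes variables beyond its bound. -/
theorem Exec.frame {P : Prog} {s s' : Store} {t N : ℕ} (h : Exec P s s' t) (hN : P.bound ≤ N)
    (r : Store) (hr : ∀ x < N, r x = s x) : Exec P r (Store.mix N s' r) t := by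
  induction h generalizing r with
  | clear s x =>
    rw [Store.mix_update hr (by simp [Prog.bound] at hN; omega)]
    exact .clear r x
  | copy s x y =>
    simp only [Prog.bound] at hN
    rw [Store.mix_update hr (by omega), ← hr y (by omega)]
    exact .copy r x y
  | cons s x y z =>
    simp only [Prog.bound] at hN
    rw [Store.mix_update hr (by omega), ← hr y (by omega), ← hr z (by omega)]
    exact .cons r x y z
  | left s x y =>
    simp only [Prog.bound] at hN
    rw [Store.mix_update hr (by omega), ← hr y (by omega)]
    exact .left r x y
  | right s x y =>
    simp only [Prog.bound] at hN
    rw [Store.mix_update hr (by omega), ← hr y (by omega)]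
    exact .right r x y
  | @seq P Q s₁ s₂ s₃ t u hP hQ ihP ihQ =>
    simp only [Prog.bound] at hN
    have h1 := ihP (by omega) r hr
    have h2 := ihQ (by omega) (Store.mix N s₂ r) (fun x hx => by simp [Store.mix, hx])
    have : Store.mix N s₃ (Store.mix N s₂ r) = Store.mix N s₃ r := by
      funext x; simp only [Store.mix]; split_ifs <;> rfl
    rw [this] at h2
    exact .seq h1 h2
  | @ite_true x P Q s₁ s₂ t hx hP ih =>
    simp only [Prog.bound] at hN
    exact .ite_true (by rwa [hr x (by omega)]) (ih (by omega) r hr)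
  | @ite_false x P Q s₁ s₂ t hx hP ih =>
    simp only [Prog.bound] at hN
    exact .ite_false (by rwa [hr x (by omega)]) (ih (by omega) r hr)
  | @loop_done x P s hx =>
    simp only [Prog.bound] at hN
    have : Store.mix N s r = r := by
      funext y; simp only [Store.mix]; split_ifs with hy
      · exact (hr y hy).symm
      · rfl
    rw [this]
    exact .loop_done (by rwa [hr x (by omega)])
  | @loop_step x P s₁ s₂ s₃ t u hx hP hL ihP ihL =>
    have hN' := hN
    simp only [Prog.bound] at hN
    have h1 := ihP (by omega) r hr
    have h2 := ihL hN' (Store.mix N s₂ r) (fun x hx => by simp [Store.mix, hx])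
    have : Store.mix N s₃ (Store.mix N s₂ r) = Store.mix N s₃ r := by
      funext x; simp only [Store.mix]; split_ifs <;> rfl
    rw [this] at h2
    exact .loop_step (by rwa [hr x (by omega)]) h1 h2

theorem Exec.clear' {s s' : Store} {x : ℕ} (h : Function.update s x .nil = s') :
    Exec (.clear x) s s' 1 := h ▸ .clear s x

theorem Dat.size_left_le (d : Dat) : d.left.size ≤ d.size := by
  cases d with
  | nil => simp [Dat.left]
  | cons a b => simp [Dat.left, Dat.size]; omega

theorem Dat.size_right_le (d : Dat) : d.right.size ≤ d.size := by
  cases d with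
  | nil => simp [Dat.right]
  | cons a b => simp [Dat.right, Dat.size]; omega

/-- The time is charged for every node that is written. -/
theorem Exec.size_le {P : Prog} {s s' : Store} {t : ℕ} (h : Exec P s s' t) (x : ℕ) :
    (s' x).size ≤ (s x).size + t := by
  induction h with
  | clear s y =>
    by_cases h : x = y
    · subst h; simp [Dat.size]
    · simp [h]
  | copy s y z =>
    by_cases h : x = y
    · subst h; simp
      omega
    · simp [h]
  | cons s y z w =>
    by_cases h : x = y
    · subst h; simp [Dat.size]
    · simp [h]
  | left s y z =>
    have := (s z).size_left_le
    by_cases h : x = y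
    · subst h; simp; omega
    · simp [h]
  | right s y z =>
    have := (s z).size_right_le
    by_cases h : x = y
    · subst h; simp; omega
    · simp [h]
  | seq _ _ ih1 ih2 => omega
  | ite_true _ _ ih => omega
  | ite_false _ _ ih => omega
  | loop_done _ => omega
  | loop_step _ _ _ ih1 ih2 => omega

/-! ### Functions computable in polynomial time -/

theorem polyEval_mono (p : Polynomial ℕ) {m n : ℕ} (h : m ≤ n) : p.eval m ≤ p.eval n := by
  simp only [Polynomial.eval_eq_sum_range]
  exact Finset.sum_le_sum fun i _ => Nat.mul_le_mul_left _ (Nat.pow_le_pow_left h i)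

/-- The function `f` of an input encoded by `enc` is computed in polynomial time. The program is
normalized for use as a subroutine: it finds its input in variable `0`, may rely on the variables
`1, …, N - 1` being `nil`, and has no effect except that variable `0` receives the output. -/
def PolyTime {ι : Type} (enc f : ι → Dat) : Prop :=
  ∃ (P : Prog) (N : ℕ) (p : Polynomial ℕ), ∀ (i : ι) (s : Store), s 0 = enc i →
    (∀ x, 0 < x → x < N → s x = .nil) →
    ∃ t, t ≤ p.eval (enc i).size ∧ Exec P s (Function.update s 0 (f i)) t

/-- Polynomial-time functions on all trees. -/
@[fun_prop]
def PolyFun (f : Dat → Dat) : Prop := PolyTime id f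

section

variable {ι κ : Type} {enc f g h : ι → Dat}

theorem PolyTime.size_le (hf : PolyTime enc f) :
    ∃ q : Polynomial ℕ, ∀ i, (f i).size ≤ q.eval (enc i).size := by
  obtain ⟨P, N, p, h⟩ := hf
  refine ⟨.X + p, fun i => ?_⟩
  obtain ⟨t, ht, he⟩ := h i (initial (enc i)) (by simp [initial])
    (fun x hx _ => by simp [initial, hx.ne'])
  have := he.size_le 0
  simp [initial] at this ⊢
  omega

theorem PolyTime.comp {enc' g : κ → Dat} {φ : ι → κ} (hg : PolyTime enc' g) (hf : PolyTime enc f)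
    (hφ : ∀ i, f i = enc' (φ i)) : PolyTime enc fun i => g (φ i) := by
  obtain ⟨q', hq'⟩ := hf.size_le
  obtain ⟨P, N, p, hP⟩ := hf
  obtain ⟨Q, M, q, hQ⟩ := hg
  refine ⟨.seq P Q, max N M, p + q.comp q', fun i s hs hn => ?_⟩
  obtain ⟨t, ht, he⟩ := hP i s hs fun x h0 hx => hn x h0 (by omega)
  obtain ⟨u, hu, he'⟩ := hQ (φ i) (Function.update s 0 (f i)) (by simp [hφ])
    fun x h0 hx => by simp [h0.ne', hn x h0 (by omega)]
  refine ⟨t + u, ?_, ?_⟩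
  · have := polyEval_mono q (hφ i ▸ hq' i)
    simp; omega
  · simpa using Exec.seq he he'

theorem PolyTime.congr (hf : PolyTime enc f) (h : ∀ i, f i = g i) : PolyTime enc g := by
  rwa [← funext h]

/-- Programs consisting of a single elementary operation on variable `0`. -/
theorem PolyTime.of_copy : PolyTime enc enc :=
  ⟨.copy 0 0, 1, .X + 1, fun i s hs _ => ⟨_, by simp, hs ▸ Exec.copy s 0 0⟩⟩

theorem PolyTime.of_clear : PolyTime enc fun _ => .nil :=
  ⟨.clear 0, 1, 1, fun i s _ _ => ⟨_, by simp, Exec.clear s 0⟩⟩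

theorem PolyFun.left_id : PolyFun Dat.left :=
  ⟨.left 0 0, 1, .X + 1, fun i s hs _ => ⟨_, by simp, hs ▸ Exec.left s 0 0⟩⟩

theorem PolyFun.right_id : PolyFun Dat.right :=
  ⟨.right 0 0, 1, .X + 1, fun i s hs _ => ⟨_, by simp, hs ▸ Exec.right s 0 0⟩⟩

theorem PolyTime.left (hf : PolyTime enc f) : PolyTime enc fun i => (f i).left :=
  PolyFun.left_id.comp hf fun _ => rfl

theorem PolyTime.right (hf : PolyTime enc f) : PolyTime enc fun i => (f i).right :=
  PolyFun.right_id.comp hf fun _ => rfl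

theorem PolyTime.cons (hf : PolyTime enc f) (hg : PolyTime enc g) :
    PolyTime enc fun i => .cons (f i) (g i) := by
  obtain ⟨pf, hpf⟩ := hf.size_le
  obtain ⟨pg, hpg⟩ := hg.size_le
  obtain ⟨P, N, p, hP⟩ := hf
  obtain ⟨Q, M, q, hQ⟩ := hg
  -- the input is saved in the first free variable, the first result in the second one
  obtain ⟨K, hK⟩ : ∃ K, K = max (max N M) 1 := ⟨_, rfl⟩
  refine ⟨.seq (.copy K 0) (.seq P (.seq (.copy (K + 1) 0) (.seq (.copy 0 K) (.seq Q
    (.seq (.cons 0 (K + 1) 0) (.seq (.clear K) (.clear (K + 1)))))))), K + 2,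
    2 * .X + p + q + 2 * pf + pg + 6, fun i s hs hn => ?_⟩
  have e1 := Exec.copy s K 0
  obtain ⟨t, ht, e2⟩ := hP i _ (show Function.update s K (s 0) 0 = enc i by
      simp [hs, show 0 ≠ K by omega])
    fun x h0 hx => by simp [show x ≠ K by omega, hn x h0 (by omega)]
  have e3 := Exec.copy (Function.update (Function.update s K (s 0)) 0 (f i)) (K + 1) 0
  have e4 := Exec.copy (Function.update (Function.update (Function.update s K (s 0)) 0 (f i))
    (K + 1) (f i)) 0 K
  obtain ⟨u, hu, e5⟩ := hQ i (Function.update (Function.update (Function.update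
      (Function.update s K (s 0)) 0 (f i)) (K + 1) (f i)) 0 (enc i)) (by simp)
    fun x h0 hx => by
      simp [show x ≠ K by omega, show x ≠ K + 1 by omega, h0.ne', hn x h0 (by omega)]
  have hK0 : K ≠ 0 := by omega
  simp [hK0, hs] at e1 e2 e3 e4 e5
  have e6 := Exec.cons (Function.update (Function.update (Function.update s K (enc i))
    (K + 1) (f i)) 0 (g i)) 0 (K + 1) 0
  have e5' : Exec Q (Function.update (Function.update (Function.update
      (Function.update s K (enc i)) 0 (f i)) (K + 1) (f i)) 0 (enc i))
      (Function.update (Function.update (Function.update s K (enc i))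
        (K + 1) (f i)) 0 (g i)) u := by
    convert e5 using 1
    funext x; simp [Function.update_apply]; split_ifs <;> rfl
  refine ⟨_, ?_, Exec.seq e1 (.seq e2 (.seq e3 (.seq e4 (.seq e5' (.seq e6
    (.seq (.clear _ K) (.clear' ?_)))))))⟩
  rotate_left
  · funext x
    have h1 := hn K (by omega) (by omega)
    have h2 := hn (K + 1) (by omega) (by omega)
    by_cases hx : x = 0
    · subst hx; simp [hK0.symm]
    · by_cases hx1 : x = K
      · subst hx1; simp [hx, h1]
      · by_cases hx2 : x = K + 1
        · subst hx2; simp [h2]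
        · simp [hx, hx1, hx2]
  · have h1 := hpf i
    have h2 := hpg i
    simp
    omega

/-- The value of a branch on whether a tree is `nil`. -/
def Dat.cond : Dat → Dat → Dat → Dat
  | .nil, _, b => b
  | .cons _ _, a, _ => a

theorem Dat.cond_of_ne_nil {c : Dat} (h : c ≠ .nil) (a b : Dat) : c.cond a b = a := by
  cases c
  · exact absurd rfl h
  · rfl

/-- A branch on whether a computed value is `nil`. -/
theorem PolyTime.ite (hh : PolyTime enc h) (hf : PolyTime enc f) (hg : PolyTime enc g) :
    PolyTime enc fun i => (h i).cond (f i) (g i) := by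
  obtain ⟨r, hr⟩ := (hh.cons (of_copy (enc := enc))).size_le
  obtain ⟨H, L, h', hH⟩ := hh.cons (of_copy (enc := enc))
  obtain ⟨P, N, p, hP⟩ := hf
  obtain ⟨Q, M, q, hQ⟩ := hg
  obtain ⟨K, hK⟩ : ∃ K, K = max (max (max N M) L) 1 := ⟨_, rfl⟩
  refine ⟨.seq H (.seq (.left K 0) (.seq (.right 0 0) (.seq (.ite K P Q) (.clear K)))), K + 1,
    h' + 2 * r + p + q + 4, fun i s hs hn => ?_⟩
  obtain ⟨t, ht, e1⟩ := hH i s hs fun x h0 hx => hn x h0 (by omega)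
  have e2 := Exec.left (Function.update s 0 (.cons (h i) (enc i))) K 0
  have e3 := Exec.right (Function.update (Function.update s 0 (.cons (h i) (enc i))) K (h i)) 0 0
  have hK0 : K ≠ 0 := by omega
  have hKn := hn K (by omega) (by omega)
  simp [hK0.symm, Dat.left, Dat.right] at e2 e3
  have hri := hr i
  by_cases hc : h i = .nil
  · obtain ⟨u, hu, e4⟩ := hQ i (Function.update (Function.update (Function.update s 0
        (.cons (h i) (enc i))) K (h i)) 0 (enc i)) (by simp) fun x h0 hx => by
      simp [show x ≠ K by omega, h0.ne', hn x h0 (by omega)]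
    refine ⟨_, ?_, Exec.seq e1 (.seq e2 (.seq e3 (.seq (.ite_false (by simp [hK0, hc]) e4) (.clear' ?_))))⟩
    rotate_left
    · funext x
      by_cases hx : x = 0
      · subst hx; simp [hc, hK0.symm, Dat.cond]
      · by_cases hx1 : x = K
        · subst hx1; simp [hx, hKn]
        · simp [hx, hx1]
    · simp; omega
  · obtain ⟨u, hu, e4⟩ := hP i (Function.update (Function.update (Function.update s 0
        (.cons (h i) (enc i))) K (h i)) 0 (enc i)) (by simp) fun x h0 hx => by
      simp [show x ≠ K by omega, h0.ne', hn x h0 (by omega)]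
    refine ⟨_, ?_, Exec.seq e1 (.seq e2 (.seq e3 (.seq (.ite_true (by simp [hK0, hc]) e4) (.clear' ?_))))⟩
    rotate_left
    · funext x
      by_cases hx : x = 0
      · subst hx; simp [Dat.cond_of_ne_nil hc, hK0.symm]
      · by_cases hx1 : x = K
        · subst hx1; simp [hx, hKn]
        · simp [hx, hx1]
    · simp; omega

/-! ### Lists and folds -/

/-- The list of left subtrees along the right spine. -/
def Dat.toList : Dat → List Dat
  | .nil => []
  | .cons a b => a :: b.toList

/-- The inverse of `Dat.toList`. -/
def Dat.ofList : List Dat → Dat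
  | [] => .nil
  | a :: l => .cons a (ofList l)

@[simp] theorem Dat.toList_ofList (l : List Dat) : (ofList l).toList = l := by
  induction l with
  | nil => rfl
  | cons a l ih => simp [ofList, toList, ih]

@[simp] theorem Dat.ofList_toList (d : Dat) : ofList d.toList = d := by
  induction d with
  | nil => rfl
  | cons a b _ ih => simp [ofList, toList, ih]

theorem Dat.length_toList_lt (d : Dat) : d.toList.length < d.size := by
  induction d with
  | nil => simp [toList, size]
  | cons a b _ ih => simp [toList, size]; omega

theorem Dat.size_ofList (l : List Dat) : (ofList l).size = 1 + (l.map fun a => a.size + 1).sum := by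
  induction l with
  | nil => rfl
  | cons a l ih => simp [ofList, size, ih]; omega

theorem Dat.size_lt_of_mem_toList {a d : Dat} (h : a ∈ d.toList) : a.size < d.size := by
  induction d with
  | nil => simp [toList] at h
  | cons b c _ ih =>
    simp only [toList, List.mem_cons] at h
    rcases h with rfl | h
    · simp [size]
    · have := ih h; simp [size]; omega

/-- The loop that implements a fold: list in variable `K + 1`, accumulator in `K + 2`, environment
in `K`. -/
theorem exec_foldLoop {F : Dat → Dat → Dat → Dat} {P : Prog} {N K : ℕ} {p : Polynomial ℕ}
    (hP : ∀ (e : Dat) (s : Store), s 0 = e → (∀ x, 0 < x → x < N → s x = .nil) →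
      ∃ t, t ≤ p.eval e.size ∧
        Exec P s (Function.update s 0 (F e.left e.right.left e.right.right)) t)
    (hNK : N ≤ K) (hK : 0 < K) (e : Dat) (B : ℕ) (L : List Dat) :
    ∀ (acc : Dat) (s : Store), s K = e → s (K + 1) = .ofList L → s (K + 2) = acc →
      (∀ x, 0 < x → x < N → s x = .nil) →
      e.size ≤ B → (Dat.ofList L).size ≤ B →
      (∀ L', L' <+: L → (L'.foldl (fun acc a => F e a acc) acc).size ≤ B) →
      ∃ (s' : Store) (t : ℕ), t ≤ L.length * (8 * B + 10 + p.eval (3 * B + 2)) + 1 ∧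
        Exec (.loop (K + 1) (.seq (.left 0 (K + 1)) (.seq (.cons 0 0 (K + 2)) (.seq (.cons 0 K 0)
          (.seq P (.seq (.copy (K + 2) 0) (.right (K + 1) (K + 1)))))))) s s' t ∧
        s' (K + 1) = .nil ∧ s' (K + 2) = L.foldl (fun acc a => F e a acc) acc ∧
        ∀ x, x ≠ 0 → x ≠ K + 1 → x ≠ K + 2 → s' x = s x := by
  induction L with
  | nil =>
    intro acc s h1 h2 h3 _ _ _ _
    exact ⟨s, 1, by simp, .loop_done (by simpa [Dat.ofList] using h2), by simpa [Dat.ofList] using h2,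
      by simpa using h3, fun _ _ _ _ => rfl⟩
  | cons a L ih =>
    intro acc s h1 h2 h3 hn he hL hB
    have hK0 : K ≠ 0 := by omega
    obtain ⟨s3, hs3⟩ : ∃ s3, s3 = Function.update s 0 (.cons e (.cons a acc)) := ⟨_, rfl⟩
    obtain ⟨t, ht, e4⟩ := hP (.cons e (.cons a acc)) s3 (by simp [hs3])
      fun x h0 hx => by simp [hs3, h0.ne', hn x h0 hx]
    simp only [Dat.left, Dat.right] at e4
    have e1 := Exec.left s 0 (K + 1)
    have e2 := Exec.cons (Function.update s 0 a) 0 0 (K + 2)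
    have e3 := Exec.cons (Function.update s 0 (.cons a acc)) 0 K 0
    have e5 := Exec.copy (Function.update s3 0 (F e a acc)) (K + 2) 0
    have e6 := Exec.right (Function.update (Function.update s3 0 (F e a acc)) (K + 2) (F e a acc))
      (K + 1) (K + 1)
    simp [h2, h3, h1, hK0, Dat.ofList, Dat.left, Dat.right, hs3] at e1 e2 e3 e4 e5 e6
    subst hs3
    simp [Dat.ofList, Dat.size] at hL
    have hacc : acc.size ≤ B := hB [] (by simp)
    have hacc' : (F e a acc).size ≤ B := by simpa using hB [a] (by simp)
    obtain ⟨s', u, hu, e7, h5, h6, h7⟩ := ih (F e a acc) (Function.update (Function.update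
      (Function.update s 0 (F e a acc)) (K + 2) (F e a acc)) (K + 1) (.ofList L)) (by simp [hK0, h1])
      (by simp) (by simp) (fun x h0 hx => by
        simp [h0.ne', hn x h0 hx, show x ≠ K + 2 by omega, show x ≠ K + 1 by omega])
      he (by omega) (fun L' hL' => by
        simpa using hB (a :: L') (by simpa using hL'))
    refine ⟨s', _, ?_, .loop_step (by simp [h2, Dat.ofList])
      (.seq e1 (.seq e2 (.seq e3 (.seq e4 (.seq e5 e6))))) e7, h5, by simpa using h6, ?_⟩
    · have hp : p.eval (Dat.cons e (.cons a acc)).size ≤ p.eval (3 * B + 2) :=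
        polyEval_mono p (by simp [Dat.size]; omega)
      simp [Dat.size] at hp ht ⊢
      rw [Nat.add_mul, one_mul]
      omega
    · intro x hx0 hx1 hx2
      rw [h7 x hx0 hx1 hx2]
      simp [hx0, hx1, hx2]

/-- A fold over a computed list. The size of all intermediate values has to be bounded by a
polynomial. -/
theorem PolyTime.foldl {l a : ι → Dat} {F : Dat → Dat → Dat → Dat} (hl : PolyTime enc l)
    (ha : PolyTime enc a) (hF : PolyFun fun e => F e.left e.right.left e.right.right)
    (q : Polynomial ℕ)
    (hq : ∀ i L, L <+: (l i).toList →
      (L.foldl (fun acc x => F (enc i) x acc) (a i)).size ≤ q.eval (enc i).size) :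
    PolyTime enc fun i => (l i).toList.foldl (fun acc x => F (enc i) x acc) (a i) := by
  have h0 := of_copy (enc := enc) |>.cons (hl.cons ha)
  obtain ⟨r, hr⟩ := h0.size_le
  obtain ⟨Q, M, p', hQ⟩ := h0
  obtain ⟨P, N, p, hP⟩ := hF
  obtain ⟨K, hK⟩ : ∃ K, K = max (max N M) 1 := ⟨_, rfl⟩
  have hK0 : K ≠ 0 := by omega
  have hK1 : 0 < K := by omega
  refine ⟨.seq Q (.seq (.left K 0) (.seq (.right 0 0) (.seq (.left (K + 1) 0) (.seq (.right (K + 2) 0)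
    (.seq (.loop (K + 1) (.seq (.left 0 (K + 1)) (.seq (.cons 0 0 (K + 2)) (.seq (.cons 0 K 0)
          (.seq P (.seq (.copy (K + 2) 0) (.right (K + 1) (K + 1)))))))) (.seq (.copy 0 (K + 2))
    (.seq (.clear K) (.clear (K + 2))))))))), K + 3,
    p' + (4 * r + 4) + (r * (8 * (r + q) + 10 + p.comp (3 * (r + q) + 2)) + 1) + (q + 3),
    fun i s hs hn => ?_⟩
  obtain ⟨t, ht, e1⟩ := hQ i s hs fun x h0 hx => hn x h0 (by omega)
  have e2 := Exec.left (Function.update s 0 (.cons (enc i) (.cons (l i) (a i)))) K 0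
  have e3 := Exec.right (Function.update (Function.update s 0 (.cons (enc i) (.cons (l i) (a i)))) K
    (enc i)) 0 0
  obtain ⟨s3, hs3⟩ : ∃ s3, s3 = Function.update (Function.update (Function.update s 0
    (.cons (enc i) (.cons (l i) (a i)))) K (enc i)) 0 (.cons (l i) (a i)) := ⟨_, rfl⟩
  have e4 := Exec.left s3 (K + 1) 0
  have e5 := Exec.right (Function.update s3 (K + 1) (l i)) (K + 2) 0
  simp [Dat.left, Dat.right, hs3, hK0, hK0.symm] at e2 e3 e4 e5
  have hri := hr i
  have hqi := hq i
  simp only [Dat.size] at hri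
  obtain ⟨s', u, hu, e6, h5, h6, h7⟩ := exec_foldLoop (fun e s hs hn => hP e s hs hn)
    (show N ≤ K by omega) (by omega)
    (enc i) (r.eval (enc i).size + q.eval (enc i).size) (l i).toList (a i)
    (Function.update (Function.update (Function.update (Function.update (Function.update s 0
      (.cons (enc i) (.cons (l i) (a i)))) K (enc i)) 0 (.cons (l i) (a i))) (K + 1) (l i)) (K + 2)
      (a i)) (by simp [hK0]) (by simp) (by simp) (fun x h0 hx => by
        simp [h0.ne', show x ≠ K + 2 by omega, show x ≠ K + 1 by omega, show x ≠ K by omega,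
          hn x h0 (by omega)])
    (by omega) (by simp; omega) (fun L' hL' => (hqi L' hL').trans (by omega))
  refine ⟨_, ?_, .seq e1 (.seq e2 (.seq e3 (.seq e4 (.seq e5 (.seq e6 (.seq (.copy s' 0 (K + 2))
    (.seq (.clear _ K) (.clear' ?_))))))))⟩
  rotate_left
  · funext x
    by_cases hx : x = 0
    · subst hx; simp [h6, hK0.symm]
    · by_cases hx0 : x = K
      · subst hx0; simp [hx, hn _ hK1 (by omega)]
      · by_cases hx1 : x = K + 1
        · subst hx1; simp [h5, hn (K + 1) (by omega) (by omega)]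
        · by_cases hx2 : x = K + 2
          · subst hx2; simp [hn (K + 2) (by omega) (by omega)]
          · simp [hx, hx0, hx1, hx2, h7 x hx hx1 hx2]
  · have h8 := hqi (l i).toList (List.prefix_refl _)
    have h9 := (l i).length_toList_lt
    have h10 := Nat.mul_le_mul_right (8 * (r.eval (enc i).size + q.eval (enc i).size) + 10 +
      p.eval (3 * (r.eval (enc i).size + q.eval (enc i).size) + 2))
      (show (l i).toList.length ≤ r.eval (enc i).size by omega)
    rw [h6]
    simp [Dat.size]
    omega

end

/-! ### A small library of polynomial-time functions -/

@[fun_prop]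
theorem PolyFun.id' : PolyFun fun d => d := PolyTime.of_copy

theorem PolyFun.const_aux : ∀ c : Dat, PolyFun fun _ => c
  | .nil => PolyTime.of_clear
  | .cons a b => (const_aux a).cons (const_aux b)

@[fun_prop]
theorem PolyFun.const (c : Dat) : PolyFun fun _ => c := const_aux c

@[fun_prop]
theorem PolyFun.comp' {f g : Dat → Dat} (hf : PolyFun f) (hg : PolyFun g) :
    PolyFun fun d => f (g d) :=
  PolyTime.comp hf hg fun _ => rfl

@[fun_prop]
theorem PolyFun.left' {f : Dat → Dat} (hf : PolyFun f) : PolyFun fun d => (f d).left :=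
  PolyTime.left hf

@[fun_prop]
theorem PolyFun.right' {f : Dat → Dat} (hf : PolyFun f) : PolyFun fun d => (f d).right :=
  PolyTime.right hf

@[fun_prop]
theorem PolyFun.cons' {f g : Dat → Dat} (hf : PolyFun f) (hg : PolyFun g) :
    PolyFun fun d => .cons (f d) (g d) :=
  PolyTime.cons hf hg

@[fun_prop]
theorem PolyFun.cond' {f g h : Dat → Dat} (hh : PolyFun h) (hf : PolyFun f) (hg : PolyFun g) :
    PolyFun fun d => (h d).cond (f d) (g d) :=
  PolyTime.ite hh hf hg

theorem PolyFun.foldl {l a : Dat → Dat} {F : Dat → Dat → Dat → Dat} (hl : PolyFun l)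
    (ha : PolyFun a) (hF : PolyFun fun e => F e.left e.right.left e.right.right)
    (q : Polynomial ℕ)
    (hq : ∀ d L, L <+: (l d).toList →
      (L.foldl (fun acc x => F d x acc) (a d)).size ≤ q.eval d.size) :
    PolyFun fun d => (l d).toList.foldl (fun acc x => F d x acc) (a d) :=
  PolyTime.foldl hl ha hF q hq

/-- Reversal of a list. -/
def reverseD (l : Dat) : Dat := .ofList l.toList.reverse

theorem foldl_cons_eq {α : Type} (f : α → Dat) (L : List α) (a : Dat) :
    L.foldl (fun acc x => .cons (f x) acc) a = .ofList ((L.map f).reverse ++ a.toList) := by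
  induction L generalizing a with
  | nil => simp
  | cons x L ih => simp [ih, Dat.toList]

theorem sum_size_le_of_prefix {L M : List Dat} (h : L <+: M) :
    (L.map fun a => a.size + 1).sum ≤ (M.map fun a => a.size + 1).sum := by
  obtain ⟨R, rfl⟩ := h
  simp

@[fun_prop]
theorem PolyFun.reverseD {l : Dat → Dat} (hl : PolyFun l) : PolyFun fun d => reverseD (l d) := by
  obtain ⟨q, hq⟩ := hl.size_le
  refine PolyTime.congr (PolyFun.foldl (a := fun _ => .nil) (F := fun _ x acc => .cons x acc) hl
    (by fun_prop) (by fun_prop) q fun d L hL => ?_) fun d => ?_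
  · refine le_trans ?_ (hq d)
    have := sum_size_le_of_prefix hL
    conv_rhs => rw [← Dat.ofList_toList (l d)]
    rw [foldl_cons_eq (fun x => x), Dat.size_ofList, Dat.size_ofList]
    simp [Dat.toList] at this ⊢
    omega
  · rw [foldl_cons_eq (fun x => x)]
    simp [SFAST.reverseD, Dat.toList]

/-- Apply a function to all members of a list. -/
def mapD (f : Dat → Dat) (l : Dat) : Dat := .ofList (l.toList.map f)

@[fun_prop]
theorem PolyFun.mapD {f : Dat → Dat → Dat} {l : Dat → Dat}
    (hf : PolyFun fun e => f e.left e.right) (hl : PolyFun l) :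
    PolyFun fun d => mapD (f d) (l d) := by
  obtain ⟨q, hq⟩ := hl.size_le
  obtain ⟨r, hr⟩ := hf.size_le
  have : PolyFun fun d => (l d).toList.foldl (fun acc x => .cons (f d x) acc) .nil := by
    refine PolyFun.foldl (a := fun _ => .nil) (F := fun d x acc => .cons (f d x) acc) hl
      (by fun_prop) ?_ (q * (r.comp (.X + q + 1) + 1) + 1) fun d L hL => ?_
    · exact PolyFun.cons' (PolyFun.comp' hf (g := fun e => .cons e.left e.right.left) (by fun_prop))
        (by fun_prop)
    · rw [foldl_cons_eq, Dat.size_ofList]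
      have h1 : ∀ y ∈ L.map fun x => (f d x).size + 1,
          y ≤ r.eval (d.size + q.eval d.size + 1) + 1 := by
        intro y hy
        obtain ⟨x, hx, rfl⟩ := List.mem_map.1 hy
        have h2 := Dat.size_lt_of_mem_toList (hL.subset hx)
        have h3 := hr (.cons d x)
        have h4 := hq d
        have h5 := polyEval_mono r (show (Dat.cons d x).size ≤ d.size + q.eval d.size + 1 by
          simp [Dat.size] at h4 ⊢; omega)
        simp [Dat.left, Dat.right] at h3 ⊢
        omega
      have h6 := List.sum_le_card_nsmul _ _ h1
      have h7 := hL.length_le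
      have h8 := (l d).length_toList_lt
      have h9 := Nat.mul_le_mul_right (r.eval (d.size + q.eval d.size + 1) + 1)
        (show L.length ≤ q.eval d.size by have := hq d; simp at this; omega)
      have h10 : (List.map (fun a => a.size + 1) ((List.map (f d) L).reverse)).sum =
          (L.map fun x => (f d x).size + 1).sum := by
        rw [List.map_reverse, List.sum_reverse, List.map_map]
        rfl
      simp only [Dat.toList, List.append_nil, ← h10, smul_eq_mul, List.length_map,
        Polynomial.eval_add, Polynomial.eval_mul, Polynomial.eval_comp, Polynomial.eval_one,
        Polynomial.eval_X] at h6 h9 ⊢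
      rw [h10] at *
      omega
  refine PolyTime.congr (PolyFun.reverseD this) fun d => ?_
  rw [foldl_cons_eq]
  simp [SFAST.reverseD, SFAST.mapD, Dat.toList]

/-- Trees as truth values. -/
def Dat.truth : Dat → Bool
  | .nil => false
  | .cons _ _ => true

/-- The members of a list that satisfy a test. -/
def filterD (f : Dat → Dat) (l : Dat) : Dat := .ofList (l.toList.filter fun x => (f x).truth)

theorem foldl_filter_eq (f : Dat → Dat) (L : List Dat) (a : Dat) :
    L.foldl (fun acc x => (f x).cond (.cons x acc) acc) a =
      .ofList ((L.filter fun x => (f x).truth).reverse ++ a.toList) := by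
  induction L generalizing a with
  | nil => simp
  | cons x L ih =>
    rw [List.foldl_cons, ih, List.filter_cons]
    cases h : f x <;> simp [Dat.toList, Dat.cond, Dat.truth]

theorem sum_size_filter_le (p : Dat → Bool) (L : List Dat) :
    ((L.filter p).map fun a => a.size + 1).sum ≤ (L.map fun a => a.size + 1).sum := by
  induction L with
  | nil => simp
  | cons x L ih => by_cases h : p x <;> simp [h, -List.sum_map_add] <;> omega

@[fun_prop]
theorem PolyFun.filterD {f : Dat → Dat → Dat} {l : Dat → Dat}
    (hf : PolyFun fun e => f e.left e.right) (hl : PolyFun l) :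
    PolyFun fun d => filterD (f d) (l d) := by
  obtain ⟨q, hq⟩ := hl.size_le
  have : PolyFun fun d => (l d).toList.foldl (fun acc x => (f d x).cond (.cons x acc) acc) .nil := by
    refine PolyFun.foldl (a := fun _ => .nil) (F := fun d x acc => (f d x).cond (.cons x acc) acc) hl
      (by fun_prop) ?_ q fun d L hL => ?_
    · exact PolyFun.cond' (PolyFun.comp' hf (g := fun e => .cons e.left e.right.left) (by fun_prop))
        (by fun_prop) (by fun_prop)
    · refine le_trans ?_ (hq d)
      have h1 := sum_size_le_of_prefix hL
      have h2 := sum_size_filter_le (fun x => (f d x).truth) L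
      conv_rhs => rw [← Dat.ofList_toList (l d)]
      rw [foldl_filter_eq, Dat.size_ofList, Dat.size_ofList]
      simp [Dat.toList] at h1 h2 ⊢
      omega
  refine PolyTime.congr (PolyFun.reverseD this) fun d => ?_
  rw [foldl_filter_eq]
  simp [SFAST.reverseD, SFAST.filterD, Dat.toList]

/-- Remove from the list `a` as many members as the list `b` has. -/
def dropD (a b : Dat) : Dat := .ofList (a.toList.drop b.toList.length)

theorem foldl_right_eq (L : List Dat) (a : Dat) :
    L.foldl (fun acc _ => acc.right) a = .ofList (a.toList.drop L.length) := by
  induction L generalizing a with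
  | nil => simp
  | cons x L ih => rw [List.foldl_cons, ih]; cases a <;> simp [Dat.right, Dat.toList]

@[fun_prop]
theorem PolyFun.dropD {a l : Dat → Dat} (ha : PolyFun a) (hl : PolyFun l) :
    PolyFun fun d => dropD (a d) (l d) := by
  obtain ⟨q, hq⟩ := ha.size_le
  refine PolyTime.congr (PolyFun.foldl (F := fun _ x acc => acc.right) hl
    ha (by fun_prop) q fun d L hL => ?_) fun d => ?_
  · refine le_trans ?_ (hq d)
    clear hL
    induction L using List.reverseRecOn with
    | nil => simp
    | append_singleton L x ih =>
      rw [List.foldl_append]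
      exact (Dat.size_right_le _).trans ih
  · rw [foldl_right_eq]
    rfl

/-- Concatenation of lists. -/
def appendD (a b : Dat) : Dat := .ofList (a.toList ++ b.toList)

@[fun_prop]
theorem PolyFun.appendD {a l : Dat → Dat} (ha : PolyFun a) (hl : PolyFun l) :
    PolyFun fun d => appendD (a d) (l d) := by
  obtain ⟨q, hq⟩ := ha.reverseD.size_le
  obtain ⟨r, hr⟩ := hl.size_le
  refine PolyTime.congr (PolyFun.foldl (F := fun _ x acc => .cons x acc) ha.reverseD
    hl (by fun_prop) (q + r) fun d L hL => ?_) fun d => ?_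
  · have h1 := sum_size_le_of_prefix hL
    have h2 := hq d
    have h3 := hr d
    rw [← Dat.ofList_toList (SFAST.reverseD (a d)), Dat.size_ofList] at h2
    rw [← Dat.ofList_toList (l d), Dat.size_ofList] at h3
    rw [foldl_cons_eq (fun x => x), Dat.size_ofList]
    simp at h1 h2 h3 ⊢
    omega
  · rw [foldl_cons_eq (fun x => x)]
    simp [SFAST.reverseD, SFAST.appendD]

/-! ### Truth values, unary numbers and counting -/

/-- The truth value of a proposition. -/
noncomputable def encProp (p : Prop) : Dat :=
  open Classical in if p then .cons .nil .nil else .nil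

theorem encBool_eq (b : Bool) : encBool b = encProp (b = true) := by
  cases b <;> simp [encBool, encProp]

@[simp] theorem truth_encProp (p : Prop) : ((encProp p).truth = true) = p := by
  unfold encProp; split_ifs with h <;> simp [Dat.truth, h]

theorem encProp_decide (p : Prop) [Decidable p] : encBool (decide p) = encProp p := by
  simp [encBool_eq]

theorem cond_encProp (p : Prop) [Decidable p] (a b : Dat) :
    (encProp p).cond a b = if p then a else b := by
  unfold encProp; split_ifs with h <;> simp [Dat.cond]

/-- Negation. -/
def notD (a : Dat) : Dat := a.cond .nil (.cons .nil .nil)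
/-- Conjunction. -/
def andD (a b : Dat) : Dat := a.cond b .nil
/-- Disjunction. -/
def orD (a b : Dat) : Dat := a.cond (.cons .nil .nil) b
/-- Implication. -/
def impD (a b : Dat) : Dat := a.cond b (.cons .nil .nil)
/-- Equivalence. -/
def iffD (a b : Dat) : Dat := a.cond b (notD b)

@[simp] theorem notD_encProp (p : Prop) : notD (encProp p) = encProp (¬ p) := by
  by_cases hp : p <;> simp [notD, encProp, Dat.cond, hp]
@[simp] theorem andD_encProp (p q : Prop) : andD (encProp p) (encProp q) = encProp (p ∧ q) := by
  by_cases hp : p <;> by_cases hq : q <;> simp [andD, encProp, Dat.cond, hp, hq]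
@[simp] theorem orD_encProp (p q : Prop) : orD (encProp p) (encProp q) = encProp (p ∨ q) := by
  by_cases hp : p <;> by_cases hq : q <;> simp [orD, encProp, Dat.cond, hp, hq]
@[simp] theorem impD_encProp (p q : Prop) : impD (encProp p) (encProp q) = encProp (p → q) := by
  by_cases hp : p <;> by_cases hq : q <;> simp [impD, encProp, Dat.cond, hp, hq]
@[simp] theorem iffD_encProp (p q : Prop) : iffD (encProp p) (encProp q) = encProp (p ↔ q) := by
  by_cases hp : p <;> by_cases hq : q <;> simp [iffD, notD, encProp, Dat.cond, hp, hq]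

section
variable {f g : Dat → Dat}

@[fun_prop]
theorem PolyFun.notD (hf : PolyFun f) : PolyFun fun d => notD (f d) := by
  unfold SFAST.notD; fun_prop
@[fun_prop]
theorem PolyFun.andD (hf : PolyFun f) (hg : PolyFun g) : PolyFun fun d => andD (f d) (g d) := by
  unfold SFAST.andD; fun_prop
@[fun_prop]
theorem PolyFun.orD (hf : PolyFun f) (hg : PolyFun g) : PolyFun fun d => orD (f d) (g d) := by
  unfold SFAST.orD; fun_prop
@[fun_prop]
theorem PolyFun.impD (hf : PolyFun f) (hg : PolyFun g) : PolyFun fun d => impD (f d) (g d) := by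
  unfold SFAST.impD; fun_prop
@[fun_prop]
theorem PolyFun.iffD (hf : PolyFun f) (hg : PolyFun g) : PolyFun fun d => iffD (f d) (g d) := by
  unfold SFAST.iffD; fun_prop

end

/-- The length of a list. -/
def Dat.len (d : Dat) : ℕ := d.toList.length

/-- A natural number in unary. -/
def num (n : ℕ) : Dat := .ofList (List.replicate n .nil)

@[simp] theorem len_num (n : ℕ) : (num n).len = n := by simp [num, Dat.len]

@[simp] theorem len_appendD (a b : Dat) : (appendD a b).len = a.len + b.len := by
  simp [appendD, Dat.len]

@[simp] theorem len_cons (a b : Dat) : (Dat.cons a b).len = b.len + 1 := by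
  simp [Dat.len, Dat.toList]

/-- Comparison of the lengths of two lists. -/
def ltD (a b : Dat) : Dat := (dropD b a).cond (.cons .nil .nil) .nil

@[fun_prop]
theorem PolyFun.ltD {f g : Dat → Dat} (hf : PolyFun f) (hg : PolyFun g) :
    PolyFun fun d => ltD (f d) (g d) := by
  unfold SFAST.ltD; fun_prop

@[simp] theorem ltD_eq (a b : Dat) : ltD a b = encProp (a.len < b.len) := by
  unfold ltD dropD
  by_cases h : a.len < b.len
  · cases hl : b.toList.drop a.toList.length with
    | nil =>
      have : b.len ≤ a.len := by simpa [Dat.len] using hl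
      omega
    | cons x L => simp [encProp, h, Dat.ofList, Dat.cond]
  · rw [List.drop_eq_nil_of_le (by simpa [Dat.len] using h)]
    simp [encProp, h, Dat.ofList, Dat.cond]

/-- The member of a list with a given index. -/
def nthD (l i : Dat) : Dat := (dropD l i).left

@[fun_prop]
theorem PolyFun.nthD {f g : Dat → Dat} (hf : PolyFun f) (hg : PolyFun g) :
    PolyFun fun d => nthD (f d) (g d) := by
  unfold SFAST.nthD; fun_prop

theorem nthD_eq (l : List Dat) (i : ℕ) (hi : i < l.length) : nthD (.ofList l) (num i) = l[i] := by
  simp only [nthD, dropD, num, Dat.toList_ofList, List.length_replicate, List.drop_eq_getElem_cons hi]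
  rfl

/-- Forget the members of a list, keeping its length in unary. -/
def unD (l : Dat) : Dat := mapD (fun _ => .nil) l

@[fun_prop]
theorem PolyFun.unD {f : Dat → Dat} (hf : PolyFun f) : PolyFun fun d => unD (f d) := by
  unfold SFAST.unD; fun_prop

theorem unD_eq (l : Dat) : unD l = num l.len := by
  simp [unD, mapD, num, Dat.len]

theorem encList_eq {α : Type} (e : α → Dat) (L : List α) : encList e L = .ofList (L.map e) := by
  induction L with
  | nil => rfl
  | cons a L ih => simp [encList, Dat.ofList, ih]

/-- The list of the vertices `0, …, n - 1`, in unary. -/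
def vertList (n : ℕ) : Dat := encList (fun i : Fin n => num i) (List.finRange n)

/-- The list of the indices of the members of a list. -/
def indicesD (l : Dat) : Dat :=
  reverseD (l.toList.foldl (fun acc _ => .cons (unD acc) acc) .nil)

theorem foldl_indices (L : List Dat) :
    L.foldl (fun acc _ => .cons (unD acc) acc) .nil =
      Dat.ofList (((List.range L.length).map num).reverse) := by
  induction L using List.reverseRecOn with
  | nil => rfl
  | append_singleton L x ih =>
    rw [List.foldl_append, ih]
    simp [List.range_succ, unD_eq, Dat.ofList, Dat.len]

theorem size_num (n : ℕ) : (num n).size = 2 * n + 1 := by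
  simp [num, Dat.size_ofList, Dat.size]; omega

@[fun_prop]
theorem PolyFun.indicesD {l : Dat → Dat} (hl : PolyFun l) : PolyFun fun d => indicesD (l d) := by
  obtain ⟨q, hq⟩ := hl.size_le
  refine PolyFun.reverseD (PolyFun.foldl (F := fun _ _ acc => .cons (SFAST.unD acc) acc) hl
    (by fun_prop) (by fun_prop) (q * (2 * q + 2) + 1) fun d L hL => ?_)
  rw [foldl_indices, Dat.size_ofList]
  have h1 : ∀ y ∈ ((List.range L.length).map num).reverse.map fun a => a.size + 1,
      y ≤ 2 * q.eval d.size + 2 := by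
    intro y hy
    simp only [List.map_reverse, List.mem_reverse, List.mem_map, List.mem_range] at hy
    obtain ⟨_, ⟨x, hx, rfl⟩, rfl⟩ := hy
    have h7 := hL.length_le
    have h8 := (l d).length_toList_lt
    have h9 := hq d
    simp [size_num] at h9 ⊢
    omega
  have h6 := List.sum_le_card_nsmul _ _ h1
  have h7 := hL.length_le
  have h8 := (l d).length_toList_lt
  have h9 := Nat.mul_le_mul_right (2 * q.eval d.size + 2)
    (show L.length ≤ q.eval d.size by have := hq d; simp at this; omega)
  simp only [List.length_map, List.length_reverse, List.length_range, smul_eq_mul] at h6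
  simp
  simp at h6
  omega

theorem indicesD_eq (l : Dat) {n : ℕ} (h : l.len = n) : indicesD l = vertList n := by
  subst h
  rw [indicesD, foldl_indices, reverseD, vertList, encList_eq]
  simp only [Dat.toList_ofList, List.reverse_reverse]
  congr 1
  rw [← List.map_coe_finRange_eq_range, List.map_map]
  rfl

/-- All members of a list satisfy a test. -/
def allD (f : Dat → Dat) (l : Dat) : Dat := notD (filterD (fun x => notD (f x)) l)
/-- Some member of a list satisfies a test. -/
def anyD (f : Dat → Dat) (l : Dat) : Dat := (filterD f l).cond (.cons .nil .nil) .nil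

@[fun_prop]
theorem PolyFun.allD {f : Dat → Dat → Dat} {l : Dat → Dat}
    (hf : PolyFun fun e => f e.left e.right) (hl : PolyFun l) :
    PolyFun fun d => allD (f d) (l d) := by
  exact (PolyFun.filterD (f := fun d x => SFAST.notD (f d x)) hf.notD hl).notD

@[fun_prop]
theorem PolyFun.anyD {f : Dat → Dat → Dat} {l : Dat → Dat}
    (hf : PolyFun fun e => f e.left e.right) (hl : PolyFun l) :
    PolyFun fun d => anyD (f d) (l d) := by
  exact (PolyFun.filterD hf hl).cond' (PolyFun.const _) (PolyFun.const _)

/-- The number of elements of a finite type with a property. -/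
noncomputable def cnt {α : Type} [Fintype α] (p : α → Prop) : ℕ :=
  open Classical in (Finset.univ.filter p).card

theorem cond_eq_encProp (a : Dat) : a.cond (.cons .nil .nil) .nil = encProp (a.truth = true) := by
  cases a <;> simp [Dat.cond, encProp, Dat.truth]

theorem truth_ofList (L : List Dat) : (Dat.ofList L).truth = true ↔ L ≠ [] := by
  cases L <;> simp [Dat.ofList, Dat.truth]

@[simp] theorem anyD_vertList (f : Dat → Dat) (n : ℕ) :
    anyD f (vertList n) = encProp (∃ i : Fin n, (f (num i)).truth = true) := by
  rw [anyD, cond_eq_encProp]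
  congr 1
  simp [filterD, truth_ofList, vertList, encList_eq, List.filter_eq_nil_iff]

@[simp] theorem allD_vertList (f : Dat → Dat) (n : ℕ) :
    allD f (vertList n) = encProp (∀ i : Fin n, (f (num i)).truth = true) := by
  rw [allD, notD]
  have : ∀ a : Dat, a.cond .nil (.cons .nil .nil) = encProp (¬ a.truth = true) := by
    intro a; cases a <;> simp [Dat.cond, encProp, Dat.truth]
  rw [this]
  congr 1
  simp only [filterD, truth_ofList, vertList, encList_eq, Dat.toList_ofList]
  have h : ∀ a : Dat, (notD a).truth = !a.truth := by
    intro a; cases a <;> simp [notD, Dat.cond, Dat.truth]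
  simp [h, List.filter_eq_nil_iff]

theorem filterD_vertList (f : Dat → Dat) (n : ℕ) :
    filterD f (vertList n) =
      encList (fun i : Fin n => num i) ((List.finRange n).filter fun i => (f (num i)).truth) := by
  simp [filterD, vertList, encList_eq, List.filter_map, Function.comp_def]

@[simp] theorem len_filterD_vertList (f : Dat → Dat) (n : ℕ) :
    (filterD f (vertList n)).len = cnt fun i : Fin n => (f (num i)).truth = true := by
  classical
  rw [filterD_vertList, encList_eq]
  simp only [Dat.len, Dat.toList_ofList, List.length_map, cnt]
  rw [← List.toFinset_card_of_nodup ((List.nodup_finRange n).filter _)]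
  congr 1
  ext i
  simp

theorem mapD_encList {α : Type} (f : Dat → Dat) (e : α → Dat) (L : List α) :
    mapD f (encList e L) = encList (fun a => f (e a)) L := by
  simp [mapD, encList_eq, Function.comp_def]

/-! ### Layerings -/

section Layering
open scoped Classical

variable {V : Type} {arc : V → V → Prop} {T X : Finset V} {ℓ : V → ℕ} {k : ℕ}

/-- The arc relation of a tournament. -/
def IsTour (arc : V → V → Prop) : Prop :=
  (∀ u, ¬ arc u u) ∧ ∀ u v, u ≠ v → (arc u v ↔ ¬ arc v u)

theorem IsTour.asymm (h : IsTour arc) {u v : V} (huv : arc u v) : ¬ arc v u := by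
  by_cases he : u = v
  · subst he; exact h.1 u
  · exact (h.2 u v he).1 huv

theorem IsTour.ne (h : IsTour arc) {u v : V} (huv : arc u v) : u ≠ v := by
  rintro rfl; exact h.1 u huv

theorem IsTour.of_not (h : IsTour arc) {u v : V} (he : u ≠ v) (huv : ¬ arc u v) : arc v u :=
  (h.2 v u he.symm).2 huv

/-- The arcs within `X` that lead from a layer to an earlier one. -/
noncomputable def backArcs (arc : V → V → Prop) (X : Finset V) (ℓ : V → ℕ) : Finset (V × V) :=
  (X ×ˢ X).filter fun e => arc e.1 e.2 ∧ ℓ e.2 < ℓ e.1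

theorem mem_backArcs {u v : V} :
    (u, v) ∈ backArcs arc X ℓ ↔ (u ∈ X ∧ v ∈ X) ∧ arc u v ∧ ℓ v < ℓ u := by
  simp [backArcs]

/-- An assignment of layers to the vertices in `X` in which terminals are alone in their layers. -/
def IsLayering (T X : Finset V) (ℓ : V → ℕ) : Prop :=
  ∀ t ∈ T, t ∈ X → ∀ v ∈ X, v ≠ t → ℓ v ≠ ℓ t

/-- The subtournament induced by `X` has a layering with at most `k` backward arcs. -/
def Solvable (arc : V → V → Prop) (T X : Finset V) (k : ℕ) : Prop :=
  ∃ ℓ, IsLayering T X ℓ ∧ (backArcs arc X ℓ).card ≤ k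

theorem Solvable.mono_set {Y : Finset V} (h : Solvable arc T Y k) (hX : X ⊆ Y) :
    Solvable arc T X k := by
  obtain ⟨ℓ, h1, h2⟩ := h
  refine ⟨ℓ, fun t ht htX v hv => h1 t ht (hX htX) v (hX hv), le_trans (Finset.card_le_card ?_) h2⟩
  exact Finset.filter_subset_filter _ (Finset.product_subset_product hX hX)

/-- If every member of `Z` is incident with a backward arc whose other end is not in `Z`, then there
are at least as many backward arcs as members of `Z`. -/
theorem card_le_card_backArcs {Z : Finset V}
    (h : ∀ z ∈ Z, ∃ y, y ∉ Z ∧ ((z, y) ∈ backArcs arc X ℓ ∨ (y, z) ∈ backArcs arc X ℓ)) :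
    Z.card ≤ (backArcs arc X ℓ).card := by
  have : ∀ z, ∃ y, z ∈ Z → y ∉ Z ∧ ((z, y) ∈ backArcs arc X ℓ ∨ (y, z) ∈ backArcs arc X ℓ) := by
    intro z
    by_cases hz : z ∈ Z
    · obtain ⟨y, hy⟩ := h z hz
      exact ⟨y, fun _ => hy⟩
    · exact ⟨z, fun h => absurd h hz⟩
  choose f hf using this
  refine Finset.card_le_card_of_injOn
    (fun z => if (z, f z) ∈ backArcs arc X ℓ then (z, f z) else (f z, z)) ?_ ?_
  · intro z hz
    have := (hf z hz).2
    simp only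
    split_ifs with h1
    · exact h1
    · exact this.resolve_left h1
  · intro z hz y hy hzy
    have h1 := (hf z hz).1
    have h2 := (hf y hy).1
    simp only at hzy
    split_ifs at hzy <;> simp only [Prod.mk.injEq] at hzy
    · exact hzy.1
    · exact absurd (hzy.1 ▸ hz) h2
    · exact absurd (hzy.2 ▸ hz) h2
    · exact hzy.2

/-- Solvability is invariant under isomorphism. -/
theorem solvable_iff_of_embedding {W : Type} [Fintype W] {arcW : W → W → Prop} {TW : Finset W}
    {e : W → V} (he : e.Injective) (hX : ∀ v, v ∈ X ↔ ∃ a, e a = v)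
    (harc : ∀ a b, arcW a b ↔ arc (e a) (e b)) (hT : ∀ a, a ∈ TW ↔ e a ∈ T) :
    Solvable arcW TW Finset.univ k ↔ Solvable arc T X k := by
  have key : ∀ ℓ : V → ℕ, (IsLayering TW Finset.univ (ℓ ∘ e) ↔ IsLayering T X ℓ) ∧
      (backArcs arcW Finset.univ (ℓ ∘ e)).card = (backArcs arc X ℓ).card := by
    intro ℓ
    constructor
    · constructor
      · rintro h t ht htX v hv hvt
        obtain ⟨a, rfl⟩ := (hX t).1 htX
        obtain ⟨b, rfl⟩ := (hX v).1 hv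
        exact h a ((hT a).2 ht) (Finset.mem_univ _) b (Finset.mem_univ _) fun h => hvt (h ▸ rfl)
      · rintro h t ht _ v _ hvt
        exact h (e t) ((hT t).1 ht) ((hX _).2 ⟨_, rfl⟩) (e v) ((hX _).2 ⟨_, rfl⟩)
          fun h => hvt (he h)
    · rw [← Finset.card_image_of_injective _ (he.prodMap he)]
      congr 1
      ext ⟨u, v⟩
      simp only [Finset.mem_image, Prod.exists, mem_backArcs, Prod.map, Prod.mk.injEq]
      constructor
      · rintro ⟨a, b, ⟨_, h1, h2⟩, rfl, rfl⟩
        exact ⟨⟨(hX _).2 ⟨_, rfl⟩, (hX _).2 ⟨_, rfl⟩⟩, (harc _ _).1 h1, h2⟩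
      · rintro ⟨⟨hu, hv⟩, h1, h2⟩
        obtain ⟨a, rfl⟩ := (hX u).1 hu
        obtain ⟨b, rfl⟩ := (hX v).1 hv
        exact ⟨a, b, ⟨by simp, (harc _ _).2 h1, h2⟩, rfl, rfl⟩
  constructor
  · rintro ⟨ℓ, h1, h2⟩
    have : Function.extend e ℓ 0 ∘ e = ℓ := by
      funext a; simp [he.extend_apply]
    have h3 := key (Function.extend e ℓ 0)
    rw [this] at h3
    exact ⟨_, h3.1.1 h1, h3.2 ▸ h2⟩
  · rintro ⟨ℓ, h1, h2⟩
    exact ⟨ℓ ∘ e, (key ℓ).1.2 h1, (key ℓ).2 ▸ h2⟩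

/-! ### Feedback arc sets and layerings -/

theorem exists_path_of_reflTransGen {R : V → V → Prop} {a b : V}
    (h : Relation.ReflTransGen R a b) :
    ∃ l : List V, (a :: l).Nodup ∧ (a :: l).IsChain R ∧ (a :: l).getLast (by simp) = b := by
  induction h using Relation.ReflTransGen.head_induction_on with
  | refl => exact ⟨[], by simp⟩
  | @head a c hac _ ih =>
    obtain ⟨l, h1, h2, h3⟩ := ih
    by_cases ha : a ∈ c :: l
    · obtain ⟨s, l', hl⟩ := List.append_of_mem ha
      have hs : a :: l' <:+ c :: l := ⟨s, hl.symm⟩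
      refine ⟨l', h1.sublist hs.sublist, h2.suffix hs, ?_⟩
      rw [← h3]
      simp only [hl]
      rw [List.getLast_append_of_ne_nil (by simp) (by simp)]
    · refine ⟨c :: l, List.nodup_cons.2 ⟨ha, h1⟩, List.isChain_cons_cons.2 ⟨hac, h2⟩, ?_⟩
      rw [List.getLast_cons (by simp)]
      exact h3

theorem exists_tCycle_iff {R : V → V → Prop} :
    (∃ c, IsTCycle R T c) ↔ ∃ t ∈ T, Relation.TransGen R t t := by
  constructor
  · rintro ⟨c, -, hc, t, ht, htc⟩
    refine ⟨t, ht, ?_⟩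
    have : c.Chain (Relation.TransGen R) := hc.imp fun _ _ h => .single h
    rw [Cycle.chain_iff_pairwise] at this
    exact this t htc t htc
  · rintro ⟨t, ht, h⟩
    obtain ⟨c, htc, hct⟩ := Relation.TransGen.head'_iff.1 h
    obtain ⟨l, h1, h2, h3⟩ := exists_path_of_reflTransGen hct
    refine ⟨((c :: l : List V) : Cycle V), by simpa using h1, ?_, t, ht, ?_⟩
    · rw [Cycle.chain_coe_cons, ← List.cons_append, List.isChain_append]
      refine ⟨h2, by simp, ?_⟩
      intro x hx y hy
      rw [List.getLast?_eq_some_getLast (by simp)] at hx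
      simp only [Option.mem_def, Option.some.injEq, List.head?_cons] at hx hy
      rw [← hx, ← hy, h3]
      exact htc
    · rw [Cycle.mem_coe_iff, ← h3]
      exact List.getLast_mem _

theorem not_transGen_of_isFeedback {G : TerminalTournament} {S : Finset (Fin G.n × Fin G.n)}
    (h : G.IsFeedback S) {t : Fin G.n} (ht : t ∈ G.T) :
    ¬ Relation.TransGen (fun u v => G.D.arc u v = true ∧ (u, v) ∉ S) t t := fun hc => by
  obtain ⟨c, hc⟩ := exists_tCycle_iff.2 ⟨t, ht, hc⟩
  exact h.2 c hc

theorem TerminalTournament.isTour (G : TerminalTournament) :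
    IsTour fun u v => G.D.arc u v = true :=
  ⟨fun u => by simp [G.D.loopless], fun u v h =>
    (G.D.exactly_one u v h).trans (by simp)⟩

/-- Layers from a feedback arc set: a vertex is placed according to the number of vertices that
reach it once the set is removed, ties between terminals being broken arbitrarily. -/
theorem solvable_of_isFeedback {G : TerminalTournament} {S : Finset (Fin G.n × Fin G.n)}
    (h : G.IsFeedback S) (hk : S.card ≤ k) :
    Solvable (fun u v => G.D.arc u v = true) G.T Finset.univ k := by
  set R := fun u v => G.D.arc u v = true ∧ (u, v) ∉ S with hR
  let A : Fin G.n → Finset (Fin G.n) := fun u =>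
    Finset.univ.filter fun w => Relation.ReflTransGen R w u
  let τ : Fin G.n → ℕ := fun u => if u ∈ G.T then u.val + 1 else 0
  have hτ : ∀ u, τ u < G.n + 1 := by
    intro u; simp only [τ]; split_ifs <;> omega
  have hAR : ∀ u v, R u v → A u ⊆ A v := by
    intro u v huv w hw
    simp only [A, Finset.mem_filter, Finset.mem_univ, true_and] at hw ⊢
    exact hw.tail huv
  refine ⟨fun u => (A u).card * (G.n + 1) + τ u, ?_, le_trans (Finset.card_le_card ?_) hk⟩
  · intro t ht _ v _ hvt heq
    have h1 := hτ t
    have h2 := hτ v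
    have h3 : τ v = τ t := by
      have := congrArg (· % (G.n + 1)) heq
      simpa [Nat.add_mod, Nat.mod_eq_of_lt h1, Nat.mod_eq_of_lt h2] using this
    simp only [τ, if_pos ht] at h3
    split_ifs at h3
    exact hvt (Fin.ext (by omega))
  · rintro ⟨u, v⟩ huv
    rw [mem_backArcs] at huv
    obtain ⟨-, harc, hlt⟩ := huv
    by_contra hS
    have hruv : R u v := ⟨harc, hS⟩
    have hsub := hAR u v hruv
    have hle := Finset.card_le_card hsub
    -- the two vertices must be reachable from each other
    have heq : (A u).card = (A v).card := by
      refine le_antisymm hle ?_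
      by_contra hcon
      have h2 := hτ u
      have : (A u).card * (G.n + 1) + (G.n + 1) ≤ (A v).card * (G.n + 1) := by
        rw [← Nat.succ_mul]; exact Nat.mul_le_mul_right _ (by omega)
      omega
    have hA : A u = A v := Finset.eq_of_subset_of_card_le hsub heq.ge
    have hvu : Relation.ReflTransGen R v u := by
      have : v ∈ A u := by
        rw [hA]; simp only [A, Finset.mem_filter, Finset.mem_univ, true_and]; exact .refl
      simpa [A] using this
    have hut : u ∉ G.T := fun ht =>
      not_transGen_of_isFeedback h ht (Relation.TransGen.head' hruv hvu)
    rw [heq] at hlt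
    simp only [τ, if_neg hut] at hlt
    omega

theorem Instance.isYes_iff (Y : Instance) :
    Y.IsYes ↔ Solvable (fun u v => Y.D.arc u v = true) Y.T Finset.univ Y.k := by
  constructor
  · rintro ⟨S, hS, hk⟩
    exact solvable_of_isFeedback hS hk
  · rintro ⟨ℓ, h1, h2⟩
    refine ⟨backArcs (fun u v => Y.D.arc u v = true) Finset.univ ℓ, ⟨?_, ?_⟩, h2⟩
    · rintro ⟨u, v⟩ h
      exact (mem_backArcs.1 h).2.1
    · intro c hc
      obtain ⟨t, ht, h⟩ := exists_tCycle_iff.1 ⟨c, hc⟩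
      have hmono : ∀ u v, (Y.D.arc u v = true ∧
          (u, v) ∉ backArcs (fun u v => Y.D.arc u v = true) Finset.univ ℓ) → ℓ u ≤ ℓ v := by
        rintro u v ⟨h3, h4⟩
        by_contra h5
        exact h4 (mem_backArcs.2 ⟨by simp, h3, by omega⟩)
      obtain ⟨v, htv, hvt⟩ := Relation.TransGen.head'_iff.1 h
      have h3 : ℓ v ≤ ℓ t := by
        clear h htv ht
        induction hvt with
        | refl => exact le_rfl
        | tail _ h ih => exact ih.trans (hmono _ _ h)
      exact h1 t ht (by simp) v (by simp) (Y.isTour.ne htv.1).symm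
        (le_antisymm h3 (hmono _ _ htv))

theorem solvable_of_sq_le {n : ℕ} {arc : Fin n → Fin n → Prop} {T : Finset (Fin n)}
    (h : n * n ≤ k) : Solvable arc T Finset.univ k := by
  refine ⟨fun v => v.val, fun t _ _ v _ h1 h2 => h1 (Fin.ext h2), le_trans (Finset.card_le_univ _) ?_⟩
  simpa using h

end Layering

/-! ### Deleting vertices far from a feedback arc set -/

section Marking
open scoped Classical

/-- `v` is among the first `m` elements with property `p`. -/
def First {V : Type} [Fintype V] [LT V] (m : ℕ) (p : V → Prop) (v : V) : Prop :=
  p v ∧ cnt (fun y => y < v ∧ p y) < m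

variable {V : Type}

variable (arc : V → V → Prop) (T : Finset V) (S : Finset (V × V))

/-- Nonterminals with the same in-neighbours and out-neighbours among the terminals. -/
def SameClass (u v : V) : Prop := u ∉ T ∧ v ∉ T ∧ ∀ t ∈ T, (arc t u ↔ arc t v)

/-- `v` is an end of an arc in `S`. -/
def Touched (v : V) : Prop := ∃ w, (v, w) ∈ S ∨ (w, v) ∈ S

/-- Without `S` no path of length two through a terminal connects `x` and `v`, so that `x` and `v`
may share a layer. -/
def Ambiguous (x v : V) : Prop :=
  ∀ t ∈ T, (arc t v → arc x t → (x, t) ∈ S) ∧ (arc v t → arc t x → (t, x) ∈ S)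

/-- The class of the nonterminal `v` may share a layer with a nonterminal touched by `S`. -/
def Dirty (v : V) : Prop := v ∉ T ∧ ∃ x, x ∉ T ∧ Touched S x ∧ Ambiguous arc T S x v

/-- The terminals that form a triangle with the arc from `u` to `w`. -/
def TermCand (u w t : V) : Prop := t ∈ T ∧ arc w t ∧ arc t u

/-- The untouched nonterminals that form a triangle with the arc from `u` to `w`. -/
def NonCand (u w v : V) : Prop := v ∉ T ∧ ¬ Touched S v ∧ arc w v ∧ arc v u

variable {arc T S} {k : ℕ} {X : Finset V} {ℓ : V → ℕ}

theorem SameClass.symm {u v : V} (h : SameClass arc T u v) : SameClass arc T v u :=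
  ⟨h.2.1, h.1, fun t ht => (h.2.2 t ht).symm⟩

theorem SameClass.trans {u v w : V} (h : SameClass arc T u v) (h' : SameClass arc T v w) :
    SameClass arc T u w :=
  ⟨h.1, h'.2.1, fun t ht => (h.2.2 t ht).trans (h'.2.2 t ht)⟩

theorem SameClass.refl {v : V} (h : v ∉ T) : SameClass arc T v v := ⟨h, h, fun _ _ => .rfl⟩

variable (arc S) in
/-- The arcs that remain when `S` is removed. -/
def Rest (u v : V) : Prop := arc u v ∧ (u, v) ∉ S

theorem rest_of_arc_left {u v : V} (hu : ¬ Touched S u) (h : arc u v) : Rest arc S u v :=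
  ⟨h, fun hS => hu ⟨v, .inl hS⟩⟩

theorem rest_of_arc_right {u v : V} (hv : ¬ Touched S v) (h : arc u v) : Rest arc S u v :=
  ⟨h, fun hS => hv ⟨u, .inr hS⟩⟩

theorem no_triangle (hF : ∀ t ∈ T, ¬ Relation.TransGen (Rest arc S) t t) {t a b : V} (ht : t ∈ T)
    (h1 : Rest arc S t a) (h2 : Rest arc S a b) (h3 : Rest arc S b t) : False :=
  hF t ht (((Relation.TransGen.single h1).tail h2).tail h3)

theorem no_square (hF : ∀ t ∈ T, ¬ Relation.TransGen (Rest arc S) t t) {t a b c : V} (ht : t ∈ T)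
    (h1 : Rest arc S t a) (h2 : Rest arc S a b) (h3 : Rest arc S b c) (h4 : Rest arc S c t) :
    False :=
  hF t ht ((((Relation.TransGen.single h1).tail h2).tail h3).tail h4)

theorem exists_rest_path (hA : IsTour arc) {x v : V} (hv : v ∉ T) (hvt : ¬ Dirty arc T S v)
    (hx : x ∉ T) (hxv : ¬ SameClass arc T x v) :
    ∃ t ∈ T, (arc t v ∧ Rest arc S x t) ∨ (arc v t ∧ Rest arc S t x) := by
  by_cases hxt : Touched S x
  · have : ¬ Ambiguous arc T S x v := fun h => hvt ⟨hv, x, hx, hxt, h⟩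
    unfold Ambiguous at this
    push Not at this
    obtain ⟨t, ht, h⟩ := this
    refine ⟨t, ht, ?_⟩
    by_cases h1 : arc t v ∧ arc x t ∧ (x, t) ∉ S
    · exact .inl h1
    · obtain ⟨h2, h3⟩ := h (fun a b => by by_contra hc; exact h1 ⟨a, b, hc⟩)
      exact .inr ⟨h2, h3⟩
  · have : ∃ t ∈ T, ¬ (arc t x ↔ arc t v) := by
      by_contra hc
      push Not at hc
      exact hxv ⟨hx, hv, hc⟩
    obtain ⟨t, ht, h⟩ := this
    refine ⟨t, ht, ?_⟩
    have hne : t ≠ x := fun h => hx (h ▸ ht)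
    have hne' : t ≠ v := fun h => hv (h ▸ ht)
    by_cases h1 : arc t v
    · exact .inl ⟨h1, rest_of_arc_left hxt (hA.of_not hne fun h2 => h ⟨fun _ => h1, fun _ => h2⟩)⟩
    · refine .inr ⟨hA.of_not hne' h1, rest_of_arc_right hxt ?_⟩
      by_contra h2
      exact h ⟨fun h3 => absurd h3 h2, fun h3 => absurd h3 h1⟩

theorem not_touched_of_sameClass (hA : IsTour arc) {u v : V} (hv : ¬ Dirty arc T S v)
    (h : SameClass arc T u v) : ¬ Touched S u := fun hu =>
  hv ⟨h.2.1, u, h.1, hu, fun t ht =>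
    ⟨fun h1 h2 => absurd h2 (hA.asymm ((h.2.2 t ht).2 h1)),
      fun h1 h2 => absurd h1 (hA.asymm ((h.2.2 t ht).1 h2))⟩⟩

/-- A class that is not dirty is homogeneous: every vertex outside of it sees all its members
alike. -/
theorem homogeneous (hA : IsTour arc) (hF : ∀ t ∈ T, ¬ Relation.TransGen (Rest arc S) t t)
    {u v x : V} (hv : ¬ Dirty arc T S v) (hu : SameClass arc T u v) (hx : ¬ SameClass arc T x v) :
    arc x u ↔ arc x v := by
  by_cases hxT : x ∈ T
  · exact hu.2.2 x hxT
  obtain ⟨t, ht, h⟩ := exists_rest_path hA hu.2.1 hv hxT hx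
  have hne : ∀ y, SameClass arc T y v → x ≠ y := by rintro y hy rfl; exact hx hy
  have key : ∀ y, SameClass arc T y v →
      (arc t v ∧ Rest arc S x t → arc x y) ∧ (arc v t ∧ Rest arc S t x → ¬ arc x y) := by
    intro y hy
    have hyt := not_touched_of_sameClass hA hv hy
    constructor
    · rintro ⟨h1, h2⟩
      by_contra h3
      exact no_triangle hF ht (rest_of_arc_right hyt ((hy.2.2 t ht).2 h1))
        (rest_of_arc_left hyt (hA.of_not (hne y hy) h3)) h2
    · rintro ⟨h1, h2⟩ h3
      have h4 : arc y t := hA.of_not (fun h => hy.1 (h ▸ ht)) fun h4 =>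
        hA.asymm h1 ((hy.2.2 t ht).1 h4)
      exact no_triangle hF ht h2 (rest_of_arc_right hyt h3) (rest_of_arc_left hyt h4)
  have hvv := SameClass.refl (arc := arc) hu.2.1
  rcases h with h | h
  · exact ⟨fun _ => (key v hvv).1 h, fun _ => (key u hu).1 h⟩
  · exact ⟨fun h' => absurd h' ((key u hu).2 h), fun h' => absurd h' ((key v hvv).2 h)⟩

theorem homogeneous' (hA : IsTour arc) (hF : ∀ t ∈ T, ¬ Relation.TransGen (Rest arc S) t t)
    {u v x : V} (hv : ¬ Dirty arc T S v) (hu : SameClass arc T u v) (hx : ¬ SameClass arc T x v) :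
    arc u x ↔ arc v x := by
  have h1 : u ≠ x := by rintro rfl; exact hx hu
  have h2 : v ≠ x := by rintro rfl; exact hx (.refl hu.2.1)
  rw [hA.2 _ _ h1, hA.2 _ _ h2, homogeneous hA hF hv hu hx]

/-- If more than `k` members of a homogeneous class of nonterminals are present, then one of them is
in no backward arc that leaves the class, and the whole class can join its layer. -/
theorem solvable_insert_of_class [DecidableEq V] (hA : IsTour arc)
    (hF : ∀ t ∈ T, ¬ Relation.TransGen (Rest arc S) t t) {v : V} (hv : ¬ Dirty arc T S v)
    (hvT : v ∉ T) (hℓ : IsLayering T X ℓ) (hk : (backArcs arc X ℓ).card ≤ k)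
    (hc : k + 1 ≤ (X.filter fun u => SameClass arc T u v).card) :
    Solvable arc T (insert v X) k := by
  obtain ⟨v', hv'X, hv', hpay⟩ : ∃ v' ∈ X, SameClass arc T v' v ∧ ∀ y, ¬ SameClass arc T y v →
      (v', y) ∉ backArcs arc X ℓ ∧ (y, v') ∉ backArcs arc X ℓ := by
    by_contra hcon
    push Not at hcon
    have := card_le_card_backArcs (arc := arc) (X := X) (ℓ := ℓ)
      (Z := X.filter fun u => SameClass arc T u v) fun z hz => by
        obtain ⟨hzX, hz⟩ := Finset.mem_filter.1 hz
        obtain ⟨y, hy, h⟩ := hcon z hzX hz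
        refine ⟨y, fun h => hy (Finset.mem_filter.1 h).2, ?_⟩
        by_cases h1 : (z, y) ∈ backArcs arc X ℓ
        · exact .inl h1
        · exact .inr (h h1)
    omega
  have hXv : ∀ x ∈ insert v X, ¬ SameClass arc T x v → x ∈ X := by
    intro x hx hxv
    rcases Finset.mem_insert.1 hx with rfl | h
    · exact absurd (.refl hvT) hxv
    · exact h
  refine ⟨fun x => if SameClass arc T x v then ℓ v' else ℓ x, ?_,
    (Finset.card_le_card ?_).trans hk⟩
  · intro t ht htX w hw hwt
    have htv : ¬ SameClass arc T t v := fun h => h.1 ht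
    simp only [if_neg htv]
    split_ifs with h
    · exact hℓ t ht (hXv t htX htv) v' hv'X (fun h => hv'.1 (h ▸ ht))
    · exact hℓ t ht (hXv t htX htv) w (hXv w hw h) hwt
  · rintro ⟨a, b⟩ hab
    rw [mem_backArcs] at hab ⊢
    obtain ⟨⟨ha, hb⟩, harc, hlt⟩ := hab
    by_cases ha' : SameClass arc T a v <;> by_cases hb' : SameClass arc T b v
    · simp [ha', hb'] at hlt
    · simp only [ha', hb', if_true, if_false] at hlt
      refine absurd (mem_backArcs.2 ⟨⟨hv'X, hXv b hb hb'⟩, ?_, hlt⟩) (hpay b hb').1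
      rwa [homogeneous' hA hF hv hv' hb', ← homogeneous' hA hF hv ha' hb']
    · simp only [ha', hb', if_true, if_false] at hlt
      refine absurd (mem_backArcs.2 ⟨⟨hXv a ha ha', hv'X⟩, ?_, hlt⟩) (hpay a ha').2
      rwa [homogeneous hA hF hv hv' ha', ← homogeneous hA hF hv hb' ha']
    · simp only [ha', hb', if_false] at hlt
      exact ⟨⟨hXv a ha ha', hXv b hb hb'⟩, harc, hlt⟩

/-- If all arcs of `S` that form a triangle with `v` are backward arcs, then the in-neighbours of
`v`, then `v` with its class, and then the out-neighbours of `v` can be put one after the other. -/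
theorem solvable_insert_of_forced [DecidableEq V] (hA : IsTour arc)
    (hF : ∀ t ∈ T, ¬ Relation.TransGen (Rest arc S) t t) {v : V} (hv : ¬ Dirty arc T S v)
    (hvt : ¬ Touched S v) (hℓ : IsLayering T X ℓ) (hk : (backArcs arc X ℓ).card ≤ k)
    (hf : ∀ q ∈ X, ∀ p ∈ X, (q, p) ∈ S → arc p v → arc v q → ℓ p < ℓ q) :
    Solvable arc T (insert v X) k := by
  let U : V → Prop := fun x => x = v ∨ SameClass arc T x v
  have hhom : ∀ a x, U a → ¬ U x → (arc x a ↔ arc x v) ∧ (arc a x ↔ arc v x) := by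
    rintro a x (rfl | ha) hx
    · exact ⟨.rfl, .rfl⟩
    · exact ⟨homogeneous hA hF hv ha fun h => hx (.inr h),
        homogeneous' hA hF hv ha fun h => hx (.inr h)⟩
  have hX : ∀ x ∈ insert v X, ¬ U x → x ∈ X := fun x hx hU =>
    (Finset.mem_insert.1 hx).resolve_left fun h => hU (.inl h)
  have hne : ∀ x, ¬ U x → x ≠ v := fun x hx h => hx (.inl h)
  obtain ⟨M, hM⟩ : ∃ M, ∀ x ∈ X, ℓ x ≤ M := ⟨X.sup ℓ, fun x hx => Finset.le_sup hx⟩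
  let ℓ' : V → ℕ := fun x => if U x then M + 1 else if arc x v then ℓ x else M + 2 + ℓ x
  have hU : ∀ x, U x → ℓ' x = M + 1 := fun x hx => if_pos hx
  have hP : ∀ x, ¬ U x → arc x v → ℓ' x = ℓ x := fun x hx h => by simp only [ℓ', if_neg hx, if_pos h]
  have hQ : ∀ x, ¬ U x → ¬ arc x v → ℓ' x = M + 2 + ℓ x := fun x hx h => by
    simp only [ℓ', if_neg hx, if_neg h]
  have hcase : ∀ x ∈ insert v X, ¬ U x →
      (arc x v ∧ ℓ' x = ℓ x ∧ ℓ x ≤ M) ∨ (¬ arc x v ∧ ℓ' x = M + 2 + ℓ x) := by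
    intro x hx hxU
    by_cases h : arc x v
    · exact .inl ⟨h, hP x hxU h, hM x (hX x hx hxU)⟩
    · exact .inr ⟨h, hQ x hxU h⟩
  refine ⟨ℓ', ?_, (Finset.card_le_card ?_).trans hk⟩
  · intro t ht htX w hw hwt
    by_cases hUt : U t <;> by_cases hUw : U w
    · have h1 : t = v := hUt.resolve_right fun h => h.1 ht
      have h2 : w = v := hUw.resolve_right fun h => h.2.1 (h1 ▸ ht)
      exact absurd (h2.trans h1.symm) hwt
    · rw [hU t hUt]
      rcases hcase w hw hUw with h | h <;> omega
    · rw [hU w hUw]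
      rcases hcase t htX hUt with h | h <;> omega
    · have := hℓ t ht (hX t htX hUt) w (hX w hw hUw) hwt
      rcases hcase t htX hUt with h | h <;> rcases hcase w hw hUw with h' | h' <;> omega
  · rintro ⟨a, b⟩ hab
    rw [mem_backArcs] at hab ⊢
    obtain ⟨⟨ha, hb⟩, harc, hlt⟩ := hab
    by_cases hUa : U a <;> by_cases hUb : U b
    · rw [hU a hUa, hU b hUb] at hlt
      omega
    · rw [hU a hUa] at hlt
      rcases hcase b hb hUb with h | h
      · exact absurd h.1 (hA.asymm ((hhom a b hUa hUb).2.1 harc))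
      · omega
    · rw [hU b hUb] at hlt
      rcases hcase a ha hUa with h | h
      · omega
      · exact absurd ((hhom b a hUb hUa).1.1 harc) h.1
    · refine ⟨⟨hX a ha hUa, hX b hb hUb⟩, harc, ?_⟩
      rcases hcase a ha hUa with h | h <;> rcases hcase b hb hUb with h' | h'
      · omega
      · omega
      swap
      · omega
      have hva : arc v a := hA.of_not (hne a hUa) h.1
      by_cases hS : (a, b) ∈ S
      · exact hf a (hX a ha hUa) b (hX b hb hUb) hS h'.1 hva
      · exfalso
        have r1 : Rest arc S a b := ⟨harc, hS⟩
        have r2 := rest_of_arc_left hvt hva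
        have r3 := rest_of_arc_right hvt h'.1
        by_cases hvT : v ∈ T
        · exact no_triangle hF hvT r2 r1 r3
        by_cases haT : a ∈ T
        · exact no_triangle hF haT r1 r3 r2
        obtain ⟨t, ht, ⟨h1, h2⟩ | ⟨h1, h2⟩⟩ := exists_rest_path hA hvT hv haT fun h => hUa (.inr h)
        · exact no_triangle hF ht (rest_of_arc_right hvt h1) r2 h2
        · exact no_square hF ht h2 r1 r3 (rest_of_arc_left hvt h1)

/-- More than `k` terminals in triangles with an arc force it to be a backward arc. -/
theorem forced_of_terminals (hA : IsTour arc) {u w : V} (hu : u ∈ X) (hw : w ∈ X)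
    (hℓ : IsLayering T X ℓ) {Z : Finset V} (hZ : ∀ t ∈ Z, t ∈ X ∧ TermCand arc T u w t)
    (hk : (backArcs arc X ℓ).card < Z.card) : ℓ w < ℓ u := by
  by_contra hcon
  refine absurd (card_le_card_backArcs (arc := arc) (X := X) (ℓ := ℓ) (Z := Z) fun t ht => ?_)
    (not_le.2 hk)
  obtain ⟨htX, htT, h1, h2⟩ := hZ t ht
  by_cases h3 : ℓ t < ℓ w
  · exact ⟨w, fun h => hA.1 w (hZ w h).2.2.1, .inr (mem_backArcs.2 ⟨⟨hw, htX⟩, h1, h3⟩)⟩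
  · have := hℓ t htT htX w hw (hA.ne h1)
    exact ⟨u, fun h => hA.1 u (hZ u h).2.2.2, .inl (mem_backArcs.2 ⟨⟨htX, hu⟩, h2, by omega⟩)⟩

variable [Fintype V] [LinearOrder V]

theorem cnt_eq {W : Type} [Fintype W] (p : W → Prop) [DecidablePred p] :
    cnt p = (Finset.univ.filter p).card := by
  unfold cnt; congr

theorem cnt_mono {W : Type} [Fintype W] {p q : W → Prop} (h : ∀ v, p v → q v) : cnt p ≤ cnt q :=
  Finset.card_le_card fun v hv => by simp at hv ⊢; exact h v hv

theorem cnt_first_le (m : ℕ) (p : V → Prop) : cnt (First m p) ≤ m := by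
  by_contra hcon
  have hne : (Finset.univ.filter (First m p)).Nonempty := by
    rw [← Finset.card_pos]; unfold cnt at hcon; omega
  obtain ⟨v, hv, hmax⟩ := Finset.exists_max_image _ id hne
  simp only [Finset.mem_filter, Finset.mem_univ, true_and, id] at hv hmax
  have : Finset.univ.filter (First m p) ⊆ insert v (Finset.univ.filter fun y => y < v ∧ p y) := by
    intro y hy
    simp only [Finset.mem_filter, Finset.mem_univ, true_and, Finset.mem_insert] at hy ⊢
    rcases (hmax y hy).eq_or_lt with h | h
    · exact .inl h
    · exact .inr ⟨h, hy.1⟩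
  have h1 := (Finset.card_le_card this).trans (Finset.card_insert_le _ _)
  have h2 := hv.2
  rw [cnt_eq] at h2 hcon
  omega

theorem le_cnt_first {m : ℕ} {p : V → Prop} {v : V} (hv : p v) (hv' : ¬ First m p v) :
    m ≤ cnt (First m p) := by
  have hne : (Finset.univ.filter fun v => p v ∧ ¬ First m p v).Nonempty :=
    ⟨v, by simp [hv, hv']⟩
  obtain ⟨w, hw, hmin⟩ := Finset.exists_min_image _ id hne
  simp only [Finset.mem_filter, Finset.mem_univ, true_and, id] at hw hmin
  have h1 : m ≤ cnt fun y => y < w ∧ p y := by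
    by_contra h; exact hw.2 ⟨hw.1, by omega⟩
  refine h1.trans (cnt_mono fun y hy => ?_)
  by_contra h
  exact absurd (hmin y ⟨hy.2, h⟩) (not_le.2 hy.1)

section
variable (arc T S k)

/-- The same with only `k + 1` members of each class. -/
def ThinCand (u w v : V) : Prop :=
  First (k + 1) (fun y => SameClass arc T y v ∧ NonCand arc T S u w y) v

/-- The witnesses selected for the arcs in `S`: enough vertices in triangles with such an arc to
force it to be a backward arc, if there are so many. -/
def Marked (v : V) : Prop :=
  ∃ u w, (u, w) ∈ S ∧
    (First (k + 1) (TermCand arc T u w) v ∨ First (2 * k + 2) (ThinCand arc T S k u w) v)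

/-- The vertices that are not deleted. -/
def Keep (v : V) : Prop := Touched S v ∨ Dirty arc T S v ∨ Marked arc T S k v

end

/-- More than `2k + 1` nonterminals in triangles with an arc, at most `k + 1` in each class, force
it to be a backward arc: those that are in no backward arc with a terminal or an end of the arc
are all in the same class. -/
theorem forced_of_nonterminals (hA : IsTour arc)
    (hF : ∀ t ∈ T, ¬ Relation.TransGen (Rest arc S) t t) {u w : V} (hu : u ∈ X) (hw : w ∈ X)
    (hℓ : IsLayering T X ℓ) (hX : ∀ x, Touched S x → x ∈ X)
    (hXT : ∀ t, TermCand arc T u w t → t ∈ X) {Z : Finset V}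
    (hZ : ∀ v ∈ Z, v ∈ X ∧ ThinCand arc T S k u w v)
    (hk : (backArcs arc X ℓ).card ≤ k) (hZk : 2 * k + 2 ≤ Z.card) : ℓ w < ℓ u := by
  by_contra hcon
  have hZN : ∀ v ∈ Z, v ∈ X ∧ NonCand arc T S u w v := fun v hv =>
    ⟨(hZ v hv).1, (hZ v hv).2.1.2⟩
  let B := Z.filter fun z => ∀ y, y ∉ Z →
    (z, y) ∉ backArcs arc X ℓ ∧ (y, z) ∉ backArcs arc X ℓ
  have h1 : (Z \ B).card ≤ k := by
    refine le_trans (card_le_card_backArcs (arc := arc) (X := X) (ℓ := ℓ) fun z hz => ?_) hk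
    obtain ⟨hzZ, hzB⟩ := Finset.mem_sdiff.1 hz
    simp only [B, Finset.mem_filter, not_and, not_forall] at hzB
    obtain ⟨y, hy, h⟩ := hzB hzZ
    refine ⟨y, fun h => hy (Finset.mem_sdiff.1 h).1, ?_⟩
    by_cases h1 : (z, y) ∈ backArcs arc X ℓ
    · exact .inl h1
    · exact .inr (by simpa using h h1)
  have h2 : B.card + (Z \ B).card = Z.card := by
    rw [add_comm]; exact Finset.card_sdiff_add_card_eq_card (Finset.filter_subset _ _)
  have hB : ∀ a ∈ B, a ∈ X ∧ NonCand arc T S u w a ∧ ℓ a = ℓ w := by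
    intro a ha
    obtain ⟨haZ, ha⟩ := Finset.mem_filter.1 ha
    obtain ⟨haX, hac⟩ := hZN a haZ
    refine ⟨haX, hac, ?_⟩
    have h3 : ℓ w ≤ ℓ a := by
      by_contra h3
      exact (ha w fun h => hA.1 w (hZN w h).2.2.2.1).2
        (mem_backArcs.2 ⟨⟨hw, haX⟩, hac.2.2.1, by omega⟩)
    have h4 : ℓ a ≤ ℓ u := by
      by_contra h3
      exact (ha u fun h => hA.1 u (hZN u h).2.2.2.2).1
        (mem_backArcs.2 ⟨⟨haX, hu⟩, hac.2.2.2, by omega⟩)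
    omega
  have hcls : ∀ a ∈ B, ∀ b ∈ B, ∀ t ∈ T, arc t b → arc t a := by
    intro a ha b hb t ht htb
    by_contra hta
    obtain ⟨haX, ⟨haT, hat, hwa, hau⟩, hla⟩ := hB a ha
    obtain ⟨hbX, ⟨hbT, hbt, hwb, hbu⟩, hlb⟩ := hB b hb
    have hat' : arc a t := hA.of_not (fun h => haT (h ▸ ht)) hta
    have htX : t ∈ X := by
      by_cases htt : Touched S t
      · exact hX t htt
      · refine hXT t ⟨ht, ?_, ?_⟩
        · by_contra h
          have h3 : arc t w := hA.of_not (by rintro rfl; exact hA.asymm hwa hat') h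
          exact no_triangle hF ht (rest_of_arc_left htt h3) (rest_of_arc_right hat hwa)
            (rest_of_arc_left hat hat')
        · by_contra h
          have h3 : arc u t := hA.of_not (by rintro rfl; exact hA.asymm hbu htb) h
          exact no_triangle hF ht (rest_of_arc_left htt htb) (rest_of_arc_left hbt hbu)
            (rest_of_arc_right htt h3)
    have htZ : t ∉ Z := fun h => (hZN t h).2.1 ht
    have h3 : ℓ t ≤ ℓ b := by
      by_contra h3
      exact ((Finset.mem_filter.1 hb).2 t htZ).2 (mem_backArcs.2 ⟨⟨htX, hbX⟩, htb, by omega⟩)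
    have h4 : ℓ a ≤ ℓ t := by
      by_contra h3
      exact ((Finset.mem_filter.1 ha).2 t htZ).1 (mem_backArcs.2 ⟨⟨haX, htX⟩, hat', by omega⟩)
    exact hℓ t ht htX a haX (hA.ne hat') (by omega)
  obtain ⟨b, hb⟩ : B.Nonempty := by rw [← Finset.card_pos]; omega
  have hsub : B ⊆ Finset.univ.filter
      (First (k + 1) fun y => SameClass arc T y b ∧ NonCand arc T S u w y) := by
    intro a ha
    have hab : SameClass arc T a b := ⟨(hB a ha).2.1.1, (hB b hb).2.1.1, fun t ht =>
      ⟨hcls b hb a ha t ht, hcls a ha b hb t ht⟩⟩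
    have h3 := (hZ a (Finset.mem_filter.1 ha).1).2
    have h4 : (fun y => SameClass arc T y a ∧ NonCand arc T S u w y) =
        fun y => SameClass arc T y b ∧ NonCand arc T S u w y := by
      funext y
      exact propext (and_congr_left fun _ => ⟨fun h => h.trans hab, fun h => h.trans hab.symm⟩)
    simp only [Finset.mem_filter, Finset.mem_univ, true_and]
    unfold ThinCand at h3
    rwa [h4] at h3
  have h3 := (Finset.card_le_card hsub).trans (cnt_first_le (k + 1) _)
  omega

theorem solvable_insert (hA : IsTour arc)
    (hF : ∀ t ∈ T, ¬ Relation.TransGen (Rest arc S) t t) (hX : ∀ x, Keep arc T S k x → x ∈ X)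
    {v : V} (hvX : v ∉ X) (h : Solvable arc T X k) : Solvable arc T (insert v X) k := by
  obtain ⟨ℓ, hℓ, hk⟩ := h
  have hvK : ¬ Keep arc T S k v := fun h => hvX (hX v h)
  simp only [Keep, not_or] at hvK
  obtain ⟨hvt, hvd, hvm⟩ := hvK
  have hXt : ∀ x, Touched S x → x ∈ X := fun x h => hX x (.inl h)
  by_cases hf : ∀ q ∈ X, ∀ p ∈ X, (q, p) ∈ S → arc p v → arc v q → ℓ p < ℓ q
  · exact solvable_insert_of_forced hA hF hvd hvt hℓ hk hf
  push Not at hf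
  obtain ⟨u, hu, w, hw, huw, hwv, hvu, hlt⟩ := hf
  have hT : ∀ t, TermCand arc T u w t → First (k + 1) (TermCand arc T u w) t := by
    intro t ht
    by_contra hcon
    refine absurd (forced_of_terminals hA hu hw hℓ
      (Z := Finset.univ.filter (First (k + 1) (TermCand arc T u w))) (fun t ht => ?_)
      (lt_of_lt_of_le (Nat.lt_succ_of_le hk) (le_cnt_first ht hcon))) (not_lt.2 hlt)
    have ht' := (Finset.mem_filter.1 ht).2
    exact ⟨hX t (.inr (.inr ⟨u, w, huw, .inl ht'⟩)), ht'.1⟩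
  by_cases hvT : v ∈ T
  · exact absurd ⟨u, w, huw, .inl (hT v ⟨hvT, hwv, hvu⟩)⟩ hvm
  have hN : ∀ y, ThinCand arc T S k u w y → First (2 * k + 2) (ThinCand arc T S k u w) y := by
    intro y hy
    by_contra hcon
    refine absurd (forced_of_nonterminals hA hF hu hw hℓ hXt
      (fun t ht => hX t (.inr (.inr ⟨u, w, huw, .inl (hT t ht)⟩)))
      (Z := Finset.univ.filter (First (2 * k + 2) (ThinCand arc T S k u w))) (fun t ht => ?_)
      hk (le_cnt_first hy hcon)) (not_lt.2 hlt)
    have ht' := (Finset.mem_filter.1 ht).2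
    exact ⟨hX t (.inr (.inr ⟨u, w, huw, .inr ht'⟩)), ht'.1⟩
  have hvc : ¬ ThinCand arc T S k u w v := fun h => hvm ⟨u, w, huw, .inr (hN v h)⟩
  have hcard := le_cnt_first (p := fun y => SameClass arc T y v ∧ NonCand arc T S u w y)
    ⟨.refl hvT, hvT, hvt, hwv, hvu⟩ hvc
  refine solvable_insert_of_class hA hF hvd hvT hℓ hk (hcard.trans (Finset.card_le_card ?_))
  intro y hy
  have hy' := (Finset.mem_filter.1 hy).2
  have hyv : SameClass arc T y v := hy'.1.1
  refine Finset.mem_filter.2 ⟨hX y (.inr (.inr ⟨u, w, huw, .inr (hN y ?_)⟩)), hyv⟩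
  have h4 : (fun z => SameClass arc T z y ∧ NonCand arc T S u w z) =
      fun z => SameClass arc T z v ∧ NonCand arc T S u w z := by
    funext z
    exact propext (and_congr_left fun _ => ⟨fun h => h.trans hyv, fun h => h.trans hyv.symm⟩)
  unfold ThinCand
  rwa [h4]

theorem solvable_keep_iff (hA : IsTour arc)
    (hF : ∀ t ∈ T, ¬ Relation.TransGen (Rest arc S) t t) :
    Solvable arc T (Finset.univ.filter (Keep arc T S k)) k ↔ Solvable arc T Finset.univ k := by
  refine ⟨fun h => ?_, fun h => h.mono_set (Finset.subset_univ _)⟩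
  have : ∀ Y : Finset V, Solvable arc T (Finset.univ.filter (Keep arc T S k) ∪ Y) k := by
    intro Y
    induction Y using Finset.induction_on with
    | empty => simpa using h
    | insert a Y _ ih =>
      by_cases ha : a ∈ Finset.univ.filter (Keep arc T S k) ∪ Y
      · rwa [Finset.union_insert, Finset.insert_eq_self.2 ha]
      · rw [Finset.union_insert]
        exact solvable_insert hA hF (fun x hx => by simp [hx]) ha ih
  have := this Finset.univ
  rwa [Finset.union_eq_right.2 (Finset.subset_univ _)] at this

end Marking

/-! ### The number of remaining vertices -/

section Counting
open scoped Classical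

variable {V : Type} {arc : V → V → Prop} {T : Finset V} {S : Finset (V × V)}

/-- Classes of untouched nonterminals are linearly ordered by their sets of in-neighbours among the
terminals. -/
theorem inTerminals_chain (hA : IsTour arc) (hF : ∀ t ∈ T, ¬ Relation.TransGen (Rest arc S) t t)
    {u v : V} (hu : u ∉ T) (hv : v ∉ T) (hut : ¬ Touched S u) (hvt : ¬ Touched S v) :
    T.filter (arc · u) ⊆ T.filter (arc · v) ∨ T.filter (arc · v) ⊆ T.filter (arc · u) := by
  by_contra hcon
  simp only [not_or, Finset.not_subset, Finset.mem_filter, not_and] at hcon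
  obtain ⟨⟨t, ⟨ht, htu⟩, htv⟩, ⟨r, ⟨hr, hrv⟩, hru⟩⟩ := hcon
  have hvt' := hA.of_not (u := t) (v := v) (fun h => hv (h ▸ ht)) (htv ht)
  have hur := hA.of_not (u := r) (v := u) (fun h => hu (h ▸ hr)) (hru hr)
  exact no_square hF ht (rest_of_arc_right hut htu) (rest_of_arc_left hut hur)
    (rest_of_arc_right hvt hrv) (rest_of_arc_left hvt hvt')

variable [Fintype V]

theorem cnt_or_le (p q : V → Prop) : cnt (fun v => p v ∨ q v) ≤ cnt p + cnt q := by
  refine le_trans (Finset.card_le_card fun v hv => ?_) (Finset.card_union_le _ _)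
  simpa using hv

theorem cnt_touched_le (S : Finset (V × V)) : cnt (Touched S) ≤ 2 * S.card := by
  have : Finset.univ.filter (Touched S) ⊆ S.image Prod.fst ∪ S.image Prod.snd := by
    intro v hv
    obtain ⟨w, h | h⟩ := (Finset.mem_filter.1 hv).2
    · exact Finset.mem_union_left _ (Finset.mem_image.2 ⟨_, h, rfl⟩)
    · exact Finset.mem_union_right _ (Finset.mem_image.2 ⟨_, h, rfl⟩)
  have h1 := (Finset.card_le_card this).trans (Finset.card_union_le _ _)
  have h2 : (S.image Prod.fst).card ≤ S.card := Finset.card_image_le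
  have h3 : (S.image Prod.snd).card ≤ S.card := Finset.card_image_le
  unfold cnt
  omega

theorem cnt_marked_le [LinearOrder V] (arc : V → V → Prop) (T : Finset V) (S : Finset (V × V))
    (k : ℕ) : cnt (Marked arc T S k) ≤ S.card * (3 * k + 3) := by
  have : Finset.univ.filter (Marked arc T S k) ⊆ S.biUnion fun e =>
      Finset.univ.filter (First (k + 1) (TermCand arc T e.1 e.2)) ∪
        Finset.univ.filter (First (2 * k + 2) (ThinCand arc T S k e.1 e.2)) := by
    intro v hv
    obtain ⟨u, w, huw, h⟩ := (Finset.mem_filter.1 hv).2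
    refine Finset.mem_biUnion.2 ⟨(u, w), huw, ?_⟩
    simpa using h
  refine (Finset.card_le_card this).trans (Finset.card_biUnion_le_card_mul _ _ _ fun e _ => ?_)
  refine (Finset.card_union_le _ _).trans ?_
  have h1 := cnt_first_le (k + 1) (TermCand arc T e.1 e.2)
  have h2 := cnt_first_le (2 * k + 2) (ThinCand arc T S k e.1 e.2)
  unfold cnt at h1 h2
  omega

/-- The terminals that are joined to `x` by an arc in `S`. -/
noncomputable def badTerminals (T : Finset V) (S : Finset (V × V)) (x : V) : Finset V :=
  T.filter fun t => (x, t) ∈ S ∨ (t, x) ∈ S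

/-- Every arc in `S` contributes at most two to this sum: one for each nonterminal end, and one more
if exactly one of its ends is a terminal. -/
theorem sum_badTerminals_le (T : Finset V) (S : Finset (V × V)) :
    ∑ x ∈ Finset.univ.filter (fun x => x ∉ T ∧ Touched S x), ((badTerminals T S x).card + 1) ≤
      2 * S.card := by
  set W := Finset.univ.filter (fun x => x ∉ T ∧ Touched S x) with hW
  let S₁ := S.filter fun e => ¬ (e.1 ∈ T ↔ e.2 ∈ T)
  let S₂ := S.filter fun e => e.1 ∈ T ↔ e.2 ∈ T
  have hS : S₁.card + S₂.card = S.card := by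
    rw [add_comm]; exact Finset.card_filter_add_card_filter_not _
  have h1 : W.card ≤ S₁.card + 2 * S₂.card := by
    have : W ⊆ S₁.image (fun e => if e.1 ∈ T then e.2 else e.1) ∪
        (S₂.image Prod.fst ∪ S₂.image Prod.snd) := by
      intro x hx
      obtain ⟨hxT, w, h | h⟩ := (Finset.mem_filter.1 hx).2
      · by_cases hw : w ∈ T
        · refine Finset.mem_union_left _ (Finset.mem_image.2 ⟨(x, w), ?_, by simp [hxT]⟩)
          simp [S₁, h, hxT, hw]
        · refine Finset.mem_union_right _ (Finset.mem_union_left _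
            (Finset.mem_image.2 ⟨(x, w), ?_, rfl⟩))
          simp [S₂, h, hxT, hw]
      · by_cases hw : w ∈ T
        · refine Finset.mem_union_left _ (Finset.mem_image.2 ⟨(w, x), ?_, by simp [hw]⟩)
          simp [S₁, h, hxT, hw]
        · refine Finset.mem_union_right _ (Finset.mem_union_right _
            (Finset.mem_image.2 ⟨(w, x), ?_, rfl⟩))
          simp [S₂, h, hxT, hw]
    have h2 := (Finset.card_le_card this).trans (Finset.card_union_le _ _)
    have h3 := Finset.card_union_le (S₂.image Prod.fst) (S₂.image Prod.snd)
    have h4 : (S₂.image Prod.fst).card ≤ S₂.card := Finset.card_image_le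
    have h5 : (S₂.image Prod.snd).card ≤ S₂.card := Finset.card_image_le
    have h6 : (S₁.image (fun e => if e.1 ∈ T then e.2 else e.1)).card ≤ S₁.card :=
      Finset.card_image_le
    omega
  have h2 : ∑ x ∈ W, (badTerminals T S x).card ≤ S₁.card := by
    rw [← Finset.card_sigma]
    refine Finset.card_le_card_of_injOn
      (fun p => if (p.1, p.2) ∈ S then (p.1, p.2) else (p.2, p.1)) ?_ ?_
    · rintro ⟨x, t⟩ h
      simp only [Finset.coe_sigma, Set.mem_sigma_iff, Finset.mem_coe, badTerminals,
        Finset.mem_filter, W] at h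
      obtain ⟨⟨-, hx, -⟩, ht, h⟩ := h
      simp only
      split_ifs with h'
      · simp [S₁, h', hx, ht]
      · simp [S₁, h.resolve_left h', hx, ht]
    · rintro ⟨x, t⟩ h ⟨y, r⟩ h' heq
      simp only [Finset.coe_sigma, Set.mem_sigma_iff, Finset.mem_coe, badTerminals,
        Finset.mem_filter, W] at h h'
      obtain ⟨⟨-, hx, -⟩, ht, h⟩ := h
      obtain ⟨⟨-, hy, -⟩, hr, h'⟩ := h'
      simp only at heq
      split_ifs at heq <;> simp only [Prod.mk.injEq] at heq
      · rw [heq.1, heq.2]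
      · exact absurd (heq.1 ▸ hr) hx
      · exact absurd (heq.1 ▸ ht) hy
      · rw [heq.1, heq.2]
  rw [Finset.sum_add_distrib]
  simp
  omega

/-- The number of dirty classes with an untouched member: such a class is determined by a touched
nonterminal `x` and the number of in-neighbours of the class among the terminals joined to `x` by an
arc in `S`. -/
theorem card_dirty_classes_le (hA : IsTour arc)
    (hF : ∀ t ∈ T, ¬ Relation.TransGen (Rest arc S) t t) :
    ((Finset.univ.filter fun v => ¬ Touched S v ∧ Dirty arc T S v).image
      fun v => T.filter (arc · v)).card ≤ 2 * S.card := by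
  rcases isEmpty_or_nonempty V with hV | hV
  · simp [Finset.univ_eq_empty]
  refine le_trans ?_ (sum_badTerminals_le T S)
  set D := Finset.univ.filter fun v => ¬ Touched S v ∧ Dirty arc T S v with hD
  have hw : ∀ τ : Finset V, ∃ x, τ ∈ D.image (fun v => T.filter (arc · v)) →
      (x ∉ T ∧ Touched S x) ∧ ∃ v ∈ D, T.filter (arc · v) = τ ∧ Ambiguous arc T S x v := by
    intro τ
    by_cases hτ : τ ∈ D.image (fun v => T.filter (arc · v))
    · obtain ⟨v, hv, rfl⟩ := Finset.mem_image.1 hτ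
      obtain ⟨-, -, -, x, hx, hxt, hxv⟩ := Finset.mem_filter.1 hv
      exact ⟨x, fun _ => ⟨⟨hx, hxt⟩, v, hv, rfl, hxv⟩⟩
    · exact ⟨Classical.arbitrary V, fun h => absurd h hτ⟩
  choose x hx using hw
  have h1 : ∀ y, (badTerminals T S y).card + 1 =
      (Finset.range ((badTerminals T S y).card + 1)).card := fun y => by simp
  rw [Finset.sum_congr rfl fun y _ => h1 y, ← Finset.card_sigma]
  refine Finset.card_le_card_of_injOn
    (fun τ => ⟨x τ, (τ ∩ badTerminals T S (x τ)).card⟩) ?_ ?_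
  · intro τ hτ
    have h2 := (hx τ hτ).1
    simp only [Finset.coe_sigma, Set.mem_sigma_iff, Finset.mem_coe, Finset.mem_filter,
      Finset.mem_univ, true_and, Finset.mem_range, Nat.lt_succ_iff]
    exact ⟨h2, Finset.card_le_card Finset.inter_subset_right⟩
  · intro τ hτ σ hσ heq
    simp only [Sigma.mk.injEq, heq_eq_eq] at heq
    obtain ⟨hxx, hcard⟩ := heq
    obtain ⟨⟨hxT, -⟩, v, hvD, hv, hxv⟩ := hx τ hτ
    obtain ⟨-, w, hwD, hw, hxw⟩ := hx σ hσ
    rw [← hxx] at hxw hcard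
    obtain ⟨hvt, hvd⟩ := (Finset.mem_filter.1 hvD).2
    obtain ⟨hwt, hwd⟩ := (Finset.mem_filter.1 hwD).2
    -- away from these terminals both sets are determined by the arcs at `x`
    have hoff : ∀ u, u ∉ T → Ambiguous arc T S (x τ) u → ∀ t ∈ T, t ∉ badTerminals T S (x τ) →
        (arc t u ↔ arc t (x τ)) := by
      intro u hu hamb t ht htb
      simp only [badTerminals, Finset.mem_filter, not_and, not_or] at htb
      obtain ⟨h3, h4⟩ := htb ht
      obtain ⟨h5, h6⟩ := hamb t ht
      constructor
      · intro h7
        by_contra h8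
        exact h3 (h5 h7 (hA.of_not (fun h => hxT (h ▸ ht)) h8))
      · intro h7
        by_contra h8
        exact h4 (h6 (hA.of_not (fun h => hu (h ▸ ht)) h8) h7)
    have hchain := inTerminals_chain hA hF hvd.1 hwd.1 hvt hwt
    rw [hv, hw] at hchain
    have hinter : τ ∩ badTerminals T S (x τ) = σ ∩ badTerminals T S (x τ) := by
      rcases hchain with h | h
      · exact Finset.eq_of_subset_of_card_le (Finset.inter_subset_inter_right h) hcard.ge
      · exact (Finset.eq_of_subset_of_card_le (Finset.inter_subset_inter_right h) hcard.le).symm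
    ext t
    by_cases htb : t ∈ badTerminals T S (x τ)
    · have := congrArg (t ∈ ·) hinter
      simpa [htb] using this
    · rw [← hv, ← hw]
      simp only [Finset.mem_filter]
      refine and_congr_right fun ht => ?_
      rw [hoff v hvd.1 hxv t ht htb, hoff w hwd.1 hxw t ht htb]

/-- If all classes have at most `6k + 6` members, then `O(sk)` vertices remain, where `s` is the size
of the feedback arc set. -/
theorem cnt_keep_le [LinearOrder V] (hA : IsTour arc)
    (hF : ∀ t ∈ T, ¬ Relation.TransGen (Rest arc S) t t) {k : ℕ}
    (hcls : ∀ v, cnt (fun u => SameClass arc T u v) ≤ 6 * k + 6) :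
    cnt (Keep arc T S k) ≤ 15 * S.card * k + 17 * S.card := by
  have h1 := cnt_touched_le S
  have h2 := cnt_marked_le arc T S k
  have h3 : cnt (fun v => ¬ Touched S v ∧ Dirty arc T S v) ≤ (6 * k + 6) * (2 * S.card) := by
    refine le_trans (Finset.card_le_mul_card_image (f := fun v => T.filter (arc · v)) _ (6 * k + 6)
      fun τ hτ => ?_) (Nat.mul_le_mul_left _ (by convert card_dirty_classes_le hA hF))
    obtain ⟨v, hv, rfl⟩ := Finset.mem_image.1 hτ
    refine le_trans (Finset.card_le_card fun u hu => ?_) (hcls v)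
    simp only [Finset.mem_filter, Finset.mem_univ, true_and] at hu hv ⊢
    refine ⟨hu.1.2.1, hv.2.1, fun t ht => ?_⟩
    have := congrArg (t ∈ ·) hu.2
    simpa [ht] using this
  have h4 : cnt (Keep arc T S k) ≤
      cnt (Touched S) + (cnt (fun v => ¬ Touched S v ∧ Dirty arc T S v) + cnt (Marked arc T S k)) := by
    refine le_trans (cnt_mono (q := fun v => Touched S v ∨
      ((¬ Touched S v ∧ Dirty arc T S v) ∨ Marked arc T S k v)) fun v hv => ?_)
      ((cnt_or_le _ _).trans (Nat.add_le_add_left (cnt_or_le _ _) _))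
    by_cases ht : Touched S v
    · exact .inl ht
    · rcases hv with h | h | h
      · exact .inl h
      · exact .inr (.inl ⟨ht, h⟩)
      · exact .inr (.inr h)
  nlinarith

end Counting

/-! ### Shrinking a class of nonterminals -/

section Core
open scoped Classical

variable {V : Type} {arc : V → V → Prop} {T X : Finset V} {ℓ : V → ℕ} {k : ℕ}

/-- A class of nonterminals cannot be torn apart by a cheap layering: after merging some layers of
nonterminals, all members with more than `k` in-neighbours and more than `k` out-neighbours in the
class are in the same layer. -/
theorem exists_layering_core_const (hA : IsTour arc) {U R : Finset V} (hUX : U ⊆ X)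
    (hUT : ∀ u ∈ U, u ∉ T) (huni : ∀ u ∈ U, ∀ v ∈ U, ∀ t ∈ T, t ∈ X → arc t u → arc t v)
    (hRU : R ⊆ U) (hRne : R.Nonempty) (hin : ∀ r ∈ R, k < (U.filter (arc · r)).card)
    (hout : ∀ r ∈ R, k < (U.filter (arc r ·)).card)
    (hℓ : IsLayering T X ℓ) (hk : (backArcs arc X ℓ).card ≤ k) :
    ∃ ℓ' m, IsLayering T X ℓ' ∧ (backArcs arc X ℓ').card ≤ k ∧ ∀ r ∈ R, ℓ' r = m := by
  have hne : ∀ u ∈ U, ∀ t ∈ T, t ≠ u := fun u hu t ht h => hUT u hu (h ▸ ht)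
  have huni' : ∀ u ∈ U, ∀ v ∈ U, ∀ t ∈ T, t ∈ X → arc u t → arc v t := by
    intro u hu v hv t ht htX h
    by_contra h'
    exact hA.asymm h (huni v hv u hu t ht htX (hA.of_not (hne v hv t ht).symm h'))
  let U₀ := U.filter fun v => ∀ t ∈ T, t ∈ X → (arc t v → ℓ t < ℓ v) ∧ (arc v t → ℓ v < ℓ t)
  have hpay : ∀ v ∈ U, v ∉ U₀ → ∃ t ∈ T, (v, t) ∈ backArcs arc X ℓ ∨ (t, v) ∈ backArcs arc X ℓ := by
    intro v hv hv0
    simp only [U₀, Finset.mem_filter, not_and, not_forall] at hv0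
    obtain ⟨t, ht, htX, h⟩ := hv0 hv
    have h1 := hℓ t ht htX v (hUX hv) (hne v hv t ht).symm
    refine ⟨t, ht, ?_⟩
    by_cases h2 : arc t v
    · refine .inr (mem_backArcs.2 ⟨⟨htX, hUX hv⟩, h2, ?_⟩)
      by_contra h3
      obtain ⟨h4, -⟩ := h fun _ => by omega
      exact hA.asymm h2 h4
    · have h2' := hA.of_not (hne v hv t ht) h2
      refine .inl (mem_backArcs.2 ⟨⟨hUX hv, htX⟩, h2', ?_⟩)
      by_contra h3
      obtain ⟨-, h4⟩ := h fun h => absurd h h2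
      omega
  obtain ⟨v₀, hv₀⟩ : U₀.Nonempty := by
    by_contra hcon
    rw [Finset.not_nonempty_iff_eq_empty] at hcon
    have h1 : U.card ≤ k := by
      refine le_trans (card_le_card_backArcs (arc := arc) (X := X) (ℓ := ℓ) fun v hv => ?_) hk
      obtain ⟨t, ht, h⟩ := hpay v hv (by simp [hcon])
      exact ⟨t, fun h => hUT t h ht, h⟩
    obtain ⟨r, hr⟩ := hRne
    have h2 := hin r hr
    have h3 := Finset.card_filter_le U (arc · r)
    omega
  obtain ⟨hv₀U, hv₀t⟩ := Finset.mem_filter.1 hv₀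
  let J : V → Prop := fun x =>
    x ∉ T ∧ ∀ t ∈ T, t ∈ X → (arc t v₀ → ℓ t < ℓ x) ∧ (arc v₀ t → ℓ x < ℓ t)
  have hJT : ∀ t ∈ T, ¬ J t := fun t ht h => h.1 ht
  -- vertices outside the interval `J` are on the same side of all its members
  have hJ : ∀ x ∈ X, ¬ J x → ∀ y, J y → (ℓ x < ℓ v₀ → ℓ x < ℓ y) ∧ (ℓ v₀ < ℓ x → ℓ y < ℓ x) := by
    intro x hx hxJ y hy
    by_cases hxT : x ∈ T
    · obtain ⟨h1, h2⟩ := hy.2 x hxT hx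
      obtain ⟨h3, h4⟩ := hv₀t x hxT hx
      by_cases h : arc x v₀
      · have := h1 h
        have := h3 h
        omega
      · have h' := hA.of_not (hne v₀ hv₀U x hxT) h
        have := h2 h'
        have := h4 h'
        omega
    · simp only [J, hxT, not_false_eq_true, true_and, not_forall] at hxJ
      obtain ⟨t, ht, htX, h⟩ := hxJ
      obtain ⟨h1, h2⟩ := hy.2 t ht htX
      obtain ⟨h3, h4⟩ := hv₀t t ht htX
      by_cases h' : arc t v₀
      · have h5 : ℓ x ≤ ℓ t := by
          by_contra h6
          exact h ⟨fun _ => by omega, fun h7 => absurd h7 (hA.asymm h')⟩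
        have := h1 h'
        have := h3 h'
        omega
      · have h'' := hA.of_not (hne v₀ hv₀U t ht) h'
        have h5 : ℓ t ≤ ℓ x := by
          by_contra h6
          exact h ⟨fun h7 => absurd h7 h', fun _ => by omega⟩
        have := h2 h''
        have := h4 h''
        omega
  refine ⟨fun x => if J x then ℓ v₀ else ℓ x, ℓ v₀, ?_, (Finset.card_le_card ?_).trans hk, ?_⟩
  · intro t ht htX w hw hwt
    simp only [if_neg (hJT t ht)]
    split_ifs with h
    · exact hℓ t ht htX v₀ (hUX hv₀U) (hne v₀ hv₀U t ht).symm
    · exact hℓ t ht htX w hw hwt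
  · rintro ⟨a, b⟩ hab
    rw [mem_backArcs] at hab ⊢
    obtain ⟨⟨ha, hb⟩, harc, hlt⟩ := hab
    refine ⟨⟨ha, hb⟩, harc, ?_⟩
    by_cases ha' : J a <;> by_cases hb' : J b <;> simp only [ha', hb', if_true, if_false] at hlt
    · omega
    · exact (hJ b hb hb' a ha').1 hlt
    · exact (hJ a ha ha' b hb').2 hlt
    · exact hlt
  · intro r hr
    have hrU := hRU hr
    refine if_pos ⟨hUT r hrU, fun t ht htX => ⟨fun h => ?_, fun h => ?_⟩⟩
    · by_contra hcon
      have h1 := hℓ t ht htX r (hUX hrU) (hne r hrU t ht).symm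
      refine absurd (le_trans (card_le_card_backArcs (arc := arc) (X := X) (ℓ := ℓ)
        (Z := U.filter (arc · r)) fun v hv => ?_) hk) (not_le.2 (hin r hr))
      obtain ⟨hvU, hvr⟩ := Finset.mem_filter.1 hv
      by_cases hv0 : v ∈ U₀
      · have h2 := ((Finset.mem_filter.1 hv0).2 t ht htX).1 (huni v₀ hv₀U v hvU t ht htX h)
        exact ⟨r, fun h => hA.1 r (Finset.mem_filter.1 h).2,
          .inl (mem_backArcs.2 ⟨⟨hUX hvU, hUX hrU⟩, hvr, by omega⟩)⟩
      · obtain ⟨s, hs, h2⟩ := hpay v hvU hv0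
        exact ⟨s, fun h => hUT s (Finset.mem_filter.1 h).1 hs, h2⟩
    · by_contra hcon
      have h1 := hℓ t ht htX r (hUX hrU) (hne r hrU t ht).symm
      refine absurd (le_trans (card_le_card_backArcs (arc := arc) (X := X) (ℓ := ℓ)
        (Z := U.filter (arc r ·)) fun v hv => ?_) hk) (not_le.2 (hout r hr))
      obtain ⟨hvU, hvr⟩ := Finset.mem_filter.1 hv
      by_cases hv0 : v ∈ U₀
      · have h2 := ((Finset.mem_filter.1 hv0).2 t ht htX).2 (huni' v₀ hv₀U v hvU t ht htX h)
        exact ⟨r, fun h => hA.1 r (Finset.mem_filter.1 h).2,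
          .inr (mem_backArcs.2 ⟨⟨hUX hrU, hUX hvU⟩, hvr, by omega⟩)⟩
      · obtain ⟨s, hs, h2⟩ := hpay v hvU hv0
        exact ⟨s, fun h => hUT s (Finset.mem_filter.1 h).1 hs, h2⟩

/-- The number of backward arcs if all members of `R` are in the layer `m`. -/
theorem card_backArcs_union [DecidableEq V] {Y R : Finset V} (hd : Disjoint Y R) {m : ℕ}
    (hm : ∀ r ∈ R, ℓ r = m) :
    (backArcs arc (Y ∪ R) ℓ).card = (backArcs arc Y ℓ).card +
      ∑ x ∈ Y, ((if m < ℓ x then (R.filter (arc x ·)).card else 0) +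
        if ℓ x < m then (R.filter (arc · x)).card else 0) := by
  have key : ∀ X : Finset V, (backArcs arc X ℓ).card =
      ∑ a ∈ X, ∑ b ∈ X, if arc a b ∧ ℓ b < ℓ a then 1 else 0 := by
    intro X
    rw [backArcs, Finset.card_filter, Finset.sum_product]
  rw [key, key, Finset.sum_union hd]
  simp only [Finset.sum_union hd]
  rw [Finset.sum_add_distrib, Finset.sum_add_distrib, Finset.sum_add_distrib]
  have h1 : ∑ a ∈ R, ∑ b ∈ R, (if arc a b ∧ ℓ b < ℓ a then 1 else 0) = 0 :=
    Finset.sum_eq_zero fun a ha => Finset.sum_eq_zero fun b hb => by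
      rw [hm a ha, hm b hb]; simp
  have h2 : ∑ a ∈ Y, ∑ b ∈ R, (if arc a b ∧ ℓ b < ℓ a then 1 else 0) =
      ∑ x ∈ Y, if m < ℓ x then (R.filter (arc x ·)).card else 0 := by
    refine Finset.sum_congr rfl fun a _ => ?_
    rw [Finset.card_filter]
    split_ifs with h
    · exact Finset.sum_congr rfl fun b hb => by rw [hm b hb]; simp [h]
    · exact Finset.sum_eq_zero fun b hb => by rw [hm b hb]; simp [h]
  have h3 : ∑ a ∈ R, ∑ b ∈ Y, (if arc a b ∧ ℓ b < ℓ a then 1 else 0) =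
      ∑ x ∈ Y, if ℓ x < m then (R.filter (arc · x)).card else 0 := by
    rw [Finset.sum_comm]
    refine Finset.sum_congr rfl fun a _ => ?_
    rw [Finset.card_filter]
    split_ifs with h
    · exact Finset.sum_congr rfl fun b hb => by rw [hm b hb]; simp [h]
    · exact Finset.sum_eq_zero fun b hb => by rw [hm b hb]; simp [h]
  rw [h1, h2, h3]
  omega

/-- Two sets of nonterminals that stay together in one layer are interchangeable if every other
vertex has, up to the threshold `k`, as many in-neighbours and out-neighbours in one as in the
other. -/
theorem solvable_exchange [DecidableEq V] {arc' : V → V → Prop} {Y R R' : Finset V} (hd : Disjoint Y R)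
    (hd' : Disjoint Y R') (hRne : R.Nonempty) (hRT : ∀ r ∈ R, r ∉ T) (hRT' : ∀ r ∈ R', r ∉ T)
    (hagree : ∀ x ∈ Y, ∀ y ∈ Y, arc' x y ↔ arc x y)
    (hnorm : ∀ ℓ, IsLayering T (Y ∪ R) ℓ → (backArcs arc (Y ∪ R) ℓ).card ≤ k →
      ∃ ℓ' m, IsLayering T (Y ∪ R) ℓ' ∧ (backArcs arc (Y ∪ R) ℓ').card ≤ k ∧ ∀ r ∈ R, ℓ' r = m)
    (hin : ∀ x ∈ Y, (R.filter (arc · x)).card ≤ k →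
      (R'.filter (arc' · x)).card ≤ (R.filter (arc · x)).card)
    (hout : ∀ x ∈ Y, (R.filter (arc x ·)).card ≤ k →
      (R'.filter (arc' x ·)).card ≤ (R.filter (arc x ·)).card)
    (h : Solvable arc T (Y ∪ R) k) : Solvable arc' T (Y ∪ R') k := by
  obtain ⟨ℓ₀, hℓ₀, hk₀⟩ := h
  obtain ⟨ℓ, m, hℓ, hk, hm⟩ := hnorm ℓ₀ hℓ₀ hk₀
  let ℓ' : V → ℕ := fun x => if x ∈ R' then m else ℓ x
  have hm' : ∀ r ∈ R', ℓ' r = m := fun r hr => if_pos hr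
  have hY' : ∀ x ∈ Y, ℓ' x = ℓ x := fun x hx => if_neg (Finset.disjoint_left.1 hd' hx)
  refine ⟨ℓ', ?_, ?_⟩
  · intro t ht htX w hw hwt
    have htY : t ∈ Y := (Finset.mem_union.1 htX).resolve_right fun h => hRT' t h ht
    rw [hY' t htY]
    rcases Finset.mem_union.1 hw with hw | hw
    · rw [hY' w hw]
      exact hℓ t ht (Finset.mem_union_left _ htY) w (Finset.mem_union_left _ hw) hwt
    · obtain ⟨r, hr⟩ := hRne
      rw [hm' w hw, ← hm r hr]
      exact hℓ t ht (Finset.mem_union_left _ htY) r (Finset.mem_union_right _ hr)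
        fun h => hRT r hr (h ▸ ht)
  · rw [card_backArcs_union hd hm] at hk
    rw [card_backArcs_union hd' hm']
    refine le_trans (add_le_add (Finset.card_le_card ?_) (Finset.sum_le_sum fun x hx => ?_)) hk
    · rintro ⟨a, b⟩ hab
      rw [mem_backArcs] at hab ⊢
      obtain ⟨⟨ha, hb⟩, harc, hlt⟩ := hab
      rw [hY' a ha, hY' b hb] at hlt
      exact ⟨⟨ha, hb⟩, (hagree a ha b hb).1 harc, hlt⟩
    · have h1 := (Finset.single_le_sum (f := fun x =>
        ((if m < ℓ x then (R.filter (arc x ·)).card else 0) +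
          if ℓ x < m then (R.filter (arc · x)).card else 0)) (fun _ _ => Nat.zero_le _) hx).trans
          ((Nat.le_add_left _ _).trans hk)
      rw [hY' x hx]
      by_cases h2 : m < ℓ x
      · simp only [h2, not_lt.2 h2.le, if_true, if_false] at h1 ⊢
        exact hout x hx h1
      · by_cases h3 : ℓ x < m
        · simp only [h2, h3, if_true, if_false, zero_add] at h1 ⊢
          exact hin x hx h1
        · simp [h2, h3]

/-- In a tournament at most `2k + 1` vertices have at most `k` in-neighbours. -/
theorem card_lowIndegree_le (hA : IsTour arc) (U : Finset V) (k : ℕ) :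
    (U.filter fun v => (U.filter (arc · v)).card ≤ k).card ≤ 2 * k + 1 := by
  set Z := U.filter fun v => (U.filter (arc · v)).card ≤ k with hZ
  have h1 : ∑ v ∈ Z, (Z.filter (arc · v)).card ≤ Z.card * k := by
    rw [← smul_eq_mul]
    refine Finset.sum_le_card_nsmul _ _ _ fun v hv => ?_
    refine le_trans (Finset.card_le_card ?_) (Finset.mem_filter.1 hv).2
    exact Finset.filter_subset_filter _ (Finset.filter_subset _ _)
  have h2 : ∑ v ∈ Z, (Z.filter (arc · v)).card = ∑ v ∈ Z, (Z.filter (arc v ·)).card := by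
    simp only [Finset.card_filter]
    exact Finset.sum_comm
  have h3 : ∀ v ∈ Z, (Z.filter (arc · v)).card + (Z.filter (arc v ·)).card + 1 = Z.card := by
    intro v hv
    rw [← Finset.card_erase_add_one hv, ← Finset.card_union_of_disjoint]
    · congr 2
      ext y
      simp only [Finset.mem_union, Finset.mem_filter, Finset.mem_erase]
      constructor
      · rintro (⟨h, h'⟩ | ⟨h, h'⟩)
        · exact ⟨hA.ne h', h⟩
        · exact ⟨(hA.ne h').symm, h⟩
      · rintro ⟨h, h'⟩
        by_cases h4 : arc y v
        · exact .inl ⟨h', h4⟩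
        · exact .inr ⟨h', hA.of_not h h4⟩
    · refine Finset.disjoint_filter.2 fun y _ h h' => hA.asymm h h'
  have h4 := Finset.sum_congr rfl h3
  rw [Finset.sum_add_distrib, Finset.sum_add_distrib, ← h2] at h4
  simp only [Finset.sum_const, smul_eq_mul, mul_one] at h4
  by_contra hcon
  have h5 : Z.card * (2 * k + 2) ≤ Z.card * Z.card := Nat.mul_le_mul_left _ (by omega)
  nlinarith

end Core

/-! ### Rewiring a class with a large core -/

section Rewire
open scoped Classical

variable {V : Type} [Fintype V] [LinearOrder V]

section
variable (arc : V → V → Prop) (U : V → Prop) (k : ℕ)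

/-- The members of the class `U` with many in-neighbours and many out-neighbours in `U`. -/
def Core (v : V) : Prop :=
  U v ∧ k < cnt (fun y => U y ∧ arc y v) ∧ k < cnt (fun y => U y ∧ arc v y)

/-- The number of earlier members of the core. -/
noncomputable def coreRank (v : V) : ℕ := cnt fun y => y < v ∧ Core arc U k y

/-- The arc from the member `r` of the new core to the vertex `x` outside of the core: there are
as many such arcs as before, if that number is at most `k`, and the number of arcs from `x` to the
new core is the same as before, if that number is at most `k`. -/
def Lead (r x : V) : Prop :=
  (coreRank arc U k r < cnt (fun y => Core arc U k y ∧ arc y x) ∧ coreRank arc U k r < k + 1) ∨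
    coreRank arc U k r + cnt (fun y => Core arc U k y ∧ arc x y) < 2 * k + 4

/-- The tournament after rewiring. The first `2k + 4` members of the core are the new core; the
orientation inside the new core only has to give every member more than `k` in-neighbours and more
than `k` out-neighbours. -/
def newArc (a b : V) : Prop :=
  (Core arc U k a ∧ Core arc U k b ∧ a ≠ b ∧
    (a < b ↔ ¬ (Even (coreRank arc U k a) ↔ Even (coreRank arc U k b)))) ∨
  (Core arc U k a ∧ ¬ Core arc U k b ∧ Lead arc U k a b) ∨
  (¬ Core arc U k a ∧ Core arc U k b ∧ ¬ Lead arc U k b a) ∨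
  (¬ Core arc U k a ∧ ¬ Core arc U k b ∧ arc a b)

/-- The vertices that remain: all outside of the core, and the new core. -/
def NewKeep (v : V) : Prop := Core arc U k v → coreRank arc U k v < 2 * k + 4

end

variable {arc : V → V → Prop} {U : V → Prop} {k : ℕ} {T : Finset V}

theorem coreRank_lt {a b : V} (ha : Core arc U k a) (h : a < b) :
    coreRank arc U k a < coreRank arc U k b := by
  unfold coreRank
  rw [cnt_eq, cnt_eq]
  refine Finset.card_lt_card (Finset.ssubset_iff_of_subset ?_ |>.2 ⟨a, ?_, ?_⟩)
  · intro y hy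
    simp only [Finset.mem_filter, Finset.mem_univ, true_and] at hy ⊢
    exact ⟨hy.1.trans h, hy.2⟩
  · simp [h, ha]
  · simp

theorem coreRank_lt_iff {a b : V} (ha : Core arc U k a) (hb : Core arc U k b) :
    coreRank arc U k a < coreRank arc U k b ↔ a < b := by
  refine ⟨fun h => ?_, coreRank_lt ha⟩
  by_contra hcon
  rcases (not_lt.1 hcon).eq_or_lt with rfl | h'
  · exact lt_irrefl _ h
  · exact lt_asymm h (coreRank_lt hb h')

theorem cnt_first_eq {m : ℕ} {p : V → Prop} (h : m ≤ cnt p) : cnt (First m p) = m := by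
  refine le_antisymm (cnt_first_le _ _) ?_
  by_cases hall : ∃ v, p v ∧ ¬ First m p v
  · obtain ⟨v, hv, hv'⟩ := hall
    exact le_cnt_first hv hv'
  · push Not at hall
    exact h.trans (cnt_mono hall)

theorem exists_coreRank_eq {j : ℕ} (h : j < cnt (Core arc U k)) :
    ∃ v, Core arc U k v ∧ coreRank arc U k v = j := by
  by_contra hcon
  push Not at hcon
  have h1 := cnt_first_eq (p := Core arc U k) (m := j + 1) h
  have h2 := cnt_first_eq (p := Core arc U k) (m := j) h.le
  have h3 : cnt (First (j + 1) (Core arc U k)) ≤ cnt (First j (Core arc U k)) :=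
    cnt_mono fun v hv => ⟨hv.1, by
      have h4 := hcon v hv.1
      have h5 := hv.2
      unfold coreRank at h4
      omega⟩
  omega

theorem IsTour.newArc (hA : IsTour arc) : IsTour (newArc arc U k) := by
  constructor
  · intro u h
    rcases h with h | h | h | h
    · exact h.2.2.1 rfl
    · exact h.2.1 h.1
    · exact h.1 h.2.1
    · exact hA.1 u h.2.2
  · intro u v huv
    by_cases hu : Core arc U k u <;> by_cases hv : Core arc U k v
    · simp only [SFAST.newArc, hu, hv, huv, huv.symm, not_true_eq_false, false_and, and_false,
        or_false, true_and, ne_eq, not_false_eq_true]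
      have h1 : v < u ↔ ¬ u < v := by
        rw [not_lt]; exact ⟨fun h => h.le, fun h => lt_of_le_of_ne h huv.symm⟩
      rw [h1]
      tauto
    · simp only [SFAST.newArc, hu, hv, not_true_eq_false, false_and, and_false,
        or_false, false_or, true_and, not_false_eq_true, not_not]
    · simp only [SFAST.newArc, hu, hv, not_true_eq_false, false_and, and_false,
        or_false, false_or, true_and, not_false_eq_true]
    · simp only [SFAST.newArc, hu, hv, false_and,
        false_or, true_and, not_false_eq_true, hA.2 u v huv]

theorem cnt_lead {x : V} (hA : IsTour arc) (hbig : 2 * k + 5 ≤ cnt (Core arc U k))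
    (hx : ¬ Core arc U k x) :
    ∃ c ≤ 2 * k + 4, c = max (min (cnt fun y => Core arc U k y ∧ arc y x) (k + 1))
        (2 * k + 4 - cnt fun y => Core arc U k y ∧ arc x y) ∧
      (cnt fun y => Core arc U k y ∧ arc y x) + (cnt fun y => Core arc U k y ∧ arc x y) =
        cnt (Core arc U k) ∧
      cnt (fun r => First (2 * k + 4) (Core arc U k) r ∧ newArc arc U k r x) = c ∧
      cnt (fun r => First (2 * k + 4) (Core arc U k) r ∧ newArc arc U k x r) = 2 * k + 4 - c := by
  have hsum : ∀ (p q : V → Prop), (∀ y, p y → (q y ↔ ¬ arc x y)) →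
      cnt (fun y => p y ∧ q y) + cnt (fun y => p y ∧ arc x y) = cnt p := by
    intro p q h
    rw [cnt_eq, cnt_eq, cnt_eq, ← Finset.card_union_of_disjoint]
    · congr 1
      ext y
      simp only [Finset.mem_union, Finset.mem_filter, Finset.mem_univ, true_and]
      have := h y
      tauto
    · refine Finset.disjoint_filter.2 fun y _ h1 h2 => (h y h1.1).1 h1.2 h2.2
  refine ⟨_, ?_, rfl, ?_, ?_⟩
  · omega
  · exact hsum _ _ fun y hy => hA.2 _ _ fun h => hx (h ▸ hy)
  set d := cnt fun y => Core arc U k y ∧ arc y x with hd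
  set e := cnt fun y => Core arc U k y ∧ arc x y with he
  have h1 : cnt (fun r => First (2 * k + 4) (Core arc U k) r ∧ newArc arc U k r x) =
      max (min d (k + 1)) (2 * k + 4 - e) := by
    rw [← cnt_first_eq (p := Core arc U k) (m := max (min d (k + 1)) (2 * k + 4 - e)) (by omega)]
    congr 1
    funext r
    refine propext ⟨?_, ?_⟩
    · rintro ⟨⟨hr, hr'⟩, h⟩
      refine ⟨hr, ?_⟩
      simp only [newArc, hr, hx, not_true_eq_false, false_and, and_false, or_false, false_or,
        true_and, not_false_eq_true, Lead, ← hd, ← he] at h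
      change coreRank arc U k r < _
      omega
    · rintro ⟨hr, hr'⟩
      change coreRank arc U k r < _ at hr'
      refine ⟨⟨hr, ?_⟩, ?_⟩
      · change coreRank arc U k r < _
        omega
      · simp only [newArc, hr, hx, not_true_eq_false, false_and, and_false, or_false, false_or,
          true_and, not_false_eq_true, Lead, ← hd, ← he]
        omega
  refine ⟨h1, ?_⟩
  have h2 : cnt (fun r => First (2 * k + 4) (Core arc U k) r ∧ newArc arc U k r x) +
      cnt (fun r => First (2 * k + 4) (Core arc U k) r ∧ newArc arc U k x r) =
      cnt (First (2 * k + 4) (Core arc U k)) := by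
    rw [cnt_eq, cnt_eq, cnt_eq, ← Finset.card_union_of_disjoint]
    · congr 1
      ext y
      simp only [Finset.mem_union, Finset.mem_filter, Finset.mem_univ, true_and]
      by_cases hy : First (2 * k + 4) (Core arc U k) y
      · have : newArc arc U k y x ↔ ¬ newArc arc U k x y :=
          (hA.newArc).2 _ _ fun h => hx (h ▸ hy.1)
        tauto
      · tauto
    · exact Finset.disjoint_filter.2 fun y _ h1 h2 => hA.newArc.asymm h1.2 h2.2
  rw [cnt_first_eq (by omega)] at h2
  omega

/-- Every member of the new core has more than `k` in-neighbours and out-neighbours in it: of any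
two members of rank `2a` and `2a + 1` one is an in-neighbour and the other one is an out-neighbour. -/
theorem lt_cnt_newArc (hbig : 2 * k + 5 ≤ cnt (Core arc U k)) {r : V} (hr : Core arc U k r) :
    k < cnt (fun y => First (2 * k + 4) (Core arc U k) y ∧ newArc arc U k y r) ∧
    k < cnt (fun y => First (2 * k + 4) (Core arc U k) y ∧ newArc arc U k r y) := by
  have hex : ∀ j, ∃ v, j < 2 * k + 4 → Core arc U k v ∧ coreRank arc U k v = j := by
    intro j
    by_cases hj : j < 2 * k + 4
    · obtain ⟨v, hv⟩ := exists_coreRank_eq (arc := arc) (U := U) (k := k) (j := j) (by omega)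
      exact ⟨v, fun _ => hv⟩
    · exact ⟨r, fun h => absurd h hj⟩
  choose f hf using hex
  obtain ⟨i, hi⟩ : ∃ i, i = coreRank arc U k r := ⟨_, rfl⟩
  have key : ∀ p : V → Prop, (∀ a < k + 2, a ≠ i / 2 → p (f (2 * a)) ∨ p (f (2 * a + 1))) →
      k < cnt (fun y => First (2 * k + 4) (Core arc U k) y ∧ p y) := by
    intro p hp
    have h1 : ((Finset.range (k + 2)).erase (i / 2)).card ≤
        (Finset.univ.filter fun y => First (2 * k + 4) (Core arc U k) y ∧ p y).card := by
      refine Finset.card_le_card_of_injOn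
        (fun a => if p (f (2 * a)) then f (2 * a) else f (2 * a + 1)) ?_ ?_
      · intro a ha
        obtain ⟨ha', ha⟩ := Finset.mem_erase.1 ha
        have ha := Finset.mem_range.1 ha
        have h1 := hf (2 * a) (by omega)
        have h2 := hf (2 * a + 1) (by omega)
        simp only [Finset.coe_filter, Finset.mem_univ, true_and, Set.mem_ofPred_eq]
        split_ifs with h
        · exact ⟨⟨h1.1, by change coreRank arc U k _ < _; omega⟩, h⟩
        · exact ⟨⟨h2.1, by change coreRank arc U k _ < _; omega⟩, (hp a ha ha').resolve_left h⟩
      · intro a ha b hb hab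
        obtain ⟨-, ha⟩ := Finset.mem_erase.1 ha
        obtain ⟨-, hb⟩ := Finset.mem_erase.1 hb
        have ha := Finset.mem_range.1 ha
        have hb := Finset.mem_range.1 hb
        have h1 := (hf (2 * a) (by omega)).2
        have h2 := (hf (2 * a + 1) (by omega)).2
        have h3 := (hf (2 * b) (by omega)).2
        have h4 := (hf (2 * b + 1) (by omega)).2
        have h5 := congrArg (coreRank arc U k) hab
        simp only at h5
        split_ifs at h5 <;> omega
    have h2 := Finset.pred_card_le_card_erase (s := Finset.range (k + 2)) (a := i / 2)
    rw [Finset.card_range] at h2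
    rw [cnt_eq]
    omega
  have hne : ∀ j < 2 * k + 4, j ≠ i → f j ≠ r ∧ (f j < r ↔ j < i) := by
    intro j hj hji
    obtain ⟨h1, h2⟩ := hf j hj
    refine ⟨fun h => hji (by rw [← h2, h, hi]), ?_⟩
    rw [← coreRank_lt_iff h1 hr, h2, hi]
  have hlt : ∀ j < 2 * k + 4, j ≠ i → (r < f j ↔ i < j) := by
    intro j hj hji
    obtain ⟨h1, h2⟩ := hf j hj
    rw [← coreRank_lt_iff hr h1, h2, hi]
  constructor
  · refine key _ fun a ha hai => ?_
    have h1 := hf (2 * a) (by omega)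
    have h2 := hf (2 * a + 1) (by omega)
    have h3 := hne (2 * a) (by omega) (by omega)
    have h4 := hne (2 * a + 1) (by omega) (by omega)
    simp only [newArc, hr, h1.1, h2.1, not_true_eq_false, false_and, or_false, true_and, h1.2, h2.2,
      ← hi, h3.1, h4.1, h3.2, h4.2, ne_eq, not_false_eq_true, Nat.even_iff]
    omega
  · refine key _ fun a ha hai => ?_
    have h1 := hf (2 * a) (by omega)
    have h2 := hf (2 * a + 1) (by omega)
    have h3 := hlt (2 * a) (by omega) (by omega)
    have h4 := hlt (2 * a + 1) (by omega) (by omega)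
    have h5 := (hne (2 * a) (by omega) (by omega)).1.symm
    have h6 := (hne (2 * a + 1) (by omega) (by omega)).1.symm
    simp only [newArc, hr, h1.1, h2.1, not_true_eq_false, false_and, or_false, true_and, h1.2, h2.2,
      ← hi, h5, h6, h3, h4, ne_eq, not_false_eq_true, Nat.even_iff]
    omega

/-- Rewiring a class with a large core yields an equivalent instance. -/
theorem solvable_newKeep_iff (hA : IsTour arc) {u₀ : V}
    (hU : ∀ v, U v ↔ SameClass arc T v u₀)
    (hbig : 2 * k + 5 ≤ cnt (Core arc U k)) :
    Solvable (newArc arc U k) T (Finset.univ.filter (NewKeep arc U k)) k ↔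
      Solvable arc T Finset.univ k := by
  set R := Finset.univ.filter (Core arc U k) with hR
  set R' := Finset.univ.filter (First (2 * k + 4) (Core arc U k)) with hR'
  set Y := Finset.univ.filter fun v => ¬ Core arc U k v with hY
  have hd : Disjoint Y R := Finset.disjoint_filter.2 fun v _ h h' => h h'
  have hd' : Disjoint Y R' := Finset.disjoint_filter.2 fun v _ h h' => h h'.1
  have hYR : Finset.univ = Y ∪ R := by
    ext v; simp only [hY, hR, Finset.mem_union, Finset.mem_filter, Finset.mem_univ, true_and]; tauto
  have hYR' : Finset.univ.filter (NewKeep arc U k) = Y ∪ R' := by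
    ext v
    simp only [hY, hR', Finset.mem_union, Finset.mem_filter, Finset.mem_univ, true_and, NewKeep,
      First, coreRank]
    tauto
  have hRT : ∀ r ∈ R, r ∉ T := fun r hr => ((hU r).1 (Finset.mem_filter.1 hr).2.1).1
  have hRT' : ∀ r ∈ R', r ∉ T := fun r hr => ((hU r).1 (Finset.mem_filter.1 hr).2.1.1).1
  have hmem : ∀ x ∈ Y, ¬ Core arc U k x := fun x hx => (Finset.mem_filter.1 hx).2
  have hRcard : R.card = cnt (Core arc U k) := rfl
  have hRne : R.Nonempty := by rw [← Finset.card_pos]; omega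
  have hRne' : R'.Nonempty := by
    rw [← Finset.card_pos]
    have : R'.card = 2 * k + 4 := cnt_first_eq (by omega)
    omega
  have hagree : ∀ x ∈ Y, ∀ y ∈ Y, newArc arc U k x y ↔ arc x y := by
    intro x hx y hy
    simp [newArc, hmem x hx, hmem y hy]
  have hc1 : ∀ x, (R.filter (arc · x)).card = cnt fun y => Core arc U k y ∧ arc y x := fun x => by
    rw [hR, Finset.filter_filter, cnt_eq]
  have hc2 : ∀ x, (R.filter (arc x ·)).card = cnt fun y => Core arc U k y ∧ arc x y := fun x => by
    rw [hR, Finset.filter_filter, cnt_eq]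
  have hc3 : ∀ x, (R'.filter (newArc arc U k · x)).card =
      cnt fun y => First (2 * k + 4) (Core arc U k) y ∧ newArc arc U k y x := fun x => by
    rw [hR', Finset.filter_filter, cnt_eq]
  have hc4 : ∀ x, (R'.filter (newArc arc U k x ·)).card =
      cnt fun y => First (2 * k + 4) (Core arc U k) y ∧ newArc arc U k x y := fun x => by
    rw [hR', Finset.filter_filter, cnt_eq]
  rw [hYR', hYR]
  constructor
  · refine solvable_exchange hd' hd hRne' hRT' hRT (fun x hx y hy => (hagree x hx y hy).symm) ?_ ?_ ?_
    · intro ℓ hℓ hk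
      -- the new class consists of the new core and the members outside of the core
      have hnew : ∀ u, U u → NewKeep arc U k u → ∀ t ∈ T,
          (newArc arc U k t u ↔ arc t u₀) := by
        intro u hUu hkeep t ht
        have htC : ¬ Core arc U k t := fun h => ((hU t).1 h.1).1 ht
        by_cases huC : Core arc U k u
        · have hC : ∀ y, Core arc U k y → (arc t y ↔ arc t u₀) := fun y hy =>
            ((hU y).1 hy.1).2.2 t ht
          simp only [newArc, huC, htC, not_true_eq_false, false_and, or_false, false_or,
            true_and, not_false_eq_true, and_false]
          by_cases h : arc t u₀
          · have h1 : (cnt fun y => Core arc U k y ∧ arc t y) = cnt (Core arc U k) := by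
              congr 1; funext y
              exact propext ⟨fun h => h.1, fun h' => ⟨h', (hC y h').2 h⟩⟩
            have h2 : (cnt fun y => Core arc U k y ∧ arc y t) = 0 := by
              rw [cnt_eq, Finset.card_eq_zero, Finset.filter_eq_empty_iff]
              rintro y _ ⟨h3, h4⟩
              exact hA.asymm h4 ((hC y h3).2 h)
            simp only [h, iff_true, Lead, h1, h2]
            omega
          · have h2 : (cnt fun y => Core arc U k y ∧ arc t y) = 0 := by
              rw [cnt_eq, Finset.card_eq_zero, Finset.filter_eq_empty_iff]
              rintro y _ ⟨h3, h4⟩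
              exact h ((hC y h3).1 h4)
            have h1 : (cnt fun y => Core arc U k y ∧ arc y t) = cnt (Core arc U k) := by
              congr 1; funext y
              exact propext ⟨fun h => h.1, fun h' => ⟨h', hA.of_not (u := t) (v := y)
                (fun h => htC (h ▸ h')) fun h4 => h ((hC y h').1 h4)⟩⟩
            simp only [h, iff_false, not_not, Lead, h1, h2]
            by_cases hlt : coreRank arc U k u < k + 1
            · exact .inl ⟨by omega, hlt⟩
            · have := hkeep huC
              exact .inr (by omega)
        · simp only [newArc, huC, htC, false_and, false_or,
            true_and, not_false_eq_true]
          exact ((hU u).1 hUu).2.2 t ht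
      have hsub : ∀ (p : V → Prop),
          cnt (fun y => First (2 * k + 4) (Core arc U k) y ∧ p y) ≤
          ((Finset.univ.filter fun v => U v ∧ NewKeep arc U k v).filter p).card := by
        intro p
        rw [Finset.filter_filter, ← cnt_eq]
        exact cnt_mono fun v hv => ⟨⟨hv.1.1.1, fun _ => hv.1.2⟩, hv.2⟩
      refine exists_layering_core_const hA.newArc
        (U := Finset.univ.filter fun v => U v ∧ NewKeep arc U k v) ?_
        (fun u hu => ((hU u).1 (Finset.mem_filter.1 hu).2.1).1) ?_ ?_ hRne' ?_ ?_ hℓ hk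
      · rw [← hYR']
        exact fun v hv => Finset.mem_filter.2 ⟨Finset.mem_univ v, (Finset.mem_filter.1 hv).2.2⟩
      · intro u hu v hv t ht _ h
        obtain ⟨-, hu1, hu2⟩ := Finset.mem_filter.1 hu
        obtain ⟨-, hv1, hv2⟩ := Finset.mem_filter.1 hv
        exact (hnew v hv1 hv2 t ht).2 ((hnew u hu1 hu2 t ht).1 h)
      · intro r hr
        have hr' := (Finset.mem_filter.1 hr).2
        exact Finset.mem_filter.2 ⟨Finset.mem_univ r, hr'.1.1, fun _ => hr'.2⟩
      · intro r hr
        exact (lt_cnt_newArc hbig (Finset.mem_filter.1 hr).2.1).1.trans_le (hsub _)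
      · intro r hr
        exact (lt_cnt_newArc hbig (Finset.mem_filter.1 hr).2.1).2.trans_le (hsub _)
    · intro x hx
      obtain ⟨c, h1, h2, h3, h4, h5⟩ := cnt_lead hA hbig (hmem x hx)
      rw [hc1, hc3]
      omega
    · intro x hx
      obtain ⟨c, h1, h2, h3, h4, h5⟩ := cnt_lead hA hbig (hmem x hx)
      rw [hc2, hc4]
      omega
  · refine solvable_exchange hd hd' hRne hRT hRT' hagree ?_ ?_ ?_
    · intro ℓ hℓ hk
      refine exists_layering_core_const hA (U := Finset.univ.filter U) (hYR ▸ Finset.subset_univ _)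
        (fun u hu => ((hU u).1 (Finset.mem_filter.1 hu).2).1) ?_ ?_ hRne ?_ ?_ hℓ hk
      · intro u hu v hv t ht _ h
        have hu' := (hU u).1 (Finset.mem_filter.1 hu).2
        have hv' := (hU v).1 (Finset.mem_filter.1 hv).2
        exact (hv'.2.2 t ht).2 ((hu'.2.2 t ht).1 h)
      · intro r hr
        simp only [hR, Finset.mem_filter, Finset.mem_univ, true_and] at hr ⊢
        exact hr.1
      · intro r hr
        have := (Finset.mem_filter.1 hr).2.2.1
        rwa [cnt_eq, ← Finset.filter_filter] at this
      · intro r hr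
        have := (Finset.mem_filter.1 hr).2.2.2
        rwa [cnt_eq, ← Finset.filter_filter] at this
    · intro x hx
      obtain ⟨c, h1, h2, h3, h4, h5⟩ := cnt_lead hA hbig (hmem x hx)
      rw [hc1, hc3]
      omega
    · intro x hx
      obtain ⟨c, h1, h2, h3, h4, h5⟩ := cnt_lead hA hbig (hmem x hx)
      rw [hc2, hc4]
      omega

/-- A class with a small core is small. -/
theorem cnt_class_le (hA : IsTour arc) (h : cnt (Core arc U k) ≤ 2 * k + 4) :
    cnt U ≤ 6 * k + 6 := by
  have hA' : IsTour fun u v => arc v u := ⟨hA.1, fun u v h => hA.2 v u h.symm⟩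
  have h1 := card_lowIndegree_le hA (Finset.univ.filter U) k
  have h2 := card_lowIndegree_le hA' (Finset.univ.filter U) k
  have h3 : Finset.univ.filter U ⊆ Finset.univ.filter (Core arc U k) ∪
      (((Finset.univ.filter U).filter fun v => ((Finset.univ.filter U).filter (arc · v)).card ≤ k) ∪
      ((Finset.univ.filter U).filter fun v => ((Finset.univ.filter U).filter (arc v ·)).card ≤ k)) := by
    intro v hv
    have hv' := (Finset.mem_filter.1 hv).2
    simp only [Finset.filter_filter, Finset.mem_union, Finset.mem_filter, Finset.mem_univ, true_and,
      Core, cnt_eq]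
    by_cases h4 : (Finset.univ.filter fun y => U y ∧ arc y v).card ≤ k
    · exact .inr (.inl ⟨hv', h4⟩)
    · by_cases h5 : (Finset.univ.filter fun y => U y ∧ arc v y).card ≤ k
      · exact .inr (.inr ⟨hv', h5⟩)
      · exact .inl ⟨hv', by omega, by omega⟩
  have h4 := (Finset.card_le_card h3).trans ((Finset.card_union_le _ _).trans
    (Nat.add_le_add_left (Finset.card_union_le _ _) _))
  rw [cnt_eq] at h ⊢
  omega

end Rewire

/-! ### Functions of several arguments -/

theorem PolyFun.lift₂ {F : Dat → Dat → Dat} (h : PolyFun fun e => F e.left e.right) {f g : Dat → Dat}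
    (hf : PolyFun f) (hg : PolyFun g) : PolyFun fun d => F (f d) (g d) :=
  PolyFun.comp' h (hf.cons' hg)

theorem PolyFun.lift₃ {F : Dat → Dat → Dat → Dat}
    (h : PolyFun fun e => F e.left e.right.left e.right.right) {f₁ f₂ f₃ : Dat → Dat}
    (h₁ : PolyFun f₁) (h₂ : PolyFun f₂) (h₃ : PolyFun f₃) :
    PolyFun fun d => F (f₁ d) (f₂ d) (f₃ d) :=
  PolyFun.comp' h (h₁.cons' (h₂.cons' h₃))

theorem PolyFun.lift₄ {F : Dat → Dat → Dat → Dat → Dat}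
    (h : PolyFun fun e => F e.left e.right.left e.right.right.left e.right.right.right)
    {f₁ f₂ f₃ f₄ : Dat → Dat} (h₁ : PolyFun f₁) (h₂ : PolyFun f₂) (h₃ : PolyFun f₃)
    (h₄ : PolyFun f₄) : PolyFun fun d => F (f₁ d) (f₂ d) (f₃ d) (f₄ d) :=
  PolyFun.comp' h (h₁.cons' (h₂.cons' (h₃.cons' h₄)))

theorem PolyFun.lift₅ {F : Dat → Dat → Dat → Dat → Dat → Dat}
    (h : PolyFun fun e => F e.left e.right.left e.right.right.left e.right.right.right.left
      e.right.right.right.right)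
    {f₁ f₂ f₃ f₄ f₅ : Dat → Dat} (h₁ : PolyFun f₁) (h₂ : PolyFun f₂) (h₃ : PolyFun f₃)
    (h₄ : PolyFun f₄) (h₅ : PolyFun f₅) : PolyFun fun d => F (f₁ d) (f₂ d) (f₃ d) (f₄ d) (f₅ d) :=
  PolyFun.comp' h (h₁.cons' (h₂.cons' (h₃.cons' (h₄.cons' h₅))))

theorem PolyFun.lift₆ {F : Dat → Dat → Dat → Dat → Dat → Dat → Dat}
    (h : PolyFun fun e => F e.left e.right.left e.right.right.left e.right.right.right.left
      e.right.right.right.right.left e.right.right.right.right.right)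
    {f₁ f₂ f₃ f₄ f₅ f₆ : Dat → Dat} (h₁ : PolyFun f₁) (h₂ : PolyFun f₂) (h₃ : PolyFun f₃)
    (h₄ : PolyFun f₄) (h₅ : PolyFun f₅) (h₆ : PolyFun f₆) :
    PolyFun fun d => F (f₁ d) (f₂ d) (f₃ d) (f₄ d) (f₅ d) (f₆ d) :=
  PolyFun.comp' h (h₁.cons' (h₂.cons' (h₃.cons' (h₄.cons' (h₅.cons' h₆)))))

/-! ### Access to the input -/

/-- An entry of a matrix. -/
def entryD (M u v : Dat) : Dat := nthD (nthD M u) v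

@[fun_prop]
theorem PolyFun.entryD {M u v : Dat → Dat} (hM : PolyFun M) (hu : PolyFun u) (hv : PolyFun v) :
    PolyFun fun d => entryD (M d) (u d) (v d) := by
  unfold SFAST.entryD; fun_prop

/-- The list of vertices of an encoded graph. -/
def vertsD (g : Dat) : Dat := indicesD g.left

@[fun_prop]
theorem PolyFun.vertsD {g : Dat → Dat} (hg : PolyFun g) : PolyFun fun d => vertsD (g d) := by
  unfold SFAST.vertsD; fun_prop

theorem nthD_encVec {n : ℕ} (v : Fin n → Bool) (i : Fin n) :
    nthD (encVec v) (num i) = encProp (v i = true) := by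
  rw [encVec, encList_eq, nthD_eq _ _ (by simp)]
  simp [encBool_eq]

theorem entryD_encMat {n : ℕ} (M : Fin n → Fin n → Bool) (i j : Fin n) :
    entryD (encMat M) (num i) (num j) = encProp (M i j = true) := by
  rw [entryD, encMat, encList_eq, nthD_eq _ _ (by simp)]
  simp only [List.getElem_map, List.getElem_ofFn]
  exact nthD_encVec _ _

theorem len_encMat {n : ℕ} (M : Fin n → Fin n → Bool) : (encMat M).len = n := by
  simp [encMat, encList_eq, Dat.len]

/-- The arc relation. -/
def TerminalTournament.Arc (G : TerminalTournament) (u v : Fin G.n) : Prop := G.D.arc u v = true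

theorem TerminalTournament.isTour_arc (G : TerminalTournament) : IsTour G.Arc := G.isTour

section
variable (G : TerminalTournament) (u v : Fin G.n)

@[simp] theorem entryD_encGraph :
    entryD (encGraph G).left (num u) (num v) = encProp (G.Arc u v) := entryD_encMat _ _ _

@[simp] theorem nthD_encGraph : nthD (encGraph G).right (num v) = encProp (v ∈ G.T) := by
  rw [encGraph, Dat.right, nthD_encVec]; simp

@[simp] theorem vertsD_encGraph : vertsD (encGraph G) = vertList G.n :=
  indicesD_eq _ (len_encMat _)

@[simp] theorem entryD_encArcs {n : ℕ} (S : Finset (Fin n × Fin n)) (u v : Fin n) :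
    entryD (encArcs S) (num u) (num v) = encProp ((u, v) ∈ S) := by
  rw [encArcs, entryD_encMat]; simp

end

/-! ### Computing the rewired tournament -/

/-- The test for `SameClass`. -/
def sameD (g u v : Dat) : Dat :=
  andD (notD (nthD g.right u)) (andD (notD (nthD g.right v))
    (allD (fun t => impD (nthD g.right t) (iffD (entryD g.left t u) (entryD g.left t v)))
      (vertsD g)))

@[fun_prop]
theorem PolyFun.sameD {g u v : Dat → Dat} (hg : PolyFun g) (hu : PolyFun u) (hv : PolyFun v) :
    PolyFun fun d => sameD (g d) (u d) (v d) :=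
  PolyFun.lift₃ (by unfold SFAST.sameD; fun_prop) hg hu hv

/-- `2 * k + 4` in unary. -/
def thresholdD (k : Dat) : Dat := appendD k (appendD k (num 4))

@[fun_prop]
theorem PolyFun.thresholdD {k : Dat → Dat} (hk : PolyFun k) : PolyFun fun d => thresholdD (k d) := by
  unfold SFAST.thresholdD; fun_prop

@[simp] theorem len_thresholdD (k : Dat) : (thresholdD k).len = 2 * k.len + 4 := by
  simp [thresholdD]; omega

/-- The test for `Core`; here `o` is a member of the class. -/
def coreD (k g o v : Dat) : Dat :=
  andD (sameD g v o) (andD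
    (ltD k (filterD (fun y => andD (sameD g y o) (entryD g.left y v)) (vertsD g)))
    (ltD k (filterD (fun y => andD (sameD g y o) (entryD g.left v y)) (vertsD g))))

@[fun_prop]
theorem PolyFun.coreD {k g o v : Dat → Dat} (hk : PolyFun k) (hg : PolyFun g) (ho : PolyFun o)
    (hv : PolyFun v) : PolyFun fun d => coreD (k d) (g d) (o d) (v d) :=
  PolyFun.lift₄ (by unfold SFAST.coreD; fun_prop) hk hg ho hv

/-- A list of length `coreRank`. -/
def coreRankD (k g o v : Dat) : Dat :=
  filterD (fun y => andD (ltD y v) (coreD k g o y)) (vertsD g)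

@[fun_prop]
theorem PolyFun.coreRankD {k g o v : Dat → Dat} (hk : PolyFun k) (hg : PolyFun g) (ho : PolyFun o)
    (hv : PolyFun v) : PolyFun fun d => coreRankD (k d) (g d) (o d) (v d) :=
  PolyFun.lift₄ (by unfold SFAST.coreRankD; fun_prop) hk hg ho hv

/-- The test for `Lead`. -/
def leadD (k g o r x : Dat) : Dat :=
  orD
    (andD (ltD (coreRankD k g o r)
      (filterD (fun y => andD (coreD k g o y) (entryD g.left y x)) (vertsD g)))
      (ltD (coreRankD k g o r) (.cons .nil k)))
    (ltD (appendD (coreRankD k g o r)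
      (filterD (fun y => andD (coreD k g o y) (entryD g.left x y)) (vertsD g))) (thresholdD k))

@[fun_prop]
theorem PolyFun.leadD {k g o r x : Dat → Dat} (hk : PolyFun k) (hg : PolyFun g) (ho : PolyFun o)
    (hr : PolyFun r) (hx : PolyFun x) : PolyFun fun d => leadD (k d) (g d) (o d) (r d) (x d) :=
  PolyFun.lift₅ (by unfold SFAST.leadD; fun_prop) hk hg ho hr hx

/-- The parity of the length of a list. -/
def evenD (l : Dat) : Dat := l.toList.foldl (fun acc _ => notD acc) (.cons .nil .nil)

theorem foldl_notD_eq (L : List Dat) :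
    L.foldl (fun acc _ => notD acc) (.cons .nil .nil) = encProp (Even L.length) := by
  induction L using List.reverseRecOn with
  | nil => simp [encProp]
  | append_singleton L x ih =>
    rw [List.foldl_append, ih]
    simp [Nat.even_add_one]

@[simp] theorem evenD_eq (l : Dat) : evenD l = encProp (Even l.len) := foldl_notD_eq _

@[fun_prop]
theorem PolyFun.evenD {l : Dat → Dat} (hl : PolyFun l) : PolyFun fun d => evenD (l d) := by
  refine PolyFun.foldl (F := fun _ _ acc => SFAST.notD acc) hl (by fun_prop) (by fun_prop) 3
    fun d L _ => ?_
  rw [foldl_notD_eq]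
  unfold encProp
  split_ifs <;> simp [Dat.size]

/-- The test for `newArc`. -/
def newArcD (k g o a b : Dat) : Dat :=
  orD (andD (coreD k g o a) (andD (coreD k g o b) (andD (orD (ltD a b) (ltD b a))
      (iffD (ltD a b) (notD (iffD (evenD (coreRankD k g o a)) (evenD (coreRankD k g o b)))))))) <|
  orD (andD (coreD k g o a) (andD (notD (coreD k g o b)) (leadD k g o a b))) <|
  orD (andD (notD (coreD k g o a)) (andD (coreD k g o b) (notD (leadD k g o b a)))) <|
  andD (notD (coreD k g o a)) (andD (notD (coreD k g o b)) (entryD g.left a b))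

@[fun_prop]
theorem PolyFun.newArcD {k g o r x : Dat → Dat} (hk : PolyFun k) (hg : PolyFun g) (ho : PolyFun o)
    (hr : PolyFun r) (hx : PolyFun x) : PolyFun fun d => newArcD (k d) (g d) (o d) (r d) (x d) :=
  PolyFun.lift₅ (by unfold SFAST.newArcD; fun_prop) hk hg ho hr hx

/-- The test for `NewKeep`. -/
def newKeepD (k g o v : Dat) : Dat :=
  impD (coreD k g o v) (ltD (coreRankD k g o v) (thresholdD k))

@[fun_prop]
theorem PolyFun.newKeepD {k g o v : Dat → Dat} (hk : PolyFun k) (hg : PolyFun g) (ho : PolyFun o)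
    (hv : PolyFun v) : PolyFun fun d => newKeepD (k d) (g d) (o d) (v d) :=
  PolyFun.lift₄ (by unfold SFAST.newKeepD; fun_prop) hk hg ho hv

/-- The test whether `o` is in a class with a core that is so large that rewiring applies. -/
def bigD (k g o : Dat) : Dat :=
  andD (notD (nthD g.right o)) (ltD (thresholdD k) (filterD (fun v => coreD k g o v) (vertsD g)))

@[fun_prop]
theorem PolyFun.bigD {k g o : Dat → Dat} (hk : PolyFun k) (hg : PolyFun g) (ho : PolyFun o) :
    PolyFun fun d => bigD (k d) (g d) (o d) :=
  PolyFun.lift₃ (by unfold SFAST.bigD; fun_prop) hk hg ho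

/-- Rewire the class of `o`. -/
def rewireD (k g o : Dat) : Dat :=
  .cons (mapD (fun a => mapD (fun b => newArcD k g o a b)
      (filterD (fun v => newKeepD k g o v) (vertsD g)))
      (filterD (fun v => newKeepD k g o v) (vertsD g)))
    (mapD (fun a => nthD g.right a) (filterD (fun v => newKeepD k g o v) (vertsD g)))

@[fun_prop]
theorem PolyFun.rewireD {k g o : Dat → Dat} (hk : PolyFun k) (hg : PolyFun g) (ho : PolyFun o) :
    PolyFun fun d => rewireD (k d) (g d) (o d) :=
  PolyFun.lift₃ (by unfold SFAST.rewireD; fun_prop) hk hg ho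

/-- Rewire one class with a large core, if there is one. -/
def stepD (k g : Dat) : Dat :=
  (filterD (fun o => bigD k g o) (vertsD g)).cond
    (rewireD k g (filterD (fun o => bigD k g o) (vertsD g)).left) g

@[fun_prop]
theorem PolyFun.stepD {k g : Dat → Dat} (hk : PolyFun k) (hg : PolyFun g) :
    PolyFun fun d => stepD (k d) (g d) :=
  PolyFun.lift₂ (by unfold SFAST.stepD; fun_prop) hk hg

section
variable (G : TerminalTournament) (k : Dat) (o u v a b : Fin G.n)

@[simp] theorem sameD_encGraph :
    sameD (encGraph G) (num u) (num v) = encProp (SameClass G.Arc G.T u v) := by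
  simp [sameD, SameClass]

@[simp] theorem coreD_encGraph : coreD k (encGraph G) (num o) (num v) =
    encProp (Core G.Arc (SameClass G.Arc G.T · o) k.len v) := by
  simp [coreD, Core]

@[simp] theorem len_coreRankD_encGraph : (coreRankD k (encGraph G) (num o) (num v)).len =
    coreRank G.Arc (SameClass G.Arc G.T · o) k.len v := by
  simp [coreRankD, coreRank]

@[simp] theorem leadD_encGraph : leadD k (encGraph G) (num o) (num a) (num b) =
    encProp (Lead G.Arc (SameClass G.Arc G.T · o) k.len a b) := by
  simp [leadD, Lead]

theorem newArcD_encGraph : newArcD k (encGraph G) (num o) (num a) (num b) =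
    encProp (newArc G.Arc (SameClass G.Arc G.T · o) k.len a b) := by
  simp [newArcD, newArc]

theorem newKeepD_encGraph : newKeepD k (encGraph G) (num o) (num v) =
    encProp (NewKeep G.Arc (SameClass G.Arc G.T · o) k.len v) := by
  simp [newKeepD, NewKeep]

theorem bigD_encGraph : bigD k (encGraph G) (num o) =
    encProp (o ∉ G.T ∧ 2 * k.len + 4 < cnt (Core G.Arc (SameClass G.Arc G.T · o) k.len)) := by
  simp [bigD]

end

/-! ### Computing the vertices that are kept -/

/-- The test for `Touched`. -/
def touchedD (g S v : Dat) : Dat :=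
  anyD (fun w => orD (entryD S v w) (entryD S w v)) (vertsD g)

@[fun_prop]
theorem PolyFun.touchedD {g S v : Dat → Dat} (hg : PolyFun g) (hS : PolyFun S) (hv : PolyFun v) :
    PolyFun fun d => touchedD (g d) (S d) (v d) :=
  PolyFun.lift₃ (by unfold SFAST.touchedD; fun_prop) hg hS hv

/-- The test for `Ambiguous`. -/
def ambiguousD (g S x v : Dat) : Dat :=
  allD (fun t => impD (nthD g.right t) (andD
    (impD (entryD g.left t v) (impD (entryD g.left x t) (entryD S x t)))
    (impD (entryD g.left v t) (impD (entryD g.left t x) (entryD S t x))))) (vertsD g)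

@[fun_prop]
theorem PolyFun.ambiguousD {g S x v : Dat → Dat} (hg : PolyFun g) (hS : PolyFun S) (hx : PolyFun x)
    (hv : PolyFun v) : PolyFun fun d => ambiguousD (g d) (S d) (x d) (v d) :=
  PolyFun.lift₄ (by unfold SFAST.ambiguousD; fun_prop) hg hS hx hv

/-- The test for `Dirty`. -/
def dirtyD (g S v : Dat) : Dat :=
  andD (notD (nthD g.right v)) (anyD (fun x => andD (notD (nthD g.right x))
    (andD (touchedD g S x) (ambiguousD g S x v))) (vertsD g))

@[fun_prop]
theorem PolyFun.dirtyD {g S v : Dat → Dat} (hg : PolyFun g) (hS : PolyFun S) (hv : PolyFun v) :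
    PolyFun fun d => dirtyD (g d) (S d) (v d) :=
  PolyFun.lift₃ (by unfold SFAST.dirtyD; fun_prop) hg hS hv

/-- The test for `TermCand`. -/
def termCandD (g u w t : Dat) : Dat :=
  andD (nthD g.right t) (andD (entryD g.left w t) (entryD g.left t u))

@[fun_prop]
theorem PolyFun.termCandD {g u w t : Dat → Dat} (hg : PolyFun g) (hu : PolyFun u) (hw : PolyFun w)
    (ht : PolyFun t) : PolyFun fun d => termCandD (g d) (u d) (w d) (t d) :=
  PolyFun.lift₄ (by unfold SFAST.termCandD; fun_prop) hg hu hw ht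

/-- The test for `NonCand`. -/
def nonCandD (g S u w v : Dat) : Dat :=
  andD (notD (nthD g.right v)) (andD (notD (touchedD g S v))
    (andD (entryD g.left w v) (entryD g.left v u)))

@[fun_prop]
theorem PolyFun.nonCandD {g S u w v : Dat → Dat} (hg : PolyFun g) (hS : PolyFun S) (hu : PolyFun u)
    (hw : PolyFun w) (hv : PolyFun v) : PolyFun fun d => nonCandD (g d) (S d) (u d) (w d) (v d) :=
  PolyFun.lift₅ (by unfold SFAST.nonCandD; fun_prop) hg hS hu hw hv

/-- The test for `ThinCand`. -/
def thinCandD (k g S u w v : Dat) : Dat :=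
  andD (andD (sameD g v v) (nonCandD g S u w v)) (ltD (filterD (fun y => andD (ltD y v)
    (andD (sameD g y v) (nonCandD g S u w y))) (vertsD g)) (.cons .nil k))

@[fun_prop]
theorem PolyFun.thinCandD {k g S u w v : Dat → Dat} (hk : PolyFun k) (hg : PolyFun g)
    (hS : PolyFun S) (hu : PolyFun u) (hw : PolyFun w) (hv : PolyFun v) :
    PolyFun fun d => thinCandD (k d) (g d) (S d) (u d) (w d) (v d) :=
  PolyFun.lift₆ (by unfold SFAST.thinCandD; fun_prop) hk hg hS hu hw hv

/-- The test for `Marked`. -/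
def markedD (k g S v : Dat) : Dat :=
  anyD (fun u => anyD (fun w => andD (entryD S u w) (orD
    (andD (termCandD g u w v) (ltD (filterD (fun y => andD (ltD y v) (termCandD g u w y)) (vertsD g))
      (.cons .nil k)))
    (andD (thinCandD k g S u w v) (ltD (filterD (fun y => andD (ltD y v) (thinCandD k g S u w y))
      (vertsD g)) (appendD k (appendD k (num 2))))))) (vertsD g)) (vertsD g)

@[fun_prop]
theorem PolyFun.markedD {k g S v : Dat → Dat} (hk : PolyFun k) (hg : PolyFun g) (hS : PolyFun S)
    (hv : PolyFun v) : PolyFun fun d => markedD (k d) (g d) (S d) (v d) :=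
  PolyFun.lift₄ (by unfold SFAST.markedD; fun_prop) hk hg hS hv

/-- The test for `Keep`. -/
def keepD (k g S v : Dat) : Dat := orD (touchedD g S v) (orD (dirtyD g S v) (markedD k g S v))

@[fun_prop]
theorem PolyFun.keepD {k g S v : Dat → Dat} (hk : PolyFun k) (hg : PolyFun g) (hS : PolyFun S)
    (hv : PolyFun v) : PolyFun fun d => keepD (k d) (g d) (S d) (v d) := by
  unfold SFAST.keepD; fun_prop

/-- Delete the vertices that need not be kept. -/
def shrinkD (k g S : Dat) : Dat :=
  .cons (mapD (fun a => mapD (fun b => entryD g.left a b)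
      (filterD (fun v => keepD k g S v) (vertsD g)))
      (filterD (fun v => keepD k g S v) (vertsD g)))
    (mapD (fun a => nthD g.right a) (filterD (fun v => keepD k g S v) (vertsD g)))

@[fun_prop]
theorem PolyFun.shrinkD {k g S : Dat → Dat} (hk : PolyFun k) (hg : PolyFun g) (hS : PolyFun S) :
    PolyFun fun d => shrinkD (k d) (g d) (S d) :=
  PolyFun.lift₃ (by unfold SFAST.shrinkD; fun_prop) hk hg hS

section
variable (G : TerminalTournament) (S : Finset (Fin G.n × Fin G.n)) (k : Dat) (u v w x t : Fin G.n)

@[simp] theorem touchedD_encGraph :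
    touchedD (encGraph G) (encArcs S) (num v) = encProp (Touched S v) := by
  simp [touchedD, Touched]

@[simp] theorem ambiguousD_encGraph : ambiguousD (encGraph G) (encArcs S) (num x) (num v) =
    encProp (Ambiguous G.Arc G.T S x v) := by
  simp [ambiguousD, Ambiguous]

@[simp] theorem dirtyD_encGraph :
    dirtyD (encGraph G) (encArcs S) (num v) = encProp (Dirty G.Arc G.T S v) := by
  simp [dirtyD, Dirty]

@[simp] theorem termCandD_encGraph : termCandD (encGraph G) (num u) (num w) (num t) =
    encProp (TermCand G.Arc G.T u w t) := by
  simp [termCandD, TermCand]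

@[simp] theorem nonCandD_encGraph : nonCandD (encGraph G) (encArcs S) (num u) (num w) (num v) =
    encProp (NonCand G.Arc G.T S u w v) := by
  simp [nonCandD, NonCand]

@[simp] theorem thinCandD_encGraph :
    thinCandD k (encGraph G) (encArcs S) (num u) (num w) (num v) =
      encProp (ThinCand G.Arc G.T S k.len u w v) := by
  simp [thinCandD, ThinCand, First]

@[simp] theorem markedD_encGraph : markedD k (encGraph G) (encArcs S) (num v) =
    encProp (Marked G.Arc G.T S k.len v) := by
  have : k.len + (k.len + 2) = 2 * k.len + 2 := by omega
  simp [markedD, Marked, First, this]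

theorem keepD_encGraph : keepD k (encGraph G) (encArcs S) (num v) =
    encProp (Keep G.Arc G.T S k.len v) := by
  simp [keepD, Keep]

end

/-! ### Renumbering the remaining vertices -/

section Restrict
open scoped Classical

variable (G : TerminalTournament) {R : Fin G.n → Fin G.n → Prop} (hR : IsTour R)
  (L : List (Fin G.n)) (hL : L.Nodup)

/-- The tournament with arc relation `R` on the vertices in the list `L`, renumbered. -/
noncomputable def TerminalTournament.restrict (hR : IsTour R) (hL : L.Nodup) : TerminalTournament where
  n := L.length
  D := {
    arc := fun i j => decide (R (L.get i) (L.get j))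
    loopless := fun u => by simp [hR.1]
    exactly_one := fun u v h => by
      simpa using hR.2 (L.get u) (L.get v) fun h' => h (hL.injective_get h') }
  T := Finset.univ.filter fun i => L.get i ∈ G.T

theorem mem_terminals_restrict (i : Fin L.length) :
    i ∈ (G.restrict L hR hL).T ↔ L.get i ∈ G.T :=
  Finset.mem_filter.trans (and_iff_right (Finset.mem_univ i))

theorem ofFn_get_eq_map {α β : Type} (L : List α) (f : α → β) :
    List.ofFn (fun i => f (L.get i)) = L.map f := by
  apply List.ext_getElem <;> simp

theorem encVec_get {α : Type} (L : List α) (p : α → Prop) :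
    encVec (fun i => decide (p (L.get i))) = encList (fun v => encProp (p v)) L := by
  rw [encVec, ofFn_get_eq_map L fun v => decide (p v)]
  simp [encList_eq, encProp_decide, Function.comp_def]

theorem encMat_get {α : Type} (L : List α) (r : α → α → Prop) :
    encMat (fun i j => decide (r (L.get i) (L.get j))) =
      encList (fun u => encList (fun v => encProp (r u v)) L) L := by
  rw [encMat, ofFn_get_eq_map L fun u => List.ofFn fun j => decide (r u (L.get j)), encList_eq,
    encList_eq, List.map_map]
  congr 2
  funext u
  exact encVec_get L (r u)

theorem encGraph_restrict : encGraph (G.restrict L hR hL) =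
    .cons (encList (fun u => encList (fun v => encProp (R u v)) L) L)
      (encList (fun v => encProp (v ∈ G.T)) L) := by
  rw [← encMat_get, ← encVec_get, encGraph]
  congr 2
  funext i
  exact decide_eq_decide.2 (mem_terminals_restrict G hR L hL i)

theorem solvable_restrict_iff {X : Finset (Fin G.n)} (hX : ∀ v, v ∈ X ↔ v ∈ L) {k : ℕ} :
    Solvable (G.restrict L hR hL).Arc (G.restrict L hR hL).T Finset.univ k ↔
      Solvable R G.T X k := by
  refine solvable_iff_of_embedding (e := L.get) hL.injective_get (fun v => ?_) (fun a b => ?_)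
    fun a => ?_
  · rw [hX, List.mem_iff_get]
    rfl
  · exact decide_eq_true_iff
  · exact mem_terminals_restrict G hR L hL a

end Restrict

/-- The vertices with a property, in increasing order. -/
noncomputable def vertsWith {n : ℕ} (p : Fin n → Prop) : List (Fin n) :=
  open Classical in (List.finRange n).filter fun i => decide (p i)

theorem nodup_vertsWith {n : ℕ} (p : Fin n → Prop) : (vertsWith p).Nodup :=
  (List.nodup_finRange n).filter _

theorem mem_vertsWith {n : ℕ} {p : Fin n → Prop} {v : Fin n} : v ∈ vertsWith p ↔ p v := by
  simp [vertsWith]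

theorem length_vertsWith {n : ℕ} (p : Fin n → Prop) : (vertsWith p).length = cnt p := by
  classical
  rw [← List.toFinset_card_of_nodup (nodup_vertsWith p), cnt_eq]
  congr 1
  ext v
  simp [mem_vertsWith]

theorem length_vertsWith_le {n : ℕ} (p : Fin n → Prop) : (vertsWith p).length ≤ n :=
  (List.length_filter_le _ _).trans_eq (List.length_finRange)

theorem filterD_vertList_eq {n : ℕ} {f : Dat → Dat} {p : Fin n → Prop}
    (h : ∀ v : Fin n, f (num v) = encProp (p v)) :
    filterD f (vertList n) = encList (fun i : Fin n => num i) (vertsWith p) := by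
  rw [filterD_vertList, vertsWith]
  congr 2
  funext i
  rw [h, Bool.eq_iff_iff]
  simp

theorem shrinkD_encGraph (G : TerminalTournament) (S : Finset (Fin G.n × Fin G.n)) (k : Dat) :
    shrinkD k (encGraph G) (encArcs S) = encGraph (G.restrict (vertsWith (Keep G.Arc G.T S k.len))
      G.isTour_arc (nodup_vertsWith _)) := by
  rw [encGraph_restrict, shrinkD, vertsD_encGraph, filterD_vertList_eq (keepD_encGraph G S k)]
  simp only [mapD_encList, entryD_encGraph, nthD_encGraph]

theorem rewireD_encGraph (G : TerminalTournament) (k : Dat) (o : Fin G.n) :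
    rewireD k (encGraph G) (num o) = encGraph (G.restrict
      (vertsWith (NewKeep G.Arc (SameClass G.Arc G.T · o) k.len))
      (R := newArc G.Arc (SameClass G.Arc G.T · o) k.len)
      (IsTour.newArc G.isTour_arc) (nodup_vertsWith _)) := by
  rw [encGraph_restrict, rewireD, vertsD_encGraph, filterD_vertList_eq (newKeepD_encGraph G k o)]
  simp only [mapD_encList, newArcD_encGraph, nthD_encGraph]

/-- All classes are small. -/
def SmallClasses (G : TerminalTournament) (k : ℕ) : Prop :=
  ∀ v, cnt (fun u => SameClass G.Arc G.T u v) ≤ 6 * k + 6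

section
open scoped Classical

/-- If not all classes are small, then one step of rewiring yields an equivalent smaller graph. -/
theorem exists_stepD_eq (G : TerminalTournament) (k : Dat) :
    ∃ G' : TerminalTournament, stepD k (encGraph G) = encGraph G' ∧
      (Solvable G'.Arc G'.T Finset.univ k.len ↔ Solvable G.Arc G.T Finset.univ k.len) ∧
      (G'.n < G.n ∨ G' = G ∧ SmallClasses G k.len) := by
  rw [stepD, vertsD_encGraph, filterD_vertList_eq (bigD_encGraph G k)]
  rcases hL : vertsWith fun o => o ∉ G.T ∧
    2 * k.len + 4 < cnt (Core G.Arc (SameClass G.Arc G.T · o) k.len) with _ | ⟨o, L⟩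
  · refine ⟨G, rfl, .rfl, .inr ⟨rfl, fun v => ?_⟩⟩
    have hv : ¬ _ := fun h => List.not_mem_nil (hL ▸ mem_vertsWith.2 h : v ∈ [])
    by_cases hvT : v ∈ G.T
    · rw [cnt, Finset.card_eq_zero.2 (Finset.filter_eq_empty_iff.2 fun u _ h => h.2.1 hvT)]
      omega
    · exact cnt_class_le G.isTour_arc (not_lt.1 fun h => hv ⟨hvT, h⟩)
  · obtain ⟨ho, hbig⟩ := mem_vertsWith.1 (hL ▸ List.mem_cons_self : o ∈ vertsWith fun o => o ∉ G.T ∧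
      2 * k.len + 4 < cnt (Core G.Arc (SameClass G.Arc G.T · o) k.len))
    refine ⟨_, rewireD_encGraph G k o, ?_, .inl ?_⟩
    · rw [solvable_restrict_iff (X := Finset.univ.filter
        (NewKeep G.Arc (SameClass G.Arc G.T · o) k.len)) (hX := fun v => by
          rw [Finset.mem_filter, mem_vertsWith]; exact and_iff_right (Finset.mem_univ v))]
      exact solvable_newKeep_iff G.isTour_arc (fun _ => .rfl) hbig
    · -- the core has a member that is not in the new core
      change (vertsWith _).length < _
      obtain ⟨v, hv, hv'⟩ := exists_coreRank_eq hbig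
      rw [length_vertsWith, cnt_eq]
      refine (Finset.card_lt_card (Finset.filter_ssubset.2 ⟨v, Finset.mem_univ v, fun h => ?_⟩)).trans_eq
        (by simp)
      have := h hv
      omega

end

/-- Sufficiently many steps of rewiring make all classes small. -/
theorem exists_foldl_stepD_eq (k : Dat) (L : List Dat) : ∀ G : TerminalTournament,
    ∃ G' : TerminalTournament, L.foldl (fun acc _ => stepD k acc) (encGraph G) = encGraph G' ∧
      (Solvable G'.Arc G'.T Finset.univ k.len ↔ Solvable G.Arc G.T Finset.univ k.len) ∧
      G'.n ≤ G.n ∧ (G.n ≤ L.length → SmallClasses G' k.len) := by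
  have key : ∀ G : TerminalTournament,
      ∃ G' : TerminalTournament, L.foldl (fun acc _ => stepD k acc) (encGraph G) = encGraph G' ∧
        (Solvable G'.Arc G'.T Finset.univ k.len ↔ Solvable G.Arc G.T Finset.univ k.len) ∧
        G'.n ≤ G.n ∧ (G'.n + L.length ≤ G.n ∨ SmallClasses G' k.len) := by
    induction L with
    | nil => exact fun G => ⟨G, rfl, .rfl, le_rfl, .inl le_rfl⟩
    | cons x L ih =>
      intro G
      obtain ⟨G₁, h1, h2, h3 | ⟨rfl, h3⟩⟩ := exists_stepD_eq G k
      · obtain ⟨G₂, h4, h5, h6, h7⟩ := ih G₁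
        refine ⟨G₂, by rw [List.foldl_cons, h1, h4], h5.trans h2, by omega, h7.imp_left fun h => ?_⟩
        rw [List.length_cons]; omega
      · exact ⟨G₁, List.foldl_fixed' (fun _ => h1) _, .rfl, le_rfl, .inr h3⟩
  intro G
  obtain ⟨G', h1, h2, h3, h4⟩ := key G
  refine ⟨G', h1, h2, h3, fun h => h4.elim (fun h' v => ?_) id⟩
  exact absurd v.isLt (by omega)

/-! ### Programs and polynomial-time functions -/

/-- Clear the variables `1, …, n + 1`. -/
def clearVars : ℕ → Prog
  | 0 => .clear 1
  | n + 1 => .seq (.clear (n + 2)) (clearVars n)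

theorem exec_clearVars (n : ℕ) : ∀ s : Store,
    Exec (clearVars n) s (fun x => if 0 < x ∧ x < n + 2 then .nil else s x) (n + 1) := by
  induction n with
  | zero =>
    intro s
    refine Exec.clear' (funext fun x => ?_)
    by_cases h : x = 1
    · simp [h]
    · rw [Function.update_of_ne h, if_neg (by omega)]
  | succ n ih =>
    intro s
    have h1 := Exec.seq (Exec.clear s (n + 2)) (ih (Function.update s (n + 2) .nil))
    convert h1 using 1
    · rfl
    · funext x
      by_cases h : x = n + 2
      · simp [h]
      · rw [Function.update_of_ne h]
        by_cases h' : 0 < x ∧ x < n + 2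
        · rw [if_pos h', if_pos (by omega)]
        · rw [if_neg h', if_neg (by omega)]
    · omega

section

variable {ι : Type} {enc : ι → Dat}

/-- A program that produces correct outputs can be normalized. -/
theorem RunsInPolyTime.exists_polyTime {P : Prog} {C : ι → Dat → Prop}
    (h : RunsInPolyTime enc P C) : ∃ f : ι → Dat, PolyTime enc f ∧ ∀ i, C i (f i) := by
  obtain ⟨p, hp⟩ := h
  choose s t he ht hC using hp
  refine ⟨fun i => s i 0, ⟨.seq P (clearVars P.bound), P.bound + 2, p + (P.bound + 1 : ℕ),
    fun i r hr hn => ?_⟩, hC⟩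
  have h1 := (he i).frame (N := P.bound + 2) (by omega) r fun x hx => by
    by_cases h : x = 0
    · subst h; simp [initial, hr]
    · simp [initial, h, hn x (by omega) hx]
  refine ⟨t i + (P.bound + 1), ?_, ?_⟩
  · have := ht i
    simp
    omega
  · have h2 := Exec.seq h1 (exec_clearVars P.bound _)
    convert h2 using 1
    funext x
    by_cases h : x = 0
    · subst h; simp [Store.mix]
    · rw [Function.update_of_ne h]
      by_cases h' : x < P.bound + 2
      · rw [if_pos ⟨by omega, h'⟩, hn x (by omega) h']
      · rw [if_neg (by omega), Store.mix, if_neg h']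

theorem PolyTime.exists_runs {f : ι → Dat} (hf : PolyTime enc f) {C : ι → Dat → Prop}
    (hC : ∀ i, C i (f i)) : ∃ P, RunsInPolyTime enc P C := by
  obtain ⟨P, N, p, hP⟩ := hf
  refine ⟨P, p, fun i => ?_⟩
  obtain ⟨t, ht, he⟩ := hP i (initial (enc i)) (by simp [initial])
    fun x hx _ => by simp [initial, hx.ne']
  exact ⟨_, t, he, ht, by simpa using hC i⟩

end

/-! ### Unary numbers from the input -/

theorem size_appendD (a b : Dat) : (appendD a b).size + 1 = a.size + b.size := by
  conv_rhs => rw [← Dat.ofList_toList a, ← Dat.ofList_toList b]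
  rw [appendD, Dat.size_ofList, Dat.size_ofList, Dat.size_ofList, List.map_append, List.sum_append]
  omega

/-- Concatenation of the members of a list. -/
def concatD (l : Dat) : Dat := l.toList.foldl (fun acc x => appendD x acc) .nil

theorem size_foldl_appendD (L : List Dat) :
    (L.foldl (fun acc x => appendD x acc) .nil).size ≤ (Dat.ofList L).size := by
  induction L using List.reverseRecOn with
  | nil => simp [Dat.ofList]
  | append_singleton L x ih =>
    have h := size_appendD x (L.foldl (fun acc x => appendD x acc) .nil)
    rw [Dat.size_ofList] at ih ⊢
    rw [List.foldl_append, List.map_append, List.sum_append]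
    simp only [List.foldl_cons, List.foldl_nil, List.map_cons, List.map_nil, List.sum_cons,
      List.sum_nil]
    omega

theorem len_foldl_appendD (L : List Dat) :
    (L.foldl (fun acc x => appendD x acc) .nil).len = (L.map Dat.len).sum := by
  induction L using List.reverseRecOn with
  | nil => rfl
  | append_singleton L x ih => simp [ih, add_comm]

theorem len_concatD (l : Dat) : (concatD l).len = (l.toList.map Dat.len).sum := len_foldl_appendD _

@[fun_prop]
theorem PolyFun.concatD {l : Dat → Dat} (hl : PolyFun l) : PolyFun fun d => concatD (l d) := by
  obtain ⟨q, hq⟩ := hl.size_le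
  refine PolyFun.foldl (F := fun _ x acc => SFAST.appendD x acc) hl (by fun_prop) (by fun_prop) q
    fun d L hL => (size_foldl_appendD L).trans (le_trans ?_ (hq d))
  conv_rhs => rw [← Dat.ofList_toList (l d)]
  rw [Dat.size_ofList, Dat.size_ofList]
  have := sum_size_le_of_prefix hL
  omega

/-- Doubling, plus a bit, up to the length of `c`. -/
def capStepD (c b acc : Dat) : Dat :=
  (ltD (appendD acc (appendD acc b)) c).cond (unD (appendD acc (appendD acc b))) c

@[fun_prop]
theorem PolyFun.capStepD {c b a : Dat → Dat} (hc : PolyFun c) (hb : PolyFun b) (ha : PolyFun a) :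
    PolyFun fun d => capStepD (c d) (b d) (a d) := by
  unfold SFAST.capStepD; fun_prop

theorem size_capStepD (c b acc : Dat) : (capStepD c b acc).size ≤ 2 * c.size := by
  rw [capStepD, ltD_eq]
  classical
  rw [cond_encProp]
  split_ifs with h
  · have := c.length_toList_lt
    rw [unD_eq, size_num]
    rw [Dat.len] at h ⊢
    rw [Dat.len] at h
    omega
  · omega

theorem len_capStepD (c b acc : Dat) :
    (capStepD c b acc).len = min (2 * acc.len + b.len) c.len := by
  rw [capStepD, ltD_eq]
  classical
  rw [cond_encProp]
  split_ifs with h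
  · rw [unD_eq, len_num]
    simp at h ⊢
    omega
  · simp at h
    omega

/-- The minimum of a number in binary, given by its bits `l`, and the length of the list `c`. -/
def capD (c l : Dat) : Dat := (reverseD l).toList.foldl (fun acc b => capStepD c b acc) .nil

@[fun_prop]
theorem PolyFun.capD {c l : Dat → Dat} (hc : PolyFun c) (hl : PolyFun l) :
    PolyFun fun d => capD (c d) (l d) := by
  obtain ⟨q, hq⟩ := hc.size_le
  refine PolyFun.foldl (F := fun d b acc => SFAST.capStepD (c d) b acc) hl.reverseD (by fun_prop)
    ?_ (2 * q + 1) fun d L _ => ?_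
  · exact PolyFun.capStepD (PolyFun.comp' hc (by fun_prop)) (by fun_prop) (by fun_prop)
  · induction L using List.reverseRecOn with
    | nil => simp [Dat.size]
    | append_singleton L x _ =>
      have h1 := hq d
      have h2 := size_capStepD (c d) x (L.foldl (fun acc b => SFAST.capStepD (c d) b acc) .nil)
      simp at h1 h2 ⊢
      omega

theorem len_encBool (b : Bool) : (encBool b).len = b.toNat := by cases b <;> rfl

theorem foldr_bits (k : ℕ) : k.bits.foldr (fun b acc => 2 * acc + b.toNat) 0 = k := by
  induction k using Nat.binaryRec' with
  | zero => rfl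
  | bit b n h ih =>
    rw [Nat.bits_append_bit n b h, List.foldr_cons, ih, Nat.bit_val]

theorem len_capD (c : Dat) (k : ℕ) : (capD c (encNat k)).len = min k c.len := by
  rw [capD, encNat, encList_eq, reverseD, Dat.toList_ofList, Dat.toList_ofList, List.foldl_reverse]
  conv_rhs => rw [← foldr_bits k]
  induction k.bits with
  | nil => simp [Dat.len, Dat.toList]
  | cons b L ih =>
    rw [List.map_cons, List.foldr_cons, List.foldr_cons, len_capStepD, ih, len_encBool]
    omega

/-- The minimum of the parameter of an instance and the square of the number of vertices. -/
def paramD (d : Dat) : Dat := capD (concatD d.left.left) d.right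

@[fun_prop]
theorem PolyFun.paramD {f : Dat → Dat} (hf : PolyFun f) : PolyFun fun d => paramD (f d) := by
  unfold SFAST.paramD; fun_prop

theorem toList_encMat {n : ℕ} (M : Fin n → Fin n → Bool) :
    (encMat M).toList = List.ofFn fun i => encVec (M i) := by
  rw [encMat, encList_eq, Dat.toList_ofList, List.map_ofFn]
  rfl

theorem len_paramD (X : Instance) : (paramD (encInstance X)).len = min X.k (X.n * X.n) := by
  have h : ∀ v : Fin X.n → Bool, (encVec v).len = X.n := fun v => by
    simp [encVec, encList_eq, Dat.len]
  rw [paramD, encInstance, Dat.right, len_capD, len_concatD]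
  simp only [encGraph, Dat.left, toList_encMat, List.map_ofFn]
  simp [h, Function.comp_def]

/-- The number of arcs in a set, in unary. -/
def arcCountD (g S : Dat) : Dat :=
  concatD (mapD (fun u => filterD (fun v => entryD S u v) (vertsD g)) (vertsD g))

@[fun_prop]
theorem PolyFun.arcCountD {g S : Dat → Dat} (hg : PolyFun g) (hS : PolyFun S) :
    PolyFun fun d => arcCountD (g d) (S d) :=
  PolyFun.lift₂ (by unfold SFAST.arcCountD; fun_prop) hg hS

theorem len_arcCountD (G : TerminalTournament) (S : Finset (Fin G.n × Fin G.n)) :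
    (arcCountD (encGraph G) (encArcs S)).len = S.card := by
  classical
  rw [arcCountD, len_concatD, vertsD_encGraph]
  conv_lhs => enter [1, 2, 1, 2]; rw [vertList]
  rw [mapD_encList, encList_eq, Dat.toList_ofList, List.map_map]
  simp only [Function.comp_def, len_filterD_vertList, entryD_encArcs, truth_encProp]
  have h : S = Finset.univ.filter (· ∈ S) := by simp
  conv_rhs => rw [h, Finset.card_filter, Fintype.sum_prod_type]
  rw [Fin.sum_univ_def]
  simp only [cnt, Finset.card_filter]
  refine congrArg List.sum (List.map_congr_left fun u _ => Finset.sum_congr rfl fun v _ => ?_)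
  congr

/-- Multiplication of a number in unary by a constant. -/
def mulD : ℕ → Dat → Dat
  | 0, _ => .nil
  | a + 1, d => appendD d (mulD a d)

theorem PolyFun.mulD (a : ℕ) {f : Dat → Dat} (hf : PolyFun f) : PolyFun fun d => mulD a (f d) := by
  induction a with
  | zero => exact PolyFun.const _
  | succ a ih => exact hf.appendD ih

theorem len_mulD (a : ℕ) (d : Dat) : (mulD a d).len = a * d.len := by
  induction a with
  | zero => simp [mulD, Dat.len, Dat.toList]
  | succ a ih => simp [mulD, ih]; ring

/-- The parameter may be replaced by its minimum with the square of the number of vertices. -/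
theorem Instance.isYes_iff_min (Y : Instance) {m : ℕ} (h : Y.n * Y.n ≤ m) :
    Y.IsYes ↔ Solvable Y.Arc Y.T Finset.univ (min Y.k m) := by
  rw [Y.isYes_iff]
  rcases le_total Y.k m with h' | h'
  · rw [min_eq_left h']
    rfl
  · rw [min_eq_right h']
    exact iff_of_true (solvable_of_sq_le (h.trans h')) (solvable_of_sq_le h)

/-! ### The kernelization -/

theorem size_encVec_le {n : ℕ} (v : Fin n → Bool) : (encVec v).size ≤ 4 * n + 1 := by
  rw [encVec, encList_eq, Dat.size_ofList]
  have h := List.sum_le_card_nsmul (((List.ofFn v).map encBool).map fun a => a.size + 1) 4 (by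
    intro x hx
    simp only [List.map_map, List.mem_map] at hx
    obtain ⟨b, -, rfl⟩ := hx
    cases b <;> simp [encBool, Dat.size])
  simp only [List.length_map, List.length_ofFn, smul_eq_mul] at h
  omega

theorem size_encGraph_le (G : TerminalTournament) :
    (encGraph G).size ≤ (4 * .X ^ 2 + 6 * .X + 3 : Polynomial ℕ).eval G.n := by
  have h1 := size_encVec_le fun v => decide (v ∈ G.T)
  have h2 := List.sum_le_card_nsmul ((encMat G.D.arc).toList.map fun a => a.size + 1)
    (4 * G.n + 2) (by
      intro x hx
      simp only [toList_encMat, List.mem_map, List.mem_ofFn] at hx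
      obtain ⟨_, ⟨u, rfl⟩, rfl⟩ := hx
      have := size_encVec_le (G.D.arc u)
      omega)
  have h3 := Dat.size_ofList (encMat G.D.arc).toList
  rw [Dat.ofList_toList] at h3
  rw [List.length_map, toList_encMat, List.length_ofFn, smul_eq_mul, ← toList_encMat] at h2
  simp only [encGraph, Dat.size, Polynomial.eval_add, Polynomial.eval_mul, Polynomial.eval_pow,
    Polynomial.eval_X, Polynomial.eval_ofNat]
  nlinarith

theorem length_rows (X : Instance) : (encInstance X).left.left.toList.length = X.n :=
  len_encMat X.D.arc

/-- Rewiring as a polynomial-time transformation of instances: every effective step removes a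
vertex, so as many steps as there are vertices suffice. -/
theorem exists_rewiring : ∃ φ : Instance → Instance,
    PolyTime encInstance (fun X => encInstance (φ X)) ∧
    ∀ X, (φ X).k = X.k ∧ (φ X).n ≤ X.n ∧
      SmallClasses (φ X).toTerminalTournament (min X.k (X.n * X.n)) ∧
      (Solvable (φ X).Arc (φ X).T Finset.univ (min X.k (X.n * X.n)) ↔
        Solvable X.Arc X.T Finset.univ (min X.k (X.n * X.n))) := by
  have key := fun X : Instance => exists_foldl_stepD_eq (paramD (encInstance X))
    (encInstance X).left.left.toList X.toTerminalTournament
  choose ψ h1 h2 h3 h4 using key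
  refine ⟨fun X => { ψ X with k := X.k }, ?_, fun X => ⟨rfl, h3 X, ?_, ?_⟩⟩
  · have h5 : PolyTime encInstance fun X => (encInstance X).left.left.toList.foldl
        (fun acc _ => stepD (paramD (encInstance X)) acc) (encInstance X).left := by
      refine PolyTime.foldl (F := fun d _ acc => stepD (paramD d) acc) PolyTime.of_copy.left.left
        PolyTime.of_copy.left (by fun_prop) (4 * .X ^ 2 + 6 * .X + 3) fun X L _ => ?_
      obtain ⟨G, h6, -, h7, -⟩ := exists_foldl_stepD_eq (paramD (encInstance X)) L
        X.toTerminalTournament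
      refine (congrArg Dat.size h6).trans_le ((size_encGraph_le G).trans (polyEval_mono _ ?_))
      refine h7.trans ?_
      have h8 := (encInstance X).left.left.length_toList_lt
      rw [length_rows] at h8
      have h9 := (encInstance X).size_left_le
      have h10 := (encInstance X).left.size_left_le
      omega
    exact (h5.cons PolyTime.of_copy.right).congr fun X => congrArg (Dat.cons · _) (h1 X)
  · have := h4 X (length_rows X).ge
    rwa [len_paramD] at this
  · have := h2 X
    rwa [len_paramD] at this

/-- A directed triangle with a terminal, and the parameter `0`. -/
def noInstance : Instance where
  n := 3
  D := { arc := fun u v => decide (v = u + 1), loopless := by decide, exactly_one := by decide }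
  T := {0}
  k := 0

theorem not_isYes_noInstance : ¬ noInstance.IsYes := by
  rintro ⟨S, hS, hk⟩
  have hS0 : S = ∅ := Finset.card_eq_zero.1 (Nat.le_zero.1 hk)
  subst hS0
  have h : ∀ u v : Fin 3, v = u + 1 →
      Relation.TransGen (fun u v : Fin 3 => noInstance.D.arc u v = true ∧
        (u, v) ∉ (∅ : Finset (Fin 3 × Fin 3))) u v :=
    fun u v huv => .single ⟨decide_eq_true huv, Finset.notMem_empty _⟩
  exact not_transGen_of_isFeedback hS (t := (0 : Fin 3)) (Finset.mem_singleton_self (0 : Fin 3))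
    (((h 0 1 rfl).trans (h 1 2 rfl)).trans (h 2 0 rfl))

/-- The output of the kernelization, given the instance `d`, the rewired instance `e`, and the
output `r` of the approximation algorithm for the latter. -/
def finishD (d e r : Dat) : Dat :=
  r.cond (.cons (shrinkD (paramD d) e.left r.left) d.right) (encInstance noInstance)

theorem PolyFun.finishD : PolyFun fun e => finishD e.left e.right.left e.right.right := by
  unfold SFAST.finishD; fun_prop

/-- The kernel has at most three vertices, or at most `15 s k + 17 s` vertices, where `s` is the
size of the approximate solution. -/
theorem hasKernel_of_hasParamApproximation {α : ℕ → ℝ} (hα : ∀ k, 1 ≤ α k)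
    (h : HasParamApproximation α) :
    HasKernel fun k => 15 * α k * (k : ℝ) ^ 2 + 17 * α k * k + 4 := by
  obtain ⟨P, hP⟩ := h
  obtain ⟨f, hf, hfC⟩ := hP.exists_polyTime
  obtain ⟨φ, hφ, hφ'⟩ := exists_rewiring
  have hrun : PolyTime encInstance fun X => finishD (encInstance X) (encInstance (φ X)) (f (φ X)) :=
    PolyTime.comp PolyFun.finishD
      (PolyTime.of_copy.cons (hφ.cons (PolyTime.comp hf hφ fun _ => rfl))) fun _ => rfl
  classical
  refine hrun.exists_runs fun X => ?_
  obtain ⟨hk, hn, hsmall, hsolv⟩ := hφ' X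
  have hlen := len_paramD X
  rcases hfC (φ X) with ⟨S, hS, hfb, hcard⟩ | ⟨hr, hno⟩
  · rw [hS]
    refine ⟨.mk ((φ X).restrict (vertsWith (Keep (φ X).Arc (φ X).T S (paramD (encInstance X)).len))
        (φ X).isTour_arc (nodup_vertsWith _)) X.k,
      congrArg (Dat.cons · _) (shrinkD_encGraph (φ X).toTerminalTournament S _), ?_, le_rfl, ?_⟩
    · have hcnt := (length_vertsWith_le
        (Keep (φ X).Arc (φ X).T S (paramD (encInstance X)).len)).trans hn
      rw [Instance.isYes_iff_min _ (Nat.mul_le_mul hcnt hcnt), X.isYes_iff_min le_rfl, ← hsolv]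
      refine (solvable_restrict_iff (X := Finset.univ.filter
        (Keep (φ X).Arc (φ X).T S (paramD (encInstance X)).len)) _ (φ X).isTour_arc _
        (nodup_vertsWith _) fun v => by
          rw [Finset.mem_filter, mem_vertsWith]; exact and_iff_right (Finset.mem_univ v)).trans ?_
      rw [hlen]
      exact solvable_keep_iff (φ X).isTour_arc fun t ht => not_transGen_of_isFeedback hfb ht
    · change ((vertsWith _).length : ℝ) < _
      rw [length_vertsWith, hlen]
      have h1 := cnt_keep_le (k := min X.k (X.n * X.n)) (φ X).isTour_arc
        (fun t ht => not_transGen_of_isFeedback hfb ht) hsmall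
      have h2 : (15 * S.card * min X.k (X.n * X.n) + 17 * S.card : ℕ) ≤
          15 * S.card * X.k + 17 * S.card :=
        Nat.add_le_add_right (Nat.mul_le_mul_left _ (min_le_left _ _)) _
      have h3 : (cnt (Keep (φ X).Arc (φ X).T S (min X.k (X.n * X.n))) : ℝ) ≤
          15 * S.card * X.k + 17 * S.card := by exact_mod_cast h1.trans h2
      rw [hk] at hcard
      have h4 : (0 : ℝ) ≤ X.k := Nat.cast_nonneg _
      have h5 := mul_le_mul_of_nonneg_right hcard h4
      calc _ ≤ _ := h3
        _ < _ := by nlinarith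
  · rw [hr]
    refine ⟨noInstance, rfl, iff_of_false not_isYes_noInstance ?_, Nat.zero_le _, ?_⟩
    · rwa [X.isYes_iff_min le_rfl, ← hsolv, ← hk, ← (φ X).isYes_iff_min (Nat.mul_le_mul hn hn)]
    · have := hα X.k
      change ((3 : ℕ) : ℝ) < _
      push_cast
      have : 0 ≤ 15 * α X.k * (X.k : ℝ) ^ 2 + 17 * α X.k * X.k := by positivity
      linarith

/-- The solution `r` for the instance `d` if its size is at most `a` times the parameter, or else
`nil`. -/
def selectD (a : ℕ) (d r : Dat) : Dat :=
  (ltD (mulD a (paramD d)) (arcCountD d.left r)).cond .nil (.cons r .nil)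

theorem PolyFun.selectD (a : ℕ) : PolyFun fun e => selectD a e.left e.right := by
  have h : PolyFun fun e => SFAST.mulD a (SFAST.paramD e.left) := PolyFun.mulD a (by fun_prop)
  unfold SFAST.selectD
  fun_prop

theorem PolyTime.selectD (a : ℕ) {f : TerminalTournament → Dat} (hf : PolyTime encGraph f) :
    PolyTime encInstance fun X => selectD a (encInstance X) (f X.toTerminalTournament) := by
  have h1 : PolyTime encInstance fun X => f X.toTerminalTournament :=
    hf.comp (φ := Instance.toTerminalTournament) PolyTime.of_copy.left fun _ => rfl
  have h2 : PolyTime encInstance fun X => (fun e => SFAST.selectD a e.left e.right)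
      (Dat.cons (encInstance X) (f X.toTerminalTournament)) := by
    exact PolyTime.comp (φ := fun X : Instance => Dat.cons (encInstance X) (f X.toTerminalTournament))
      (PolyFun.selectD a) (PolyTime.of_copy.cons h1) fun _ => rfl
  exact h2

/-- An approximation algorithm decides whether its solution is small enough; the parameter, given
in binary, is first replaced by its minimum with the square of the number of vertices, which no
set of arcs exceeds. -/
theorem HasApproximation.hasParamApproximation {α : ℝ} {a : ℕ} (ha : 1 ≤ a) (hα : α ≤ a)
    (h : HasApproximation α) : HasParamApproximation fun _ => (a : ℝ) := by
  obtain ⟨P, hP⟩ := h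
  obtain ⟨f, hf, hfC⟩ := hP.exists_polyTime
  have hrun := hf.selectD a
  refine hrun.exists_runs fun X => ?_
  obtain ⟨S, hS, hfb, hmin⟩ := hfC X.toTerminalTournament
  have hlen := len_paramD X
  have hcount : (arcCountD (encInstance X).left (encArcs S)).len = S.card :=
    len_arcCountD X.toTerminalTournament S
  classical
  have hsel : selectD a (encInstance X) (f X.toTerminalTournament) =
      if a * min X.k (X.n * X.n) < S.card then .nil else .cons (encArcs S) .nil := by
    rw [selectD, hS, ltD_eq, len_mulD, cond_encProp, hcount, hlen]
  rw [hsel]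
  split_ifs with h
  · refine .inr ⟨rfl, ?_⟩
    rintro ⟨S', hS', hk⟩
    have h2 : S.card ≤ a * S'.card := by
      have : (S.card : ℝ) ≤ a * S'.card :=
        (hmin S' hS').trans (mul_le_mul_of_nonneg_right hα (Nat.cast_nonneg _))
      exact_mod_cast this
    have h3 : S.card ≤ X.n * X.n := (Finset.card_le_univ S).trans_eq (by simp)
    rcases le_total X.k (X.n * X.n) with h4 | h4
    · rw [min_eq_left h4] at h
      exact absurd (h2.trans (Nat.mul_le_mul_left _ hk)) (not_le.2 h)
    · rw [min_eq_right h4] at h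
      exact absurd (h3.trans (Nat.le_mul_of_pos_left _ ha)) (not_le.2 h)
  · refine .inl ⟨S, rfl, hfb, ?_⟩
    have h2 := (not_lt.1 h).trans (Nat.mul_le_mul_left _ (min_le_left _ _))
    change (S.card : ℝ) ≤ (a : ℝ) * X.k
    exact_mod_cast h2

theorem HasKernel.mono {f g : ℕ → ℝ} (h : HasKernel f) (hfg : ∀ k, f k ≤ g k) : HasKernel g := by
  obtain ⟨P, p, hP⟩ := h
  refine ⟨P, p, fun X => ?_⟩
  obtain ⟨s, t, he, ht, Y, h1, h2, h3, h4⟩ := hP X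
  exact ⟨s, t, he, ht, Y, h1, h2, h3, h4.trans_le (hfg _)⟩

end SFAST

theorem mainTheorem1 :
    (∀ α : ℝ, 1 ≤ α → SFAST.HasApproximation α →
      SFAST.HasKernel fun k => SFAST.kernelBound α k) ∧
    (∀ α : ℕ → ℝ, (∀ k, 1 ≤ α k) → SFAST.HasParamApproximation α →
      SFAST.HasKernel fun k => SFAST.kernelBound (α k) k) ∧
    (∃ C : ℝ, ∀ (α : ℝ) (k : ℕ), 1 ≤ α → 1 ≤ k →
      SFAST.kernelBound α k ≤ C * (α * k) ^ 2) := by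
  refine ⟨fun α hα h => ?_, fun α hα h => ?_, 88, fun α k hα hk => ?_⟩
  · have hα' : α ≤ ⌈α⌉₊ := Nat.le_ceil α
    refine (SFAST.hasKernel_of_hasParamApproximation (fun _ => hα.trans hα')
      (h.hasParamApproximation (Nat.one_le_cast.1 (hα.trans hα')) hα')).mono fun k => ?_
    have h1 : (⌈α⌉₊ : ℝ) ≤ α + 1 := (Nat.ceil_lt_add_one (zero_le_one.trans hα)).le
    have hk : (0 : ℝ) ≤ k := Nat.cast_nonneg _
    have h2 : 15 * (⌈α⌉₊ : ℝ) ≤ 6 * α * (3 * α + 5) := by nlinarith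
    have h3 : 17 * (⌈α⌉₊ : ℝ) ≤ 21 * α + 13 := by linarith
    have h4 := mul_le_mul_of_nonneg_right h2 (sq_nonneg (k : ℝ))
    have h5 := mul_le_mul_of_nonneg_right h3 hk
    unfold SFAST.kernelBound
    linarith
  · refine (SFAST.hasKernel_of_hasParamApproximation hα h).mono fun k => ?_
    have hk : (0 : ℝ) ≤ k := Nat.cast_nonneg _
    have h1 := hα k
    have h2 : 15 * α k ≤ 6 * α k * (3 * α k + 5) := by nlinarith
    have h3 : 17 * α k ≤ 21 * α k + 13 := by linarith
    have h4 := mul_le_mul_of_nonneg_right h2 (sq_nonneg (k : ℝ))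
    have h5 := mul_le_mul_of_nonneg_right h3 hk
    unfold SFAST.kernelBound
    linarith
  · have hk' : (1 : ℝ) ≤ k := by exact_mod_cast hk
    have h1 : (1 : ℝ) ≤ α * k := by nlinarith
    have h2 : (k : ℝ) ≤ α * k := by nlinarith
    have h3 : α * (k : ℝ) ^ 2 ≤ (α * k) ^ 2 := by
      nlinarith [mul_nonneg (sub_nonneg.2 h2) (by linarith : (0 : ℝ) ≤ α * k)]
    have h4 : α * k ≤ (α * k) ^ 2 := by nlinarith
    unfold SFAST.kernelBound
    nlinarith
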